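/- For $\tau$ in the upper half plane $\mathcal H$ put $q=e^{2\pi i\tau}$, $y=\mathrm{Im}\,\tau$, and let $\zeta_c=e^{2\pi i/c}$, $(z;q)_\infty=\prod_{j\ge0}(1-zq^j)$, $[z;q]_\infty=(z;q)_\infty(q/z;q)_\infty$. For $u,v\notin\mathbb Z+\tau\mathbb Z$ let $$\vartheta(z;\tau)=\sum_{n\in\mathbb Z+\frac12}e^{\pi in^2\tau+2\pi in(z+\frac12)},\qquad \mu(u,v;\tau)=\frac{e^{\pi iu}}{\vartheta(v;\tau)}\sum_{n\in\mathbb Z}\frac{(-1)^ne^{\pi in(n+1)\tau+2\pi inv}}{1-e^{2\pi in\tau+2\pi iu}},$$ $$R(u;\tau)=\sum_{n\in\mathbb Z+\frac12}\Big(\mathrm{sgn}(n)-E\big((n+\tfrac{\mathrm{Im}\,u}{y})\sqrt{2y}\big)\Big)(-1)^{n-\frac12}e^{-\pi in^2\tau-2\pi inu},\qquad E(x)=2\int_0^xe^{-\pi w^2}dw,$$ and $\tilde\mu(u,v;\tau)=\mu(u,v;\tau)+\frac i2R(u-v;\tau)$. For integers $a,c$ with $c>0$ and $c\nmid 2a$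 let $$N(a,c;\tau)=q^{-1/4}\,\tilde\mu\big(\tfrac{2a}{c},\tau;2\tau\big),\qquad P(a,c;\tau)=\frac{(-q;q)_\infty\,(q^2;q^2)_\infty^2}{(q;q)_\infty\,[\zeta_c^{2a};q^2]_\infty}.$$ A function $f$ on $\mathcal H$ with an expansion $f(\tau)=\sum_{m\ge m_0}a(m)e^{2\pi i\tau m/M}$, where $M$ is a positive integer and $a(m_0)\ne0$, has invariant order $m_0/M$ at $\infty$ (the zero function has order $+\infty$). The holomorphic part of a function $F$ on $\mathcal H$, of weight $k$, is the function $F^+$ in a decomposition $F=F^++F^-$ with, for some positive integer $M$, $$F^+(\tau)=\sum_{n\ge n_0}a(n)q^{n/M},\qquad F^-(\tau)=\sum_{n\ge1}b(n)\,\Gamma\big(1-k,\tfrac{4\pi ny}{M}\big)q^{-n/M},\qquad \Gamma(s,x)=\int_x^\infty e^{-t}t^{s-1}dt.$$ For coprime non-negative integers $\alpha,\gamma$, the invariant order of a function $f$ of weight $\frac12$ (respectively of its holomorphic part) at the cusp $\alpha/\gamma$ is the invariant order at $\infty$ of $(\gamma\tau+\delta)^{-1/2}f\big(\frac{\alpha\tau+\beta}{\gamma\tau+\delta}\big)$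 (respectively of the holomorphic part of this function, for the weight $\frac12$), where $\begin{pmatrix}\alpha&\beta\\\gamma&\delta\end{pmatrix}\in\mathrm{SL}_2(\mathbb Z)$; the statements below hold for every such matrix with first column $(\alpha,\gamma)$, and include the existence of the decomposition and of the expansions. Write $x=\lfloor x\rfloor+\{x\}$ with $\lfloor x\rfloor\in\mathbb Z$, $0\le\{x\}<1$. For $0\le u,w<1$ put $\nu(u,w)=\frac{u+w}2-\frac18$ if $u+w\le1$ and $\nu(u,w)=\frac78-\frac{u+w}2$ if $u+w>1$. For real $u,w$ put $$\tilde\nu(u,w)=\tfrac12(\lfloor u\rfloor-\lfloor w\rfloor)^2+(\lfloor u\rfloor-\lfloor w\rfloor)(\{u\}-\{w\})+k(u,w),$$ where $k(u,w)=\nu(\{u\},\{w\})$ if $\{u\}-\{w\}\ne\pm\frac12$, and $k(u,w)=\min\big(\frac18,\nu(\{u\},\{w\})\big)$ if $\{u\}-\{w\}=\pm\frac12$. **Theorem.** Let $a,c$ be integers with $c>0$ and $c\nmid2a$, and let $\alpha,\gamma$ be non-negative integers with $\gcd(\alpha,\gamma)=1$. 1. If $\gamma$ is even, the invariant order of the holomorphic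 part of $N(a,c;\tau)$ at the cusp $\frac\alpha\gamma$ is at least $$-\frac{a^2\gamma^2}{c^2}+\frac{a\gamma}{c}-\frac14+2\tilde\nu\Big(\frac{a\gamma}{c},\frac12\Big).$$ 2. If $\gamma$ is odd, the invariant order of the holomorphic part of $N(a,c;\tau)$ at the cusp $\frac\alpha\gamma$ is at least $$-\frac{a^2\gamma^2}{c^2}+\frac{a\alpha\gamma}{c}-\frac{\alpha^2}4+\frac12\tilde\nu\Big(\frac{2a\gamma}{c},\alpha\Big).$$ 3. If $\gamma$ is even, the invariant order of $P(a,c;\tau)$ at the cusp $\frac\alpha\gamma$ is exactly $$\Big\{\frac{a\gamma}{c}\Big\}-\Big\{\frac{a\gamma}{c}\Big\}^2.$$ 4. If $\gamma$ is odd, the invariant order of $P(a,c;\tau)$ at the cusp $\frac\alpha\gamma$ is exactly $$\frac14\Big\{\frac{2a\gamma}{c}\Big\}-\frac14\Big\{\frac{2a\gamma}{c}\Big\}^2-\frac1{16}.$$ -/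

import Mathlib

open scoped UpperHalfPlane MatrixGroups

noncomputable section

namespace OverpartitionRank

/-! ### The functions `ϑ`, `μ`, `R` and `μ̃` -/

/-- `ϑ(z;τ) = ∑_{m ∈ ℤ + 1/2} exp(π i m² τ + 2 π i m (z + 1/2))`, with `m = n + 1/2`. -/
def theta (z τ : ℂ) : ℂ :=
  ∑' n : ℤ, Complex.exp (Real.pi * Complex.I * ((n : ℂ) + 1 / 2) ^ 2 * τ
    + 2 * Real.pi * Complex.I * ((n : ℂ) + 1 / 2) * (z + 1 / 2))

/-- `μ(u,v;τ)`. -/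
def mu (u v τ : ℂ) : ℂ :=
  Complex.exp (Real.pi * Complex.I * u) / theta v τ *
    ∑' n : ℤ, (-1 : ℂ) ^ n *
      Complex.exp (Real.pi * Complex.I * n * (n + 1) * τ + 2 * Real.pi * Complex.I * n * v) /
        (1 - Complex.exp (2 * Real.pi * Complex.I * n * τ + 2 * Real.pi * Complex.I * u))

/-- `E(x) = 2 ∫_0^x exp(-π w²) dw`. Only real arguments occur in `R`. -/
def E (x : ℝ) : ℝ :=
  2 * ∫ w in (0 : ℝ)..x, Real.exp (-Real.pi * w ^ 2)

/-- `R(u;τ) = ∑_{m ∈ ℤ + 1/2} (sgn m - E((m + a) √(2y))) (-1)^(m - 1/2) exp(-π i m² τ - 2 π i m u)`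
with `y = Im τ`, `a = Im u / Im τ`; here `m = n + 1/2`. -/
def R (u τ : ℂ) : ℂ :=
  ∑' n : ℤ,
    ((Real.sign ((n : ℝ) + 1 / 2)
        - E (((n : ℝ) + 1 / 2 + u.im / τ.im) * Real.sqrt (2 * τ.im)) : ℝ) : ℂ) *
      (-1 : ℂ) ^ n *
      Complex.exp (-(Real.pi * Complex.I * ((n : ℂ) + 1 / 2) ^ 2 * τ)
        - 2 * Real.pi * Complex.I * ((n : ℂ) + 1 / 2) * u)

/-- `μ̃(u,v;τ) = μ(u,v;τ) + (i/2) R(u - v;τ)`. -/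
def muTilde (u v τ : ℂ) : ℂ :=
  mu u v τ + Complex.I / 2 * R (u - v) τ

/-! ### The functions `N(a,c;τ)` and `P(a,c;τ)` -/

/-- `N(a,c;τ) = q^(-1/4) μ̃(2a/c, τ; 2τ)`, where `q = exp(2πiτ)`. -/
def N (a c : ℤ) (τ : ℍ) : ℂ :=
  Complex.exp (-(Real.pi * Complex.I * (τ : ℂ) / 2)) * muTilde (2 * (a : ℂ) / c) τ (2 * (τ : ℂ))

/-- `(z;q)_∞ = ∏_{j ≥ 0} (1 - z q^j)`. -/
def qPoch (z q : ℂ) : ℂ := ∏' j : ℕ, (1 - z * q ^ j)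

/-- `[z;q]_∞ = (z;q)_∞ (q/z;q)_∞`. -/
def jacProd (z q : ℂ) : ℂ := qPoch z q * qPoch (q / z) q

/-- `P(a,c;τ) = (-q;q)_∞ (q²;q²)_∞² / ((q;q)_∞ [ζ_c^(2a);q²]_∞)`, where `q = exp(2πiτ)` and
`ζ_c = exp(2πi/c)`. -/
def P (a c : ℤ) (τ : ℍ) : ℂ :=
  let q : ℂ := Complex.exp (2 * Real.pi * Complex.I * (τ : ℂ))
  let ζ : ℂ := Complex.exp (2 * Real.pi * Complex.I / c)
  qPoch (-q) q * qPoch (q ^ 2) (q ^ 2) ^ 2 / (qPoch q q * jacProd (ζ ^ (2 * a)) (q ^ 2))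

/-! ### Invariant orders -/

/-- `(A:τ)^(-k) f(Aτ)`, where `(A:τ) = γτ + δ` for `A = (α, β; γ, δ)`; principal branch. -/
def weightAct (k : ℝ) (f : ℍ → ℂ) (A : SL(2, ℤ)) (τ : ℍ) : ℂ :=
  (((A 1 0 : ℤ) : ℂ) * τ + ((A 1 1 : ℤ) : ℂ)) ^ (-(k : ℂ)) * f (A • τ)

/-- `f(τ) = ∑_{m ≥ m₀} a(m) exp(2πiτm/M)` on the upper half plane; the `n`-th entry of the
sequence `a` is the coefficient `a(m₀ + n)`. -/
def HasExpansion (f : ℍ → ℂ) (M : ℕ) (m₀ : ℤ) (a : ℕ → ℂ) : Prop :=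
  ∀ τ : ℍ, HasSum
    (fun n : ℕ => a n * Complex.exp (2 * Real.pi * Complex.I * (τ : ℂ) * ((m₀ : ℂ) + n) / M))
    (f τ)

/-- The invariant order of `f` at `∞` is `r`: `f` has an expansion
`∑_{m ≥ m₀} a(m) exp(2πiτm/M)` with `a(m₀) ≠ 0` and `r = m₀ / M`. -/
def HasInvariantOrder (f : ℍ → ℂ) (r : ℝ) : Prop :=
  ∃ (M : ℕ) (m₀ : ℤ) (a : ℕ → ℂ), 0 < M ∧ HasExpansion f M m₀ a ∧ a 0 ≠ 0 ∧ r = (m₀ : ℝ) / M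

/-- The invariant order of `f` at `∞` is at least `r` (the zero function has order `+∞`). -/
def InvariantOrderAtLeast (f : ℍ → ℂ) (r : ℝ) : Prop :=
  f = 0 ∨ ∃ s : ℝ, HasInvariantOrder f s ∧ r ≤ s

/-- The incomplete Gamma function `Γ(s,x) = ∫_x^∞ e^(-t) t^(s-1) dt`. -/
def incGamma (s x : ℝ) : ℝ :=
  ∫ t in Set.Ioi x, Real.exp (-t) * t ^ (s - 1)

/-- `g` is the holomorphic part of `F`, for the weight `k`: `F = g + h`, where, with
`y = Im τ`,
`g(τ) = ∑_{n ≥ n₀} a(n) q^(n/M)` and `h(τ) = ∑_{n ≥ 1} b(n) Γ(1-k, 4πny/M) q^(-n/M)`. -/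
def IsHolomorphicPart (k : ℝ) (F g : ℍ → ℂ) : Prop :=
  ∃ (M : ℕ) (n₀ : ℤ) (a b : ℕ → ℂ), 0 < M ∧ HasExpansion g M n₀ a ∧
    ∀ τ : ℍ, HasSum
      (fun n : ℕ => b n * (incGamma (1 - k) (4 * Real.pi * ((n : ℝ) + 1) * τ.im / M) : ℂ) *
        Complex.exp (-(2 * Real.pi * Complex.I * (τ : ℂ) * ((n : ℂ) + 1) / M)))
      (F τ - g τ)

/-- The invariant order of `f`, of weight `k`, at the cusp `α/γ` is `r`: this is the invariant
order at `∞` of `(A:τ)^(-k) f(Aτ)`, for every `A` in `SL₂(ℤ)` with first column `(α, γ)`. -/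
def HasInvariantOrderAtCusp (k : ℝ) (f : ℍ → ℂ) (α γ : ℕ) (r : ℝ) : Prop :=
  ∀ A : SL(2, ℤ), A 0 0 = (α : ℤ) → A 1 0 = (γ : ℤ) → HasInvariantOrder (weightAct k f A) r

/-- The invariant order of the holomorphic part of `f`, of weight `k`, at the cusp `α/γ` is at
least `r`: for every `A` in `SL₂(ℤ)` with first column `(α, γ)`, the function
`(A:τ)^(-k) f(Aτ)` has a holomorphic part, and its invariant order at `∞` is at least `r`. -/
def HolomorphicPartOrderAtCuspAtLeast (k : ℝ) (f : ℍ → ℂ) (α γ : ℕ) (r : ℝ) : Prop :=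
  ∀ A : SL(2, ℤ), A 0 0 = (α : ℤ) → A 1 0 = (γ : ℤ) →
    (∃ g : ℍ → ℂ, IsHolomorphicPart k (weightAct k f A) g) ∧
    ∀ g : ℍ → ℂ, IsHolomorphicPart k (weightAct k f A) g → InvariantOrderAtLeast g r

/-! ### The functions `ν` and `ν̃` -/

/-- `ν(u,w)`. -/
def nu (u w : ℝ) : ℝ :=
  if u + w ≤ 1 then (u + w) / 2 - 1 / 8 else 7 / 8 - (u + w) / 2

/-- `k(u,w)`. -/
def kFun (u w : ℝ) : ℝ :=
  if Int.fract u - Int.fract w = 1 / 2 ∨ Int.fract u - Int.fract w = -(1 / 2) then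
    min (1 / 8) (nu (Int.fract u) (Int.fract w))
  else nu (Int.fract u) (Int.fract w)

/-- `ν̃(u,w)`. -/
def nuTilde (u w : ℝ) : ℝ :=
  1 / 2 * ((⌊u⌋ : ℝ) - ⌊w⌋) ^ 2
    + ((⌊u⌋ : ℝ) - ⌊w⌋) * (Int.fract u - Int.fract w) + kFun u w

end OverpartitionRank

end

open scoped UpperHalfPlane MatrixGroups

noncomputable section

namespace OverpartitionRank

open Complex Filter Topology
open scoped Real ComplexConjugate

/-! Both `N` and `P` are values at modulus 2τ of functions obeying a weight 1/2 Jacobi-type law: `N`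
of Zwegers' completion μ̃, and `P` of the quotient η³/(ϑϑ) by `P_eq_theta`. For A in SL₂(ℤ) there is
B in SL₂(ℤ) with 2Aτ = B(κτ + σ), where κ = 2 if γ is even and κ = 1/2 if γ is odd
(`exists_conjugate_even`, `exists_conjugate_odd`). Up to a nonzero constant the slashed functions
are therefore `Zmu`, respectively η³ over two factors `Ztheta`, at κτ + σ, with characteristics x =
B₁₀·2a/c and y = B₀₀/2. The normalising exponentials make an integer shift of x or y cost only a
constant, so x and y may be replaced by their fractional parts; then y = 1/2 for even γ and y = 0
for odd γ.

The law for μ̃ is checked on the generators S and T. For S, subtracting the expected transform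
leaves a function D of u. It is holomorphic off the lattice because the ∂̄-derivatives of the two
R-terms cancel (`RBar_S`), and its residues at the lattice points cancel. Hence D(u)ϑ(u - v) is
elliptic with removable singularities, thus constant; it vanishes at u = v, so D = 0 (`muTilde_S`).
Constants are never computed: η(Aτ)/η(τ) serves as the weight 1/2 multiplier, and its ratio to (γτ +
δ)^(1/2) is constant, being continuous with constant square (`exists_multiplier`).

For `P` the triple product gives the leading exponents of ϑ and η, hence the exact order. For `N`,
put d = x - y and write sgn(m) - E(·) = (sgn(m) - sgn(m + d)) + (sgn(m + d) - E(·)) in each term of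
R. The second bracket is an incomplete Gamma value and produces the non-holomorphic part; the first
is zero except at m = ±1/2 and joins μ in the holomorphic part `ZHol`. The Appell sum and 1/ϑ bound
μ by the exponent ν(x, y), and the two extra terms account for the minimum with 1/8 in `kFun`
(`mu_isBigO`, `kFun_le_of_signDiff_ne_zero`). Holomorphic parts are unique
(`IsHolomorphicPart.unique`), so a bound for the one constructed is a bound for all; restoring the
integer parts of the characteristics turns `kFun` into ν̃. -/

lemma hasSum_of_eq {ι : Type*} {f g : ι → ℂ} {a b : ℂ} (h : HasSum f a) (hf : ∀ i, g i = f i)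
    (ha : b = a) : HasSum g b := by
  rw [ha, funext hf]; exact h

/-! ### Jacobi's triple product -/

/-- The finite product `(Q;Q)_m`. -/
def qFac (Q : ℂ) (m : ℕ) : ℂ := ∏ i ∈ Finset.range m, (1 - Q ^ (i + 1))

/-- `1 / (Q;Q)_m`, extended by zero to negative `m`. -/
def invQFac (Q : ℂ) (m : ℤ) : ℂ := if 0 ≤ m then (qFac Q m.toNat)⁻¹ else 0

lemma one_sub_pow_ne_zero {Q : ℂ} (hQ : ‖Q‖ < 1) (m : ℕ) : 1 - Q ^ (m + 1) ≠ 0 := by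
  intro h
  have h1 : ‖Q ^ (m + 1)‖ = 1 := by rw [← sub_eq_zero.mp h]; simp
  rw [norm_pow] at h1
  exact absurd h1 (pow_lt_one₀ (norm_nonneg _) hQ (by omega)).ne

lemma qFac_ne_zero {Q : ℂ} (hQ : ‖Q‖ < 1) (m : ℕ) : qFac Q m ≠ 0 :=
  Finset.prod_ne_zero_iff.mpr fun i _ => one_sub_pow_ne_zero hQ i

lemma qFac_succ (Q : ℂ) (m : ℕ) : qFac Q (m + 1) = qFac Q m * (1 - Q ^ (m + 1)) :=
  Finset.prod_range_succ _ _

lemma invQFac_of_neg (Q : ℂ) {m : ℤ} (hm : m < 0) : invQFac Q m = 0 :=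
  if_neg (by omega)

lemma invQFac_natCast (Q : ℂ) (m : ℕ) : invQFac Q m = (qFac Q m)⁻¹ := by
  simp [invQFac]

/-- At m = -1 the factor 1 - Q^(m+1) vanishes, so extension by zero respects the recursion. Gaussian
binomials can then be summed over all of ℤ without boundary terms. -/
lemma invQFac_eq_mul_succ {Q : ℂ} (hQ : ‖Q‖ < 1) (m : ℤ) :
    invQFac Q m = (1 - Q ^ (m + 1)) * invQFac Q (m + 1) := by
  rcases lt_trichotomy m (-1) with h | rfl | h
  · rw [invQFac_of_neg Q (by omega), invQFac_of_neg Q (by omega), mul_zero]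
  · rw [invQFac_of_neg Q (by omega)]; simp
  · obtain ⟨k, rfl⟩ := Int.eq_ofNat_of_zero_le (show 0 ≤ m by omega)
    have e : ((k : ℤ) + 1) = ((k + 1 : ℕ) : ℤ) := by push_cast; ring
    rw [e, invQFac_natCast, invQFac_natCast, qFac_succ, zpow_natCast]
    have := one_sub_pow_ne_zero hQ k
    have := qFac_ne_zero hQ k
    field_simp

/-- The finite form of the triple product identity. -/
lemma hasSum_finite_triple_product {p z : ℂ} (hp0 : p ≠ 0) (hp : ‖p‖ < 1) (hz : z ≠ 0) (N : ℕ) :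
    HasSum (fun n : ℤ => p ^ (n ^ 2) * z ^ n *
      (qFac (p ^ 2) (2 * N) * invQFac (p ^ 2) (N + n) * invQFac (p ^ 2) (N - n)))
      (∏ j ∈ Finset.range N, (1 + z * p ^ (2 * j + 1)) * (1 + z⁻¹ * p ^ (2 * j + 1))) := by
  have hQ : ‖p ^ 2‖ < 1 := by
    rw [norm_pow]; exact pow_lt_one₀ (norm_nonneg _) hp (by norm_num)
  have hQ0 : p ^ 2 ≠ 0 := pow_ne_zero _ hp0
  induction N with
  | zero =>
    convert hasSum_single (0 : ℤ) ?_ using 1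
    · simp [qFac, invQFac]
    · intro n hn
      rcases lt_or_gt_of_ne hn with h | h
      · rw [invQFac_of_neg _ (m := ((0 : ℕ) : ℤ) + n) (by simpa using h)]; simp
      · rw [invQFac_of_neg _ (m := ((0 : ℕ) : ℤ) - n) (by simpa using h)]; simp
  | succ N ih =>
    -- The new factor (1 + z p^(2N+1))(1 + z⁻¹ p^(2N+1)) expands into 1 + p^(4N+2) plus a multiple
    -- of z and one of z⁻¹; the last two shift the summation index by ∓1.
    have hshift (k : ℤ) := (Equiv.addRight k).hasSum_iff.mpr ih
    have key := ((ih.mul_left (1 + p ^ (4 * N + 2))).add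
      ((hshift (-1)).mul_left (z * p ^ (2 * N + 1)))).add
      ((hshift 1).mul_left (z⁻¹ * p ^ (2 * N + 1)))
    rw [Finset.prod_range_succ]
    refine hasSum_of_eq key (fun n => ?_) ?_
    · simp only [Function.comp_apply, Equiv.coe_addRight]
      have e1 : invQFac (p ^ 2) ((N : ℤ) + n) = (1 - (p ^ 2) ^ ((N : ℤ) + n + 1)) *
          invQFac (p ^ 2) (((N + 1 : ℕ) : ℤ) + n) := by
        rw [invQFac_eq_mul_succ hQ]; congr 2; push_cast; ring
      have e2 : invQFac (p ^ 2) ((N : ℤ) - n) = (1 - (p ^ 2) ^ ((N : ℤ) - n + 1)) *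
          invQFac (p ^ 2) (((N + 1 : ℕ) : ℤ) - n) := by
        rw [invQFac_eq_mul_succ hQ]; congr 2; push_cast; ring
      have e3 : invQFac (p ^ 2) ((N : ℤ) + (n + -1)) = (1 - (p ^ 2) ^ ((N : ℤ) + n)) *
          invQFac (p ^ 2) ((N : ℤ) + n) := by
        rw [invQFac_eq_mul_succ hQ]; congr 2 <;> ring_nf
      have e4 : invQFac (p ^ 2) ((N : ℤ) - (n + 1)) = (1 - (p ^ 2) ^ ((N : ℤ) - n)) *
          invQFac (p ^ 2) ((N : ℤ) - n) := by
        rw [invQFac_eq_mul_succ hQ]; congr 2 <;> ring_nf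
      have e5 : invQFac (p ^ 2) ((N : ℤ) + (n + 1)) =
          invQFac (p ^ 2) (((N + 1 : ℕ) : ℤ) + n) := by congr 1; push_cast; ring
      have e6 : invQFac (p ^ 2) ((N : ℤ) - (n + -1)) =
          invQFac (p ^ 2) (((N + 1 : ℕ) : ℤ) - n) := by congr 1; push_cast; ring
      rw [e3, e4, e5, e6, e1, e2, show 2 * (N + 1) = 2 * N + 1 + 1 by ring, qFac_succ, qFac_succ]
      generalize invQFac (p ^ 2) (((N + 1 : ℕ) : ℤ) + n) = G₁
      generalize invQFac (p ^ 2) (((N + 1 : ℕ) : ℤ) - n) = G₂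
      generalize qFac (p ^ 2) (2 * N) = F
      have s1 : p ^ ((n + -1) ^ 2) = p ^ (n ^ 2) * (p ^ n)⁻¹ * (p ^ n)⁻¹ * p := by
        rw [show (n + -1) ^ 2 = n ^ 2 + -n + -n + 1 by ring, zpow_add₀ hp0, zpow_add₀ hp0,
          zpow_add₀ hp0, zpow_neg, zpow_one]
      have s2 : p ^ ((n + 1) ^ 2) = p ^ (n ^ 2) * p ^ n * p ^ n * p := by
        rw [show (n + 1) ^ 2 = n ^ 2 + n + n + 1 by ring, zpow_add₀ hp0, zpow_add₀ hp0,
          zpow_add₀ hp0, zpow_one]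
      have t1 : z ^ (n + -1) = z ^ n * z⁻¹ := by rw [zpow_add₀ hz, zpow_neg_one]
      have t2 : z ^ (n + 1) = z ^ n * z := by rw [zpow_add₀ hz, zpow_one]
      have u1 : (p ^ 2) ^ ((N : ℤ) + n) = p ^ (2 * N) * (p ^ n) ^ 2 := by
        rw [zpow_add₀ hQ0, zpow_natCast, ← pow_mul, ← zpow_natCast (p ^ n), ← zpow_mul,
          ← zpow_natCast p 2, ← zpow_mul, mul_comm n]
      have u2 : (p ^ 2) ^ ((N : ℤ) - n) = p ^ (2 * N) * ((p ^ n) ^ 2)⁻¹ := by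
        rw [zpow_sub₀ hQ0, zpow_natCast, ← pow_mul, ← zpow_natCast (p ^ n), ← zpow_mul,
          ← zpow_natCast p 2, ← zpow_mul, mul_comm n, div_eq_mul_inv]
      have u3 : (p ^ 2) ^ ((N : ℤ) + n + 1) = p ^ (2 * N) * (p ^ n) ^ 2 * p ^ 2 := by
        rw [zpow_add₀ hQ0, u1, zpow_one]
      have u4 : (p ^ 2) ^ ((N : ℤ) - n + 1) = p ^ (2 * N) * ((p ^ n) ^ 2)⁻¹ * p ^ 2 := by
        rw [zpow_add₀ hQ0, u2, zpow_one]
      rw [s1, s2, t1, t2, u1, u2, u3, u4]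
      have hX : p ^ n ≠ 0 := zpow_ne_zero _ hp0
      have h4 : p ^ (4 * N + 2) = (p ^ (2 * N)) ^ 2 * p ^ 2 := by ring
      have h2 : p ^ (2 * N + 1) = p ^ (2 * N) * p := by ring
      have h5 : (p ^ 2) ^ (2 * N + 1) = (p ^ (2 * N)) ^ 2 * p ^ 2 := by ring
      have h6 : (p ^ 2) ^ (2 * N + 1 + 1) = (p ^ (2 * N)) ^ 2 * p ^ 4 := by ring
      rw [h4, h2, h5, h6]
      generalize p ^ n = X at *
      generalize p ^ (2 * N) = Y at *
      generalize p ^ (n ^ 2) = W at *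
      generalize z ^ n = V at *
      field_simp
      ring
    · have : z * z⁻¹ = 1 := mul_inv_cancel₀ hz
      linear_combination (p ^ (2 * N + 1)) ^ 2 *
        (∏ j ∈ Finset.range N, (1 + z * p ^ (2 * j + 1)) * (1 + z⁻¹ * p ^ (2 * j + 1))) * this

lemma qPoch_multipliable {q : ℂ} (hq : ‖q‖ < 1) (z : ℂ) :
    Multipliable fun j : ℕ => 1 - z * q ^ j := by
  have := multipliable_one_add_of_summable (f := fun j : ℕ => -(z * q ^ j)) (by
    simpa using (summable_geometric_of_lt_one (norm_nonneg _) hq).mul_left ‖z‖)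
  simpa [sub_eq_add_neg] using this

lemma qPoch_ne_zero {q : ℂ} (hq : ‖q‖ < 1) {z : ℂ} (hz : ∀ j : ℕ, z * q ^ j ≠ 1) :
    qPoch z q ≠ 0 := by
  have := tprod_one_add_ne_zero_of_summable (f := fun j : ℕ => -(z * q ^ j))
    (fun j h => hz j (by linear_combination -h)) (by
    simpa using (summable_geometric_of_lt_one (norm_nonneg _) hq).mul_left ‖z‖)
  simpa [qPoch, sub_eq_add_neg] using this

lemma tendsto_qFac {Q : ℂ} (hQ : ‖Q‖ < 1) :
    Tendsto (qFac Q) atTop (𝓝 (qPoch Q Q)) := by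
  have := (qPoch_multipliable hQ Q).hasProd.tendsto_prod_nat
  refine this.congr fun m => ?_
  simp [qFac, pow_succ, mul_comm]

lemma qPoch_self_ne_zero {Q : ℂ} (hQ : ‖Q‖ < 1) : qPoch Q Q ≠ 0 :=
  qPoch_ne_zero hQ fun j h => one_sub_pow_ne_zero hQ j (by rw [pow_succ', h, sub_self])

/-- **Jacobi's triple product**. -/
lemma tsum_eq_triple_product {p z : ℂ} (hp0 : p ≠ 0) (hp : ‖p‖ < 1) (hz : z ≠ 0)
    (hs : Summable fun n : ℤ => p ^ (n ^ 2) * z ^ n) :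
    ∑' n : ℤ, p ^ (n ^ 2) * z ^ n =
      qPoch (p ^ 2) (p ^ 2) * qPoch (-z * p) (p ^ 2) * qPoch (-z⁻¹ * p) (p ^ 2) := by
  have hQ : ‖p ^ 2‖ < 1 := by
    rw [norm_pow]; exact pow_lt_one₀ (norm_nonneg _) hp (by norm_num)
  have hC := qPoch_self_ne_zero hQ
  set C := qPoch (p ^ 2) (p ^ 2) with hCdef
  have hF := tendsto_qFac hQ
  have hG := hF.inv₀ hC
  obtain ⟨K, hK⟩ : ∃ K : ℝ, ∀ m : ℕ, ‖qFac (p ^ 2) m‖ ≤ K := by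
    obtain ⟨K, hK⟩ := hF.norm.bddAbove_range
    exact ⟨K, fun m => hK ⟨m, rfl⟩⟩
  obtain ⟨K', hK'⟩ : ∃ K : ℝ, ∀ m : ℕ, ‖(qFac (p ^ 2) m)⁻¹‖ ≤ K := by
    obtain ⟨K, hK⟩ := hG.norm.bddAbove_range
    exact ⟨K, fun m => hK ⟨m, rfl⟩⟩
  have hK'0 : 0 ≤ K' := (norm_nonneg _).trans (hK' 0)
  have hK0 : 0 ≤ K := (norm_nonneg _).trans (hK 0)
  have hinv (m : ℤ) : ‖invQFac (p ^ 2) m‖ ≤ K' := by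
    unfold invQFac
    split_ifs
    · exact hK' _
    · simpa using hK'0
  have hinvlim (f : ℕ → ℤ) (hf : Tendsto f atTop atTop) :
      Tendsto (fun N => invQFac (p ^ 2) (f N)) atTop (𝓝 C⁻¹) := by
    have h1 : Tendsto (fun N => (f N).toNat) atTop atTop :=
      tendsto_atTop.mpr fun b => (hf.eventually_ge_atTop (b : ℤ)).mono fun N hN => by omega
    refine (hG.comp h1).congr' ?_
    filter_upwards [hf.eventually_ge_atTop 0] with N hN
    simp [invQFac, hN]
  have hcast : Tendsto (fun N : ℕ => (N : ℤ)) atTop atTop := tendsto_natCast_atTop_atTop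
  -- Tannery's theorem: the Gaussian binomials are bounded uniformly in N and n, and for fixed n
  -- they tend to C⁻¹, written here as C·C⁻¹·C⁻¹.
  have lim1 := tendsto_tsum_of_dominated_convergence (𝓕 := atTop)
    (f := fun (N : ℕ) (n : ℤ) => p ^ (n ^ 2) * z ^ n *
      (qFac (p ^ 2) (2 * N) * invQFac (p ^ 2) (N + n) * invQFac (p ^ 2) (N - n)))
    (g := fun n => p ^ (n ^ 2) * z ^ n * (C * C⁻¹ * C⁻¹))
    (bound := fun n => ‖p ^ (n ^ 2) * z ^ n‖ * (K * K' * K'))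
    (hs.norm.mul_right _)
    (fun n => tendsto_const_nhds.mul (((hF.comp
      (tendsto_id.const_mul_atTop' (by norm_num : 0 < 2))).mul
      (hinvlim _ (tendsto_atTop_add_const_right _ _ hcast))).mul
      (hinvlim _ (tendsto_atTop_add_const_right _ _ hcast))))
    (Eventually.of_forall fun N n => by
      rw [norm_mul, norm_mul (qFac _ _ * _), norm_mul (qFac _ _)]
      gcongr
      · exact hK _
      · exact hinv _
      · exact hinv _)
  simp only [fun N => (hasSum_finite_triple_product hp0 hp hz N).tsum_eq] at lim1
  have lim2 := ((qPoch_multipliable hQ (-z * p)).hasProd.tendsto_prod_nat).mul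
    (qPoch_multipliable hQ (-z⁻¹ * p)).hasProd.tendsto_prod_nat
  have lim3 := tendsto_nhds_unique lim1 (lim2.congr fun N => by
    rw [← Finset.prod_mul_distrib]
    refine Finset.prod_congr rfl fun j _ => ?_
    ring)
  rw [tsum_mul_right] at lim3
  have : C * C⁻¹ = 1 := mul_inv_cancel₀ hC
  change _ = qPoch (-z * p) (p ^ 2) * qPoch (-z⁻¹ * p) (p ^ 2) at lim3
  rw [mul_assoc, ← lim3]
  linear_combination (-(∑' n : ℤ, p ^ (n ^ 2) * z ^ n)) * (C * C⁻¹ + 1) * this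

/-! ### The theta function -/

/-- Membership in the lattice `ℤτ + ℤ`. -/
def InLattice (z τ : ℂ) : Prop := ∃ m n : ℤ, z = m * τ + n

/-- Passes from half-integers to integers. Convergence, holomorphy and inversion of ϑ are all
inherited from `jacobiTheta₂` through this. -/
lemma theta_eq_jacobiTheta₂ (z τ : ℂ) :
    theta z τ = cexp (π * I * τ / 4 + π * I * (z + 1 / 2)) *
      jacobiTheta₂ (z + 1 / 2 + τ / 2) τ := by
  rw [theta, jacobiTheta₂, ← tsum_mul_left]
  refine tsum_congr fun n => ?_
  rw [jacobiTheta₂_term, ← Complex.exp_add]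
  congr 1
  ring

lemma exp_eq_of_sub {x y : ℂ} (n : ℤ) (h : x = y + n * (2 * π * I)) : cexp x = cexp y :=
  Complex.exp_eq_exp_iff_exists_int.mpr ⟨n, h⟩

lemma neg_cexp (x : ℂ) : -cexp x = cexp (x + π * I) := by
  rw [Complex.exp_add, Complex.exp_pi_mul_I, mul_neg_one]

lemma theta_add_one (z τ : ℂ) : theta (z + 1) τ = -theta z τ := by
  rw [theta_eq_jacobiTheta₂, theta_eq_jacobiTheta₂,
    show z + 1 + 1 / 2 + τ / 2 = (z + 1 / 2 + τ / 2) + 1 by ring, jacobiTheta₂_add_left,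
    show π * I * τ / 4 + π * I * (z + 1 + 1 / 2) =
      (π * I * τ / 4 + π * I * (z + 1 / 2)) + π * I by ring, Complex.exp_add, Complex.exp_pi_mul_I]
  ring

lemma theta_add_tau (z τ : ℂ) :
    theta (z + τ) τ = -cexp (-(π * I * τ) - 2 * π * I * z) * theta z τ := by
  rw [theta_eq_jacobiTheta₂, theta_eq_jacobiTheta₂,
    show z + τ + 1 / 2 + τ / 2 = (z + 1 / 2 + τ / 2) + τ by ring, jacobiTheta₂_add_left',
    neg_cexp, ← mul_assoc, ← mul_assoc, ← Complex.exp_add, ← Complex.exp_add]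
  congr 1
  refine exp_eq_of_sub (-1) ?_
  push_cast
  ring

lemma theta_neg (z τ : ℂ) : theta (-z) τ = -theta z τ := by
  rw [theta, theta, ← tsum_neg, ← (Equiv.subLeft (-1 : ℤ)).tsum_eq]
  refine tsum_congr fun n => ?_
  rw [neg_cexp]
  refine exp_eq_of_sub (-(n + 1)) ?_
  simp only [Equiv.subLeft_apply]
  push_cast
  ring

lemma theta_zero (τ : ℂ) : theta 0 τ = 0 := by
  have := theta_neg 0 τ
  rw [neg_zero] at this
  linear_combination this / 2

lemma theta_sub_tau (z τ : ℂ) :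
    theta (z - τ) τ = -cexp (-(π * I * τ) + 2 * π * I * z) * theta z τ := by
  rw [← neg_sub, theta_neg, sub_eq_add_neg, add_comm, theta_add_tau, theta_neg]
  ring_nf

/-- Since (n + 1/2)² = n(n+1) + 1/4 with n(n+1) even, every term acquires the same eighth root of
unity. -/
lemma theta_add_one_right (z τ : ℂ) : theta z (τ + 1) = cexp (π * I / 4) * theta z τ := by
  rw [theta, theta, ← tsum_mul_left]
  refine tsum_congr fun n => ?_
  rw [← Complex.exp_add]
  obtain ⟨k, hk⟩ := Int.even_mul_succ_self n
  refine exp_eq_of_sub k ?_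
  have hk' : (n : ℂ) * (n + 1) = k + k := by exact_mod_cast hk
  linear_combination (π * I) * hk'

lemma summable_theta (z : ℂ) {τ : ℂ} (hτ : 0 < τ.im) : Summable fun n : ℤ =>
    cexp (π * I * ((n : ℂ) + 1 / 2) ^ 2 * τ + 2 * π * I * ((n : ℂ) + 1 / 2) * (z + 1 / 2)) := by
  have := ((summable_jacobiTheta₂_term_iff (z + 1 / 2 + τ / 2) τ).mpr hτ).mul_left
    (cexp (π * I * τ / 4 + π * I * (z + 1 / 2)))
  refine this.congr fun n => ?_
  rw [jacobiTheta₂_term, ← Complex.exp_add]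
  congr 1
  ring

lemma differentiable_theta {τ : ℂ} (hτ : 0 < τ.im) : Differentiable ℂ fun z => theta z τ := by
  intro z
  simp only [theta_eq_jacobiTheta₂]
  have h := (differentiableAt_jacobiTheta₂_fst (z + 1 / 2 + τ / 2) hτ).comp (𝕜 := ℂ) z
    (f := fun z => z + 1 / 2 + τ / 2) (by fun_prop)
  exact DifferentiableAt.mul (by fun_prop) h

lemma differentiableAt_theta_line (x s : ℂ) {τ : ℂ} (hτ : 0 < τ.im) :
    DifferentiableAt ℂ (fun τ => theta (x * τ + s) τ) τ := by
  simp only [theta_eq_jacobiTheta₂]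
  have h := (hasFDerivAt_jacobiTheta₂ (x * τ + s + 1 / 2 + τ / 2) hτ).differentiableAt.comp
    (𝕜 := ℂ) τ (f := fun τ : ℂ => (x * τ + s + 1 / 2 + τ / 2, τ)) (by fun_prop)
  exact DifferentiableAt.mul (by fun_prop) h

lemma neg_one_div_im_pos {τ : ℂ} (hτ : 0 < τ.im) : 0 < (-1 / τ).im := by
  rw [neg_div, neg_im, one_div, inv_im]
  have : 0 < normSq τ := normSq_pos.mpr (by rintro rfl; simp at hτ)
  rw [neg_div, neg_neg]
  positivity

lemma ne_zero_of_im_pos {τ : ℂ} (hτ : 0 < τ.im) : τ ≠ 0 := by rintro rfl; simp at hτ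

/-- The shift 1/2 + τ/2 divided by τ differs from the shift belonging to -1/τ by exactly one
quasi-period, whose exponential factor is then absorbed. -/
lemma theta_S (z : ℂ) {τ : ℂ} (hτ : 0 < τ.im) :
    theta (z / τ) (-1 / τ) =
      -I * (-I * τ) ^ (1 / 2 : ℂ) * cexp (π * I * z ^ 2 / τ) * theta z τ := by
  have h0 := ne_zero_of_im_pos hτ
  have h1 : (-I * τ) ^ (1 / 2 : ℂ) ≠ 0 := by
    rw [Ne, cpow_eq_zero_iff]
    simp [h0]
  rw [theta_eq_jacobiTheta₂, theta_eq_jacobiTheta₂ z,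
    jacobiTheta₂_functional_equation (z + 1 / 2 + τ / 2) τ,
    show z / τ + 1 / 2 + -1 / τ / 2 = (z + 1 / 2 + τ / 2) / τ + -1 / τ by field_simp; ring,
    jacobiTheta₂_add_left']
  have e : cexp (π * I * (-1 / τ) / 4 + π * I * (z / τ + 1 / 2)) *
      cexp (-π * I * (-1 / τ + 2 * ((z + 1 / 2 + τ / 2) / τ))) =
      -I * cexp (π * I * z ^ 2 / τ) * (cexp (π * I * τ / 4 + π * I * (z + 1 / 2)) *
        cexp (-π * I * (z + 1 / 2 + τ / 2) ^ 2 / τ)) := by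
    have hI : -I = cexp (-(π / 2 * I)) := by
      rw [Complex.exp_neg, Complex.exp_pi_div_two_mul_I, inv_I]
    rw [hI, ← Complex.exp_add, ← Complex.exp_add, ← Complex.exp_add, ← Complex.exp_add]
    congr 1
    field_simp
    ring
  rw [← mul_assoc, e]
  field_simp

lemma norm_exp_lt_one {τ : ℂ} (hτ : 0 < τ.im) : ‖cexp (2 * π * I * τ)‖ < 1 := by
  rw [Complex.norm_exp, Real.exp_lt_one_iff]
  simp
  positivity

lemma norm_exp_pi_lt_one {τ : ℂ} (hτ : 0 < τ.im) : ‖cexp (π * I * τ)‖ < 1 := by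
  rw [Complex.norm_exp, Real.exp_lt_one_iff]
  simp
  positivity

/-- The product formula for `ϑ`. -/
lemma theta_eq_prod (z : ℂ) {τ : ℂ} (hτ : 0 < τ.im) :
    theta z τ = -I * cexp (π * I * τ / 4) * cexp (-(π * I * z)) *
      qPoch (cexp (2 * π * I * τ)) (cexp (2 * π * I * τ)) *
      jacProd (cexp (2 * π * I * z)) (cexp (2 * π * I * τ)) := by
  have key (w : ℂ) : jacobiTheta₂ w τ = qPoch (cexp (π * I * τ) ^ 2) (cexp (π * I * τ) ^ 2) *
      qPoch (-cexp (2 * π * I * w) * cexp (π * I * τ)) (cexp (π * I * τ) ^ 2) *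
      qPoch (-(cexp (2 * π * I * w))⁻¹ * cexp (π * I * τ)) (cexp (π * I * τ) ^ 2) := by
    have hterm (n : ℤ) : jacobiTheta₂_term n w τ =
        cexp (π * I * τ) ^ (n ^ 2) * cexp (2 * π * I * w) ^ n := by
      rw [jacobiTheta₂_term, ← Complex.exp_int_mul, ← Complex.exp_int_mul, ← Complex.exp_add]
      congr 1
      push_cast
      ring
    have hs := (summable_jacobiTheta₂_term_iff w τ).mpr hτ
    simp only [hterm] at hs
    rw [jacobiTheta₂]
    simp only [hterm]
    exact tsum_eq_triple_product (Complex.exp_ne_zero _) (norm_exp_pi_lt_one hτ)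
      (Complex.exp_ne_zero _) hs
  have hQ : cexp (π * I * τ) ^ 2 = cexp (2 * π * I * τ) := by
    rw [← Complex.exp_nat_mul]; congr 1; push_cast; ring
  -- Working at -z makes the two products come out directly as the factors with arguments q/ζ and ζ
  -- of `jacProd`, without moving a factor 1 - ζ.
  rw [← neg_neg (theta z τ), ← theta_neg, theta_eq_jacobiTheta₂, key, hQ, jacProd]
  have e1 : -cexp (2 * π * I * (-z + 1 / 2 + τ / 2)) * cexp (π * I * τ) =
      cexp (2 * π * I * τ) / cexp (2 * π * I * z) := by
    rw [← Complex.exp_sub, neg_cexp, ← Complex.exp_add]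
    refine exp_eq_of_sub 1 ?_
    push_cast
    ring
  have e2 : -(cexp (2 * π * I * (-z + 1 / 2 + τ / 2)))⁻¹ * cexp (π * I * τ) =
      cexp (2 * π * I * z) := by
    rw [← Complex.exp_neg, neg_cexp, ← Complex.exp_add]
    congr 1
    ring
  have e3 : cexp (π * I * τ / 4 + π * I * (-z + 1 / 2)) =
      I * (cexp (π * I * τ / 4) * cexp (-(π * I * z))) := by
    rw [← Complex.exp_add, show π * I * τ / 4 + π * I * (-z + 1 / 2) =
      π / 2 * I + (π * I * τ / 4 + -(π * I * z)) by ring, Complex.exp_add,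
      Complex.exp_pi_div_two_mul_I]
  rw [e1, e2, e3]
  ring

/-- These absolutely convergent products vanish only if some factor does, and a vanishing factor of
the triple product places z in the lattice. -/
lemma theta_ne_zero {z τ : ℂ} (hτ : 0 < τ.im) (hz : ¬ InLattice z τ) : theta z τ ≠ 0 := by
  have hQ := norm_exp_lt_one hτ
  have hpow (j : ℕ) : cexp (2 * π * I * τ) ^ j = cexp (2 * π * I * (j * τ)) := by
    rw [← Complex.exp_nat_mul]; congr 1; ring
  have h2 : (2 * π * I : ℂ) ≠ 0 := Complex.two_pi_I_ne_zero
  rw [theta_eq_prod z hτ]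
  refine mul_ne_zero (mul_ne_zero (by simp [Complex.exp_ne_zero]) (qPoch_self_ne_zero hQ))
    (mul_ne_zero (qPoch_ne_zero hQ fun j h => hz ?_) (qPoch_ne_zero hQ fun j h => hz ?_))
  · rw [hpow, ← Complex.exp_add, Complex.exp_eq_one_iff] at h
    obtain ⟨n, hn⟩ := h
    refine ⟨-j, n, mul_left_cancel₀ h2 ?_⟩
    push_cast
    linear_combination hn
  · rw [hpow, ← Complex.exp_sub, ← Complex.exp_add, Complex.exp_eq_one_iff] at h
    obtain ⟨n, hn⟩ := h
    refine ⟨j + 1, -n, mul_left_cancel₀ h2 ?_⟩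
    push_cast
    linear_combination -hn

/-! ### The function `P` as a theta quotient -/

lemma eta_eq_qPoch (τ : ℂ) : ModularForm.eta τ =
    cexp (π * I * τ / 12) * qPoch (cexp (2 * π * I * τ)) (cexp (2 * π * I * τ)) := by
  rw [ModularForm.eta, qPoch]
  congr 1
  · rw [Function.Periodic.qParam]; congr 1; push_cast; ring
  · refine tprod_congr fun n => ?_
    rw [ModularForm.eta_q_eq_pow, pow_succ']

lemma qPoch_neg_mul_qPoch {q : ℂ} (hq : ‖q‖ < 1) :
    qPoch (-q) q * qPoch q q = qPoch (q ^ 2) (q ^ 2) := by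
  rw [qPoch, qPoch, ← (qPoch_multipliable hq _).tprod_mul (qPoch_multipliable hq _), qPoch]
  exact tprod_congr fun j => by ring

lemma qPoch_sq_mul_qPoch {q : ℂ} (hq : ‖q‖ < 1) :
    qPoch q (q ^ 2) * qPoch (q ^ 2) (q ^ 2) = qPoch q q := by
  have hQ : ‖q ^ 2‖ < 1 := by
    rw [norm_pow]; exact pow_lt_one₀ (norm_nonneg _) hq (by norm_num)
  have h1 := qPoch_multipliable hQ q
  have h2 := qPoch_multipliable hQ (q ^ 2)
  have := tprod_even_mul_odd (f := fun j : ℕ => 1 - q * q ^ j)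
    (h1.congr fun j => by ring) (h2.congr fun j => by ring)
  rw [qPoch, qPoch, qPoch, ← this]
  congr 1 <;> exact tprod_congr fun j => by ring

/-- Uses Euler's identity (-q;q)_∞ (q;q²)_∞ = 1 together with ϑ(τ;2τ), whose triple product contains
the square of (q;q²)_∞. If the factor `J` vanishes, both sides are 0 by the convention for division.
-/
lemma P_eq_theta (a c : ℤ) (τ : ℍ) :
    P a c τ = -cexp (-(π * I * (2 * a / c))) * cexp (-(π * I * τ / 2)) *
      (ModularForm.eta (2 * τ) ^ 3 / (theta (2 * a / c) (2 * τ) * theta τ (2 * τ))) := by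
  have hτ : 0 < (τ : ℂ).im := τ.im_pos
  have h2τ : 0 < (2 * (τ : ℂ)).im := by simpa using hτ
  set q := cexp (2 * π * I * τ) with hq
  have hq1 : ‖q‖ < 1 := norm_exp_lt_one hτ
  have hQ : cexp (2 * π * I * (2 * τ)) = q ^ 2 := by
    rw [hq, ← Complex.exp_nat_mul]; congr 1; push_cast; ring
  have hQ1 : ‖q ^ 2‖ < 1 := hQ ▸ norm_exp_lt_one h2τ
  have hζ : cexp (2 * π * I / c) ^ (2 * a) = cexp (2 * π * I * (2 * a / c)) := by
    rw [← Complex.exp_int_mul]; congr 1; push_cast; ring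
  have hqne : q ≠ 0 := Complex.exp_ne_zero _
  have hA := qPoch_self_ne_zero hq1
  have hB := qPoch_self_ne_zero hQ1
  have r1 := qPoch_neg_mul_qPoch hq1
  have r2 := qPoch_sq_mul_qPoch hq1
  have hth : theta τ (2 * τ) = -I * cexp (-(π * I * τ / 2)) *
      (qPoch (q ^ 2) (q ^ 2) * qPoch q (q ^ 2) ^ 2) := by
    rw [theta_eq_prod _ h2τ, hQ, jacProd, ← hq, show q ^ 2 / q = q by field_simp]
    have : cexp (π * I * (2 * τ) / 4) * cexp (-(π * I * τ)) = cexp (-(π * I * τ / 2)) := by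
      rw [← Complex.exp_add]; congr 1; ring
    linear_combination (-I * qPoch (q ^ 2) (q ^ 2) * qPoch q (q ^ 2) ^ 2) * this
  rw [hth, theta_eq_prod _ h2τ, eta_eq_qPoch, hQ]
  simp only [P]
  rw [← hq, hζ]
  generalize jacProd (cexp (2 * π * I * (2 * a / c))) (q ^ 2) = J
  have hC : qPoch q (q ^ 2) ≠ 0 := fun h => hA (by rw [← r2, h, zero_mul])
  have e1 : cexp (π * I * (2 * τ) / 12) ^ 3 = cexp (π * I * (2 * τ) / 4) := by
    rw [← Complex.exp_nat_mul]; congr 1; push_cast; ring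
  rw [mul_pow, e1, ← r2, Complex.exp_neg (π * I * (2 * a / c))]
  have hn : qPoch (-q) q = (qPoch q (q ^ 2))⁻¹ := by
    have h3 : qPoch (-q) q * qPoch q (q ^ 2) = 1 := by
      rw [← r2] at r1
      exact mul_right_cancel₀ hB (by linear_combination r1)
    exact eq_inv_of_mul_eq_one_left h3
  rw [hn]
  have := Complex.exp_ne_zero (π * I * (2 * a / c))
  have := Complex.exp_ne_zero (π * I * (2 * τ) / 4)
  have := Complex.exp_ne_zero (-(π * I * τ / 2))
  generalize cexp (π * I * (2 * a / c)) = E₁ at *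
  generalize cexp (π * I * (2 * τ) / 4) = E₂ at *
  generalize cexp (-(π * I * τ / 2)) = E₃ at *
  by_cases hJ : J = 0
  · simp [hJ]
  · have hI := I_ne_zero
    field_simp
    linear_combination I_sq

/-! ### The Appell sum -/

/-- The coefficients `(-1)^n exp(πi n(n+1)τ + 2πi n v)`. -/
def appellCoeff (v τ : ℂ) (n : ℤ) : ℂ :=
  (-1 : ℂ) ^ n * cexp (π * I * n * (n + 1) * τ + 2 * π * I * n * v)

/-- The Appell sum in the definition of `μ`. -/
def appell (u v τ : ℂ) : ℂ :=
  ∑' n : ℤ, appellCoeff v τ n / (1 - cexp (2 * π * I * n * τ + 2 * π * I * u))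

lemma mu_eq_appell (u v τ : ℂ) : mu u v τ = cexp (π * I * u) / theta v τ * appell u v τ := rfl

lemma neg_one_zpow_eq_exp (n : ℤ) : (-1 : ℂ) ^ n = cexp (n * (π * I)) := by
  rw [Complex.exp_int_mul, Complex.exp_pi_mul_I]

lemma appellCoeff_eq_exp (v τ : ℂ) (n : ℤ) : appellCoeff v τ n =
    cexp (n * (π * I) + (π * I * n * (n + 1) * τ + 2 * π * I * n * v)) := by
  rw [appellCoeff, neg_one_zpow_eq_exp, ← Complex.exp_add]

/-- With its denominators removed the Appell sum is ϑ itself. This is the source of the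
inhomogeneous terms in the quasi-periodicity of μ. -/
lemma hasSum_appellCoeff (v : ℂ) {τ : ℂ} (hτ : 0 < τ.im) :
    HasSum (appellCoeff v τ) (-I * cexp (-(π * I * τ / 4) - π * I * v) * theta v τ) := by
  refine hasSum_of_eq ((summable_theta v hτ).hasSum.mul_left
    (-I * cexp (-(π * I * τ / 4) - π * I * v))) (fun n => ?_) rfl
  have hI : -I = cexp (-(π / 2 * I)) := by
    rw [Complex.exp_neg, Complex.exp_pi_div_two_mul_I, inv_I]
  rw [appellCoeff_eq_exp, hI, ← Complex.exp_add, ← Complex.exp_add]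
  congr 1
  ring

lemma summable_norm_appellCoeff (v : ℂ) {τ : ℂ} (hτ : 0 < τ.im) :
    Summable fun n => ‖appellCoeff v τ n‖ := (hasSum_appellCoeff v hτ).summable.norm

/-- For Re w ≤ 0 this is the triangle inequality; for Re w ≥ 0 one also uses e^δ - 1 ≥ 1 - e^(-δ).
-/
lemma norm_one_sub_exp_ge {w : ℂ} {δ : ℝ} (h : δ ≤ |w.re|) :
    1 - Real.exp (-δ) ≤ ‖1 - cexp w‖ := by
  rcases le_total 0 w.re with h0 | h0
  · rw [abs_of_nonneg h0] at h
    have h1 := norm_sub_norm_le (cexp w) 1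
    rw [norm_one, Complex.norm_exp, norm_sub_rev] at h1
    have h2 := Real.add_one_le_exp (-δ)
    have h3 : Real.exp δ ≤ Real.exp w.re := Real.exp_le_exp.mpr h
    have h4 : Real.exp δ * Real.exp (-δ) = 1 := by rw [← Real.exp_add]; simp
    nlinarith [sq_nonneg (Real.exp δ - 1), Real.exp_pos δ, Real.exp_pos (-δ),
      sq_nonneg (1 - Real.exp (-δ))]
  · rw [abs_of_nonpos h0] at h
    have h1 := norm_sub_norm_le 1 (cexp w)
    rw [norm_one, Complex.norm_exp] at h1
    have h3 : Real.exp w.re ≤ Real.exp (-δ) := Real.exp_le_exp.mpr (by linarith)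
    linarith

lemma norm_div_one_sub_exp_le (a : ℂ) {w : ℂ} {δ : ℝ} (hδ : 0 < δ) (h : δ ≤ |w.re|) :
    ‖a / (1 - cexp w)‖ ≤ ‖a‖ * (1 - Real.exp (-δ))⁻¹ := by
  have h1 : 0 < 1 - Real.exp (-δ) := by
    rw [sub_pos]; exact Real.exp_lt_one_iff.mpr (by linarith)
  rw [norm_div, div_eq_mul_inv]
  gcongr
  exact norm_one_sub_exp_ge h

lemma re_appell_exponent (n : ℤ) (u τ : ℂ) :
    (2 * π * I * n * τ + 2 * π * I * u).re = -(2 * π * (n * τ.im + u.im)) := by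
  simp
  ring

/-- All but finitely many denominators are bounded below by 1 - e⁻¹. The exceptional terms,
including one at a pole, do not affect convergence. -/
lemma summable_appell (u v : ℂ) {τ : ℂ} (hτ : 0 < τ.im) : Summable fun n : ℤ =>
    appellCoeff v τ n / (1 - cexp (2 * π * I * n * τ + 2 * π * I * u)) := by
  refine Summable.of_norm_bounded_eventually
    ((summable_norm_appellCoeff v hτ).mul_right (1 - Real.exp (-1))⁻¹) ?_
  have hfin : {n : ℤ | |(n : ℝ)| * τ.im < 1 + |u.im|}.Finite := by
    refine (Set.finite_Icc (-⌈(1 + |u.im|) / τ.im⌉) ⌈(1 + |u.im|) / τ.im⌉).subset fun n hn => ?_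
    have h1 : |(n : ℝ)| < (1 + |u.im|) / τ.im := by rw [lt_div_iff₀ hτ]; exact hn
    have h2 : |(n : ℝ)| ≤ ⌈(1 + |u.im|) / τ.im⌉ := h1.le.trans (Int.le_ceil _)
    have h3 : |n| ≤ ⌈(1 + |u.im|) / τ.im⌉ := by exact_mod_cast h2
    exact abs_le.mp h3
  filter_upwards [hfin.compl_mem_cofinite] with n hn
  refine norm_div_one_sub_exp_le _ one_pos ?_
  have hn' : 1 + |u.im| ≤ |(n : ℝ)| * τ.im := not_lt.mp hn
  rw [re_appell_exponent, abs_neg, abs_mul, abs_of_pos (by positivity : 0 < 2 * π)]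
  have h1 : 1 ≤ |n * τ.im + u.im| := by
    have := abs_sub_abs_le_abs_sub (n * τ.im) (-u.im)
    rw [abs_mul, abs_of_pos hτ, abs_neg, sub_neg_eq_add] at this
    linarith
  nlinarith [Real.pi_gt_three]

lemma one_sub_exp_ne_zero {u τ : ℂ} (hu : ¬ InLattice u τ) (n : ℤ) :
    1 - cexp (2 * π * I * n * τ + 2 * π * I * u) ≠ 0 := by
  intro h
  obtain ⟨k, hk⟩ := Complex.exp_eq_one_iff.mp (sub_eq_zero.mp h).symm
  refine hu ⟨-n, k, mul_left_cancel₀ Complex.two_pi_I_ne_zero ?_⟩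
  push_cast
  linear_combination hk

lemma appell_add_one_left (u v τ : ℂ) : appell (u + 1) v τ = appell u v τ := by
  refine tsum_congr fun n => ?_
  congr 2
  refine exp_eq_of_sub 1 ?_
  push_cast
  ring

lemma appell_add_one_right (u v τ : ℂ) : appell u (v + 1) τ = appell u v τ := by
  refine tsum_congr fun n => ?_
  congr 1
  rw [appellCoeff_eq_exp, appellCoeff_eq_exp]
  exact exp_eq_of_sub n (by ring)

/-- The shift multiplies the n-th coefficient by a constant times X, where 1 - X is the denominator,
and X/(1 - X) = 1/(1 - X) - 1 splits off a theta series. -/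
lemma appell_add_tau_right {u : ℂ} (v : ℂ) {τ : ℂ} (hτ : 0 < τ.im) (hu : ¬ InLattice u τ) :
    appell u (v + τ) τ = cexp (-(2 * π * I * u)) *
      (appell u v τ - -I * cexp (-(π * I * τ / 4) - π * I * v) * theta v τ) := by
  refine (hasSum_of_eq (((summable_appell u v hτ).hasSum.sub (hasSum_appellCoeff v hτ)).mul_left
    (cexp (-(2 * π * I * u)))) (fun n => ?_) rfl).tsum_eq
  have h := one_sub_exp_ne_zero hu n
  have e : appellCoeff (v + τ) τ n = appellCoeff v τ n * (cexp (-(2 * π * I * u)) *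
      cexp (2 * π * I * n * τ + 2 * π * I * u)) := by
    rw [appellCoeff_eq_exp, appellCoeff_eq_exp, ← Complex.exp_add, ← Complex.exp_add]
    congr 1
    ring
  rw [e]
  generalize cexp (2 * π * I * n * τ + 2 * π * I * u) = X at *
  field_simp
  ring

/-- Translating u by τ moves the denominator from index n to n + 1. After reindexing, the
coefficient ratio involves 1/X, and 1/(X(1 - X)) = 1/X + 1/(1 - X) again leaves a theta series. -/
lemma appell_add_tau_left {u : ℂ} (v : ℂ) {τ : ℂ} (hτ : 0 < τ.im) (hu : ¬ InLattice u τ) :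
    appell (u + τ) v τ = -cexp (2 * π * I * (u - v)) *
      (appell u v τ - -I * cexp (-(π * I * τ / 4) + π * I * v - 2 * π * I * u) * theta v τ) := by
  have h1 := (hasSum_appellCoeff (v - τ) hτ).mul_left (cexp (-(2 * π * I * u)))
  have h2 := (((summable_appell u v hτ).hasSum.add h1).mul_left
    (-cexp (2 * π * I * (u - v))))
  have h3 := (Equiv.addRight (1 : ℤ)).hasSum_iff.mpr h2
  refine (hasSum_of_eq h3 (fun n => ?_) ?_).tsum_eq
  · simp only [Function.comp_apply, Equiv.coe_addRight]
    have h := one_sub_exp_ne_zero hu (n + 1)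
    have e0 : cexp (2 * π * I * n * τ + 2 * π * I * (u + τ)) =
        cexp (2 * π * I * (n + 1 : ℤ) * τ + 2 * π * I * u) := by
      congr 1; push_cast; ring
    have e1 : appellCoeff v τ n = -cexp (2 * π * I * (u - v)) *
        (cexp (-(2 * π * I * u)) * appellCoeff (v - τ) τ (n + 1)) := by
      rw [appellCoeff_eq_exp, appellCoeff_eq_exp, neg_cexp, ← Complex.exp_add, ← Complex.exp_add]
      refine exp_eq_of_sub (-1) ?_
      push_cast
      ring
    have e2 : appellCoeff v τ (n + 1) = appellCoeff (v - τ) τ (n + 1) *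
        (cexp (-(2 * π * I * u)) * cexp (2 * π * I * (n + 1 : ℤ) * τ + 2 * π * I * u)) := by
      rw [appellCoeff_eq_exp, appellCoeff_eq_exp, ← Complex.exp_add, ← Complex.exp_add]
      congr 1
      push_cast
      ring
    rw [e0, e1, e2]
    generalize cexp (2 * π * I * (n + 1 : ℤ) * τ + 2 * π * I * u) = X at *
    field_simp
    ring
  · congr 1
    rw [theta_sub_tau, appell]
    have : cexp (-(π * I * τ / 4) + π * I * v - 2 * π * I * u) = cexp (-(2 * π * I * u)) *
        (cexp (-(π * I * τ / 4) - π * I * (v - τ)) * cexp (-(π * I * τ) + 2 * π * I * v)) := by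
      rw [← Complex.exp_add, ← Complex.exp_add]
      congr 1
      ring
    rw [this]
    ring

/-! ### Quasi-periodicity of μ. -/

lemma mu_add_one_left (u v τ : ℂ) : mu (u + 1) v τ = -mu u v τ := by
  rw [mu_eq_appell, mu_eq_appell, appell_add_one_left, mul_add, Complex.exp_add, mul_one,
    Complex.exp_pi_mul_I]
  ring

lemma mu_add_one_right (u v τ : ℂ) : mu u (v + 1) τ = -mu u v τ := by
  rw [mu_eq_appell, mu_eq_appell, appell_add_one_right, theta_add_one]
  ring

lemma mu_add_tau_left {u v τ : ℂ} (hτ : 0 < τ.im) (hu : ¬ InLattice u τ)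
    (hv : ¬ InLattice v τ) : mu (u + τ) v τ = cexp (2 * π * I * (u - v) + π * I * τ) *
      (-mu u v τ - I * cexp (-(π * I * (u - v)) - π * I * τ / 4)) := by
  have h := theta_ne_zero hτ hv
  rw [mu_eq_appell, mu_eq_appell, appell_add_tau_left v hτ hu]
  have e1 : cexp (π * I * (u + τ)) * cexp (2 * π * I * (u - v)) =
      cexp (π * I * u) * cexp (2 * π * I * (u - v) + π * I * τ) := by
    rw [← Complex.exp_add, ← Complex.exp_add]; congr 1; ring
  have e2 : cexp (-(π * I * (u - v)) - π * I * τ / 4) = cexp (π * I * u) *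
      cexp (-(π * I * τ / 4) + π * I * v - 2 * π * I * u) := by
    rw [← Complex.exp_add]; congr 1; ring
  rw [e2]
  generalize cexp (-(π * I * τ / 4) + π * I * v - 2 * π * I * u) = X at *
  generalize cexp (2 * π * I * (u - v)) = Y at *
  generalize cexp (2 * π * I * (u - v) + π * I * τ) = Z at *
  field_simp
  linear_combination (-1 : ℂ) * (appell u v τ + I * theta v τ * X) * e1

lemma mu_add_tau_right {u v τ : ℂ} (hτ : 0 < τ.im) (hu : ¬ InLattice u τ)
    (hv : ¬ InLattice v τ) : mu u (v + τ) τ = cexp (2 * π * I * (v - u) + π * I * τ) *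
      (-mu u v τ - I * cexp (π * I * (u - v) - π * I * τ / 4)) := by
  have h := theta_ne_zero hτ hv
  rw [mu_eq_appell, mu_eq_appell, appell_add_tau_right v hτ hu, theta_add_tau]
  have e1 : cexp (2 * π * I * (v - u) + π * I * τ) =
      cexp (-(2 * π * I * u)) * (cexp (-(π * I * τ) - 2 * π * I * v))⁻¹ := by
    rw [← Complex.exp_neg, ← Complex.exp_add]; congr 1; ring
  have e2 : cexp (π * I * (u - v) - π * I * τ / 4) = cexp (π * I * u) *
      cexp (-(π * I * τ / 4) - π * I * v) := by
    rw [← Complex.exp_add]; congr 1; ring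
  have := Complex.exp_ne_zero (-(π * I * τ) - 2 * π * I * v)
  rw [e1, e2]
  field_simp
  ring

lemma mu_add_one_tau (u v τ : ℂ) : mu u v (τ + 1) = cexp (-(π * I / 4)) * mu u v τ := by
  have : appell u v (τ + 1) = appell u v τ := by
    refine tsum_congr fun n => ?_
    congr 1
    · rw [appellCoeff_eq_exp, appellCoeff_eq_exp]
      obtain ⟨k, hk⟩ := Int.even_mul_succ_self n
      have hk' : (n : ℂ) * (n + 1) = k + k := by exact_mod_cast hk
      refine exp_eq_of_sub k ?_
      linear_combination (π * I) * hk'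
    · congr 1
      exact exp_eq_of_sub n (by ring)
  rw [mu_eq_appell, mu_eq_appell, this, theta_add_one_right, Complex.exp_neg]
  field_simp

/-! ### Holomorphy and poles in the first variable -/

/-- The Appell sum without the term `n = 0`. -/
def appellTail (u v τ : ℂ) : ℂ :=
  ∑' n : ℤ, if n = 0 then 0 else
    appellCoeff v τ n / (1 - cexp (2 * π * I * n * τ + 2 * π * I * u))

lemma appell_eq_add_appellTail (u v : ℂ) {τ : ℂ} (hτ : 0 < τ.im) :
    appell u v τ = 1 / (1 - cexp (2 * π * I * u)) + appellTail u v τ := by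
  rw [appell, (summable_appell u v hτ).tsum_eq_add_tsum_ite 0]
  simp [appellCoeff, appellTail]

/-- The strip `|Im u| < 3y/4`. -/
def strip (τ : ℂ) : Set ℂ := {u | |u.im| < 3 / 4 * τ.im}

lemma isOpen_strip (τ : ℂ) : IsOpen (strip τ) :=
  isOpen_lt (by fun_prop) (by fun_prop)

lemma abs_add_mul_ge_of_mem_strip {u τ : ℂ} (hτ : 0 < τ.im) (hu : u ∈ strip τ) {n : ℤ}
    (hn : n ≠ 0) : τ.im / 4 ≤ |n * τ.im + u.im| := by
  have h1 : 1 ≤ |(n : ℝ)| := by exact_mod_cast Int.one_le_abs hn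
  have h2 : |u.im| < 3 / 4 * τ.im := hu
  have := abs_sub_abs_le_abs_sub (n * τ.im) (-u.im)
  rw [abs_mul, abs_of_pos hτ, abs_neg, sub_neg_eq_add] at this
  nlinarith

lemma one_sub_exp_ne_zero_of_mem_strip {u τ : ℂ} (hτ : 0 < τ.im) (hu : u ∈ strip τ) {n : ℤ}
    (hn : n ≠ 0) : 1 - cexp (2 * π * I * n * τ + 2 * π * I * u) ≠ 0 := by
  have h := abs_add_mul_ge_of_mem_strip hτ hu hn
  intro h0
  have h1 := norm_one_sub_exp_ge (w := 2 * π * I * n * τ + 2 * π * I * u)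
    (δ := 2 * π * (τ.im / 4)) (by
      rw [re_appell_exponent, abs_neg, abs_mul, abs_of_pos (by positivity : 0 < 2 * π)]
      gcongr)
  rw [h0, norm_zero, sub_nonpos, ← Real.exp_zero, Real.exp_le_exp] at h1
  have : 0 < 2 * π * (τ.im / 4) := by positivity
  linarith

/-- On the strip, |ny + Im u| ≥ y/4 for n ≠ 0, so these denominators are uniformly bounded away from
0 and the series converges uniformly. -/
lemma differentiableOn_appellTail (v : ℂ) {τ : ℂ} (hτ : 0 < τ.im) :
    DifferentiableOn ℂ (fun u => appellTail u v τ) (strip τ) := by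
  have hδ : 0 < 2 * π * (τ.im / 4) := by positivity
  refine differentiableOn_tsum_of_summable_norm ((summable_norm_appellCoeff v hτ).mul_right
    (1 - Real.exp (-(2 * π * (τ.im / 4))))⁻¹) (fun n => ?_) (isOpen_strip τ) (fun n u hu => ?_)
  · split_ifs with hn
    · exact differentiableOn_const _
    · exact DifferentiableOn.div (by fun_prop) (by fun_prop)
        fun u hu => one_sub_exp_ne_zero_of_mem_strip hτ hu hn
  · split_ifs with hn
    · rw [norm_zero]
      have : 0 ≤ 1 - Real.exp (-(2 * π * (τ.im / 4))) := by
        rw [sub_nonneg]; exact Real.exp_le_one_iff.mpr (by linarith)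
      positivity
    · refine norm_div_one_sub_exp_le _ hδ ?_
      rw [re_appell_exponent, abs_neg, abs_mul, abs_of_pos (by positivity : 0 < 2 * π)]
      gcongr
      exact abs_add_mul_ge_of_mem_strip hτ hu hn

lemma inLattice_add_tau {u τ : ℂ} : InLattice (u + τ) τ ↔ InLattice u τ := by
  constructor
  · rintro ⟨m, n, h⟩
    exact ⟨m - 1, n, by push_cast; linear_combination h⟩
  · rintro ⟨m, n, h⟩
    exact ⟨m + 1, n, by push_cast; linear_combination h⟩

lemma inLattice_add_one {u τ : ℂ} : InLattice (u + 1) τ ↔ InLattice u τ := by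
  constructor
  · rintro ⟨m, n, h⟩
    exact ⟨m, n - 1, by push_cast; linear_combination h⟩
  · rintro ⟨m, n, h⟩
    exact ⟨m, n + 1, by push_cast; linear_combination h⟩

lemma inLattice_zero (τ : ℂ) : InLattice 0 τ := ⟨0, 0, by simp⟩

lemma differentiableAt_mu_of_mem_strip (v : ℂ) {u τ : ℂ} (hτ : 0 < τ.im) (hu : u ∈ strip τ)
    (huL : ¬ InLattice u τ) : DifferentiableAt ℂ (fun u => mu u v τ) u := by
  simp only [mu_eq_appell, appell_eq_add_appellTail _ v hτ]
  have h1 := (differentiableOn_appellTail v hτ).differentiableAt ((isOpen_strip τ).mem_nhds hu)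
  have h2 : DifferentiableAt ℂ (fun u => 1 / (1 - cexp (2 * π * I * u))) u :=
    DifferentiableAt.div (by fun_prop) (by fun_prop) (by
      simpa using one_sub_exp_ne_zero huL 0)
  exact DifferentiableAt.mul (by fun_prop) (h2.add h1)

/-- The lattice is exactly the zero set of the continuous function ϑ(·;τ). -/
lemma isClosed_lattice {τ : ℂ} (hτ : 0 < τ.im) : IsClosed {z | InLattice z τ} := by
  have : {z | InLattice z τ} = {z | theta z τ = 0} := by
    ext z
    constructor
    · rintro ⟨m, n, rfl⟩
      have hz (n : ℤ) : theta n τ = 0 := by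
        induction n using Int.induction_on with
        | zero => simpa using theta_zero τ
        | succ k ih => push_cast; rw [theta_add_one]; push_cast at ih; rw [ih, neg_zero]
        | pred k ih =>
          have := theta_add_one (-(k : ℂ) - 1) τ
          rw [sub_add_cancel] at this
          push_cast at ih ⊢
          rw [ih] at this
          exact neg_eq_zero.mp this.symm
      change theta (m * τ + n) τ = 0
      induction m using Int.induction_on with
      | zero => simpa using hz n
      | succ k ih =>
        rw [show (((k : ℤ) + 1 : ℤ) : ℂ) * τ + n = ((k : ℤ) : ℂ) * τ + n + τ by push_cast; ring,
          theta_add_tau, ih, mul_zero]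
      | pred k ih =>
        rw [show ((-(k : ℤ) - 1 : ℤ) : ℂ) * τ + n = ((-(k : ℤ) : ℤ) : ℂ) * τ + n - τ by
          push_cast; ring, theta_sub_tau, ih, mul_zero]
    · intro h
      by_contra hz
      exact theta_ne_zero hτ hz h
  rw [this]
  exact isClosed_eq (differentiable_theta hτ).continuous continuous_const

lemma eventually_not_inLattice {u τ : ℂ} (hτ : 0 < τ.im) (hu : ¬ InLattice u τ) :
    ∀ᶠ z in 𝓝 u, ¬ InLattice z τ :=
  (isClosed_lattice hτ).isOpen_compl.mem_nhds hu

/-- The translates of the strip by multiples of τ cover the plane, and the functional equation in u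
carries differentiability from one to the next, in both directions. -/
lemma differentiableAt_mu {u v τ : ℂ} (hτ : 0 < τ.im) (hu : ¬ InLattice u τ)
    (hv : ¬ InLattice v τ) : DifferentiableAt ℂ (fun u => mu u v τ) u := by
  have up {u : ℂ} (hu : ¬ InLattice u τ) (h : DifferentiableAt ℂ (fun u => mu u v τ) u) :
      DifferentiableAt ℂ (fun u => mu (u + τ) v τ) u := by
    have : DifferentiableAt ℂ (fun u => cexp (2 * π * I * (u - v) + π * I * τ) *
      (-mu u v τ - I * cexp (-(π * I * (u - v)) - π * I * τ / 4))) u :=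
      DifferentiableAt.mul (by fun_prop) (h.neg.sub (by fun_prop))
    refine this.congr_of_eventuallyEq ?_
    filter_upwards [eventually_not_inLattice hτ hu] with z hz
    exact mu_add_tau_left hτ hz hv
  have down {u : ℂ} (hu : ¬ InLattice u τ)
      (h : DifferentiableAt ℂ (fun u => mu (u + τ) v τ) u) :
      DifferentiableAt ℂ (fun u => mu u v τ) u := by
    have : DifferentiableAt ℂ (fun u => -(cexp (-(2 * π * I * (u - v) + π * I * τ)) *
      mu (u + τ) v τ + I * cexp (-(π * I * (u - v)) - π * I * τ / 4))) u :=
      ((DifferentiableAt.mul (by fun_prop) h).add (by fun_prop)).neg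
    refine this.congr_of_eventuallyEq ?_
    filter_upwards [eventually_not_inLattice hτ hu] with z hz
    rw [mu_add_tau_left hτ hz hv, Complex.exp_neg]
    have := Complex.exp_ne_zero (2 * π * I * (z - v) + π * I * τ)
    field_simp
    ring
  have shift (u : ℂ) : DifferentiableAt ℂ (fun u => mu (u + τ) v τ) u ↔
      DifferentiableAt ℂ (fun u => mu u v τ) (u + τ) :=
    ⟨fun h => by
      have h' := h
      rw [← add_sub_cancel_right u τ] at h'
      have := DifferentiableAt.comp (𝕜 := ℂ) (u + τ) (f := fun z => z - τ) h' (by fun_prop)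
      simpa [Function.comp_def] using this,
    fun h => DifferentiableAt.comp (𝕜 := ℂ) u (f := fun z => z + τ)
      (g := fun u => mu u v τ) h (by fun_prop)⟩
  have main (k : ℤ) : ∀ u, ¬ InLattice u τ → u ∈ strip τ →
      DifferentiableAt ℂ (fun u => mu u v τ) (u + k * τ) := by
    have lat (k : ℤ) (u : ℂ) : InLattice (u + k * τ) τ ↔ InLattice u τ := by
      constructor
      · rintro ⟨m, n, h⟩
        exact ⟨m - k, n, by push_cast; linear_combination h⟩
      · rintro ⟨m, n, h⟩
        exact ⟨m + k, n, by push_cast; linear_combination h⟩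
    induction k using Int.induction_on with
    | zero => intro u hu hs; simpa using differentiableAt_mu_of_mem_strip v hτ hs hu
    | succ k ih =>
      intro u hu hs
      rw [show u + ((k : ℤ) + 1 : ℤ) * τ = (u + (k : ℤ) * τ) + τ by push_cast; ring, ← shift]
      exact up (mt (lat k u).mp hu) (ih u hu hs)
    | pred k ih =>
      intro u hu hs
      refine down (mt (lat _ u).mp hu) ((shift _).mpr ?_)
      rw [show u + (-(k : ℤ) - 1 : ℤ) * τ + τ = u + (-(k : ℤ) : ℤ) * τ by push_cast; ring]
      exact ih u hu hs
  -- Rounding Im u / y leaves a remainder of at most 1/2, which is inside the half-width 3/4 of the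
  -- strip.
  have hk := abs_sub_round (u.im / τ.im)
  have := main (round (u.im / τ.im)) (u - round (u.im / τ.im) * τ) (fun ⟨m, n, h⟩ =>
    hu ⟨m + round (u.im / τ.im), n, by push_cast; linear_combination h⟩) (by
    rw [strip, Set.mem_ofPred_eq]
    have e : (u - round (u.im / τ.im) * τ).im =
        (u.im / τ.im - round (u.im / τ.im)) * τ.im := by
      simp
      field_simp
    rw [e, abs_mul, abs_of_pos hτ]
    nlinarith)
  simpa using this

/-- The residue at u = 0 comes from the term n = 0 alone, as the tail is continuous there. -/
lemma tendsto_mul_mu (v : ℂ) {τ : ℂ} (hτ : 0 < τ.im) :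
    Tendsto (fun u => u * mu u v τ) (𝓝[≠] 0) (𝓝 (-1 / (2 * π * I) / theta v τ)) := by
  have h0 : (0 : ℂ) ∈ strip τ := by simp [strip, hτ]
  have hc : ContinuousAt (fun u => appellTail u v τ) 0 :=
    ((differentiableOn_appellTail v hτ).differentiableAt
      ((isOpen_strip τ).mem_nhds h0)).continuousAt
  have hd : HasDerivAt (fun u => cexp (2 * π * I * u)) (2 * π * I) 0 := by
    have := ((hasDerivAt_id (0 : ℂ)).const_mul (2 * π * I)).cexp
    simpa using this
  have hs := hd.tendsto_slope_zero.inv₀ Complex.two_pi_I_ne_zero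
  have h1 : Tendsto (fun u => u * (1 / (1 - cexp (2 * π * I * u)))) (𝓝[≠] 0)
      (𝓝 (-(2 * π * I)⁻¹)) := by
    refine hs.neg.congr fun u => ?_
    simp only [zero_add, mul_zero, Complex.exp_zero, smul_eq_mul]
    rw [mul_inv, inv_inv, ← neg_sub 1 (cexp _), inv_neg, one_div]
    ring
  have h2 : Tendsto (fun u => u * appellTail u v τ) (𝓝[≠] 0) (𝓝 0) := by
    have : ContinuousAt (fun u => u * appellTail u v τ) 0 := continuousAt_id.mul hc
    have := this.tendsto
    rw [zero_mul] at this
    exact this.mono_left nhdsWithin_le_nhds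
  have h3 : Tendsto (fun u => cexp (π * I * u) / theta v τ) (𝓝[≠] 0) (𝓝 (1 / theta v τ)) := by
    have : ContinuousAt (fun u => cexp (π * I * u) / theta v τ) 0 := by fun_prop
    have := this.tendsto
    simp only [mul_zero, Complex.exp_zero] at this
    exact this.mono_left nhdsWithin_le_nhds
  have := h3.mul (h1.add h2)
  refine Tendsto.congr (fun u => ?_) (this.trans (le_of_eq ?_))
  · rw [mu_eq_appell, appell_eq_add_appellTail _ v hτ]
    ring
  · congr 1
    ring

/-! ### The error function `E` -/

lemma continuous_gaussian : Continuous fun w : ℝ => Real.exp (-π * w ^ 2) := by fun_prop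

lemma hasDerivAt_E (x : ℝ) : HasDerivAt E (2 * Real.exp (-π * x ^ 2)) x :=
  (intervalIntegral.integral_hasDerivAt_right (continuous_gaussian.intervalIntegrable _ _)
    (continuous_gaussian.stronglyMeasurableAtFilter _ _)
    continuous_gaussian.continuousAt).const_mul 2

lemma E_neg (x : ℝ) : E (-x) = -E x := by
  have h := intervalIntegral.integral_comp_neg (a := 0) (b := x)
    (fun w : ℝ => Real.exp (-π * w ^ 2))
  simp only [neg_sq, neg_zero] at h
  rw [E, E, h, intervalIntegral.integral_symm]
  ring

lemma integrable_gaussian : MeasureTheory.Integrable fun w : ℝ => Real.exp (-π * w ^ 2) :=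
  integrable_exp_neg_mul_sq Real.pi_pos

lemma integral_gaussian_Ioi_zero :
    ∫ w in Set.Ioi (0 : ℝ), Real.exp (-π * w ^ 2) = 1 / 2 := by
  rw [integral_gaussian_Ioi, div_self Real.pi_ne_zero, Real.sqrt_one]

lemma one_sub_E (x : ℝ) : 1 - E x = 2 * ∫ w in Set.Ioi x, Real.exp (-π * w ^ 2) := by
  have := intervalIntegral.integral_interval_add_Ioi (a := (0 : ℝ)) (b := x)
    integrable_gaussian.integrableOn integrable_gaussian.integrableOn
  rw [integral_gaussian_Ioi_zero] at this
  rw [E]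
  linarith

lemma E_le_one (x : ℝ) : E x ≤ 1 := by
  have : 0 ≤ ∫ w in Set.Ioi x, Real.exp (-π * w ^ 2) :=
    MeasureTheory.integral_nonneg fun _ => (Real.exp_pos _).le
  linarith [one_sub_E x]

lemma abs_E_le_one (x : ℝ) : |E x| ≤ 1 := by
  rw [abs_le]
  exact ⟨by linarith [E_le_one (-x), E_neg x], E_le_one x⟩

lemma tendsto_E : Tendsto E atTop (𝓝 1) := by
  have := (MeasureTheory.intervalIntegral_tendsto_integral_Ioi 0
    integrable_gaussian.integrableOn tendsto_id).const_mul 2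
  rw [integral_gaussian_Ioi_zero, mul_one_div_cancel two_ne_zero] at this
  exact this

/-- For w ≥ x ≥ 0 one has w² ≥ x² + (w - x)², so the tail from x is at most e^(-πx²) times the tail
from 0. -/
lemma one_sub_E_le {x : ℝ} (hx : 0 ≤ x) : 1 - E x ≤ Real.exp (-π * x ^ 2) := by
  refine le_of_tendsto (tendsto_E.sub_const (E x)) ?_
  filter_upwards [eventually_ge_atTop x] with X hX
  have h1 : E X - E x = 2 * ∫ w in x..X, Real.exp (-π * w ^ 2) := by
    rw [E, E, ← mul_sub, intervalIntegral.integral_interval_sub_left] <;>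
    exact continuous_gaussian.intervalIntegrable _ _
  have h2 : ∫ w in x..X, Real.exp (-π * w ^ 2) ≤
      ∫ w in x..X, Real.exp (-π * x ^ 2) * Real.exp (-π * (w - x) ^ 2) := by
    refine intervalIntegral.integral_mono_on hX (continuous_gaussian.intervalIntegrable _ _)
      (Continuous.intervalIntegrable (by fun_prop) _ _) fun w hw => ?_
    rw [← Real.exp_add, Real.exp_le_exp]
    have : 0 ≤ 2 * π * (x * (w - x)) :=
      mul_nonneg (by positivity) (mul_nonneg hx (by linarith [hw.1]))
    nlinarith
  rw [intervalIntegral.integral_const_mul, intervalIntegral.integral_comp_sub_right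
    (fun w => Real.exp (-π * w ^ 2)), sub_self] at h2
  have h3 := E_le_one (X - x)
  rw [E] at h3
  rw [h1]
  nlinarith [Real.exp_pos (-π * x ^ 2)]

lemma abs_sign_sub_E_le (x : ℝ) : |Real.sign x - E x| ≤ Real.exp (-π * x ^ 2) := by
  have hpos {x : ℝ} (hx : 0 < x) : |Real.sign x - E x| ≤ Real.exp (-π * x ^ 2) := by
    rw [Real.sign_of_pos hx, abs_of_nonneg (by linarith [E_le_one x])]
    exact one_sub_E_le hx.le
  rcases lt_trichotomy x 0 with h | rfl | h
  · have := hpos (neg_pos.mpr h)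
    rwa [Real.sign_neg, E_neg, neg_sub_neg, neg_sq, abs_sub_comm] at this
  · simp [E]
  · exact hpos h

lemma abs_sign_le_one (x : ℝ) : |Real.sign x| ≤ 1 := by
  rcases Real.sign_apply_eq x with h | h | h <;> simp [h]

/-- If `|a| ≤ A`, then `sgn m - E((m + a)√(2y))` is at most of the order `exp(-2πy(m + a)²)`. -/
lemma abs_sign_sub_E_shift_le {m a A y : ℝ} (hy : 0 < y) (ha : |a| ≤ A) :
    |Real.sign m - E ((m + a) * √(2 * y))| ≤
      2 * Real.exp (2 * π * y * A ^ 2) * Real.exp (-(2 * π * y * (m + a) ^ 2)) := by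
  have hsq : -π * ((m + a) * √(2 * y)) ^ 2 = -(2 * π * y * (m + a) ^ 2) := by
    rw [mul_pow, Real.sq_sqrt (by positivity)]
    ring
  have hA : 1 ≤ Real.exp (2 * π * y * A ^ 2) := Real.one_le_exp (by positivity)
  have hs : 0 < √(2 * y) := Real.sqrt_pos.mpr (by positivity)
  have case1 (h : Real.sign m = Real.sign ((m + a) * √(2 * y))) :
      |Real.sign m - E ((m + a) * √(2 * y))| ≤
      2 * Real.exp (2 * π * y * A ^ 2) * Real.exp (-(2 * π * y * (m + a) ^ 2)) := by
    rw [h]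
    refine (abs_sign_sub_E_le _).trans ?_
    rw [hsq]
    nlinarith [Real.exp_pos (-(2 * π * y * (m + a) ^ 2))]
  -- If m and m + a do not have the same sign then |m + a| ≤ |a| ≤ A, and the product of the two
  -- exponentials is at least 1; the trivial bound 2 suffices.
  have case2 (h : |m + a| ≤ |a|) : |Real.sign m - E ((m + a) * √(2 * y))| ≤
      2 * Real.exp (2 * π * y * A ^ 2) * Real.exp (-(2 * π * y * (m + a) ^ 2)) := by
    have h1 : |Real.sign m - E ((m + a) * √(2 * y))| ≤ 2 := by
      have := abs_sub (Real.sign m) (E ((m + a) * √(2 * y)))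
      linarith [abs_sign_le_one m, abs_E_le_one ((m + a) * √(2 * y))]
    refine h1.trans ?_
    rw [mul_assoc, ← Real.exp_add]
    have h2 : (m + a) ^ 2 ≤ A ^ 2 := sq_le_sq' (by linarith [neg_abs_le (m + a)])
      (by linarith [le_abs_self (m + a)])
    have : 0 ≤ 2 * π * y * A ^ 2 + -(2 * π * y * (m + a) ^ 2) := by
      have : 0 < 2 * π * y := by positivity
      nlinarith
    linarith [Real.one_le_exp this]
  rcases lt_trichotomy m 0 with hm | rfl | hm
  · rcases lt_or_ge (m + a) 0 with h | h
    · exact case1 (by rw [Real.sign_of_neg hm, Real.sign_of_neg (mul_neg_of_neg_of_pos h hs)])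
    · exact case2 (by rw [abs_of_nonneg h, abs_of_nonneg] <;> linarith)
  · exact case2 (by rw [zero_add])
  · rcases lt_or_ge 0 (m + a) with h | h
    · exact case1 (by rw [Real.sign_of_pos hm, Real.sign_of_pos (mul_pos h hs)])
    · exact case2 (by rw [abs_of_nonpos h, abs_of_nonpos] <;> linarith)

/-! ### The series `R` -/

/-- The holomorphic factor of the terms of `R`. -/
def RCoeff (u τ : ℂ) (n : ℤ) : ℂ :=
  (-1 : ℂ) ^ n * cexp (-(π * I * ((n : ℂ) + 1 / 2) ^ 2 * τ) - 2 * π * I * ((n : ℂ) + 1 / 2) * u)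

/-- The real factor of the terms of `R`. -/
def RFactor (u τ : ℂ) (n : ℤ) : ℝ :=
  Real.sign ((n : ℝ) + 1 / 2) - E (((n : ℝ) + 1 / 2 + u.im / τ.im) * √(2 * τ.im))

lemma R_eq_tsum (u τ : ℂ) : R u τ = ∑' n : ℤ, (RFactor u τ n : ℂ) * RCoeff u τ n :=
  tsum_congr fun n => by rw [RFactor, RCoeff, mul_assoc]

lemma RCoeff_eq_exp (u τ : ℂ) (n : ℤ) : RCoeff u τ n = cexp (n * (π * I) +
    (-(π * I * ((n : ℂ) + 1 / 2) ^ 2 * τ) - 2 * π * I * ((n : ℂ) + 1 / 2) * u)) := by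
  rw [RCoeff, neg_one_zpow_eq_exp, ← Complex.exp_add]

lemma norm_RCoeff (u : ℂ) {τ : ℂ} (hτ : 0 < τ.im) (n : ℤ) : ‖RCoeff u τ n‖ =
    Real.exp (π * τ.im * (((n : ℝ) + 1 / 2) ^ 2 + 2 * (u.im / τ.im) * ((n : ℝ) + 1 / 2))) := by
  rw [RCoeff_eq_exp, Complex.norm_exp]
  congr 1
  have e : (n * (π * I) + (-(π * I * ((n : ℂ) + 1 / 2) ^ 2 * τ) -
      2 * π * I * ((n : ℂ) + 1 / 2) * u) : ℂ) =
      ((n * π : ℝ) : ℂ) * I + (-(((π * ((n : ℝ) + 1 / 2) ^ 2 : ℝ) : ℂ) * (I * τ)) -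
      ((2 * π * ((n : ℝ) + 1 / 2) : ℝ) : ℂ) * (I * u)) := by
    push_cast
    ring
  rw [e]
  simp only [add_re, sub_re, neg_re, re_ofReal_mul, I_re, I_mul_re]
  field_simp
  ring

/-- The majorant for the terms of `R` and their derivatives, uniform in `|Im u| ≤ A y`. -/
def RBound (A y : ℝ) (n : ℤ) : ℝ :=
  Real.exp (π * y * A) * (|(n : ℝ)| * Real.exp (-π * (y * n ^ 2 - 2 * (y * (1 + 2 * A) / 2) * |n|))
    + Real.exp (-π * (y * n ^ 2 - 2 * (y * (1 + 2 * A) / 2) * |n|)))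

lemma summable_RBound (A : ℝ) {y : ℝ} (hy : 0 < y) : Summable (RBound A y) := by
  have h1 := summable_pow_mul_jacobiTheta₂_term_bound (y * (1 + 2 * A) / 2) hy 1
  have h0 := summable_pow_mul_jacobiTheta₂_term_bound (y * (1 + 2 * A) / 2) hy 0
  refine ((h1.add h0).mul_left (Real.exp (π * y * A))).congr fun n => ?_
  rw [RBound, pow_one, pow_zero, one_mul, Int.cast_abs]

/-- With m = n + 1/2 and a = Im u / y the total exponent is πy(-m² - 2am - 2a²), so the Gaussian
beats the growth of the coefficient. The weight |n| + 1 leaves room for the factor produced by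
differentiating in u. -/
lemma norm_RCoeff_mul_le {A : ℝ} {u τ : ℂ} (hτ : 0 < τ.im) (hu : |u.im / τ.im| ≤ A) (n : ℤ) :
    (|(n : ℝ)| + 1) * (‖RCoeff u τ n‖ *
      Real.exp (-(2 * π * τ.im * ((n : ℝ) + 1 / 2 + u.im / τ.im) ^ 2))) ≤ RBound A τ.im n := by
  rw [norm_RCoeff u hτ, ← Real.exp_add, RBound, ← add_one_mul, mul_left_comm]
  refine mul_le_mul_of_nonneg_left ?_ (by positivity)
  rw [← Real.exp_add, Real.exp_le_exp]
  set a := u.im / τ.im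
  set y := τ.im
  have hA : 0 ≤ A := (abs_nonneg a).trans hu
  have h1 : -(a * ((n : ℝ) + 1 / 2)) ≤ A * (|(n : ℝ)| + 1 / 2) := by
    have h2 : |(n : ℝ) + 1 / 2| ≤ |(n : ℝ)| + 1 / 2 := by
      refine (abs_add_le _ _).trans_eq ?_
      norm_num
    calc -(a * ((n : ℝ) + 1 / 2)) ≤ |a * ((n : ℝ) + 1 / 2)| := neg_le_abs _
      _ = |a| * |(n : ℝ) + 1 / 2| := abs_mul _ _
      _ ≤ _ := by gcongr
  have h3 : -(n : ℝ) ≤ |(n : ℝ)| := neg_le_abs _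
  have hkey : -((n : ℝ) ^ 2) - n - 1 / 4 - 2 * (a * ((n : ℝ) + 1 / 2)) - 2 * a ^ 2 ≤
      A - n ^ 2 + (1 + 2 * A) * |(n : ℝ)| := by nlinarith [sq_nonneg a]
  have hpy : 0 < π * y := mul_pos Real.pi_pos hτ
  push_cast
  calc _ = π * y * (-((n : ℝ) ^ 2) - n - 1 / 4 - 2 * (a * ((n : ℝ) + 1 / 2)) - 2 * a ^ 2) := by
        ring
    _ ≤ π * y * (A - n ^ 2 + (1 + 2 * A) * |(n : ℝ)|) := by gcongr
    _ = _ := by ring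

lemma norm_RTerm_le {A : ℝ} {u τ : ℂ} (hτ : 0 < τ.im) (hu : |u.im / τ.im| ≤ A) (n : ℤ) :
    (|(n : ℝ)| + 1) * ‖(RFactor u τ n : ℂ) * RCoeff u τ n‖ ≤
      2 * Real.exp (2 * π * τ.im * A ^ 2) * RBound A τ.im n := by
  rw [norm_mul, Complex.norm_real, Real.norm_eq_abs]
  have h1 := abs_sign_sub_E_shift_le (m := (n : ℝ) + 1 / 2) hτ hu
  have h2 := norm_RCoeff_mul_le hτ hu n
  calc _ ≤ (|(n : ℝ)| + 1) * (2 * Real.exp (2 * π * τ.im * A ^ 2) *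
        Real.exp (-(2 * π * τ.im * ((n : ℝ) + 1 / 2 + u.im / τ.im) ^ 2)) * ‖RCoeff u τ n‖) := by
        gcongr
        exact h1
    _ = 2 * Real.exp (2 * π * τ.im * A ^ 2) * ((|(n : ℝ)| + 1) * (‖RCoeff u τ n‖ *
      Real.exp (-(2 * π * τ.im * ((n : ℝ) + 1 / 2 + u.im / τ.im) ^ 2)))) := by ring
    _ ≤ _ := by gcongr

lemma summable_RTerm (u : ℂ) {τ : ℂ} (hτ : 0 < τ.im) :
    Summable fun n : ℤ => (RFactor u τ n : ℂ) * RCoeff u τ n := by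
  refine Summable.of_norm_bounded ((summable_RBound |u.im / τ.im| hτ).mul_left
    (2 * Real.exp (2 * π * τ.im * |u.im / τ.im| ^ 2))) fun n => ?_
  refine le_trans ?_ (norm_RTerm_le hτ le_rfl n)
  exact le_mul_of_one_le_left (norm_nonneg _) (by linarith [abs_nonneg (n : ℝ)])

lemma R_add_one (u τ : ℂ) : R (u + 1) τ = -R u τ := by
  rw [R_eq_tsum, R_eq_tsum, ← tsum_neg]
  refine tsum_congr fun n => ?_
  have h1 : RFactor (u + 1) τ n = RFactor u τ n := by simp [RFactor]
  have h2 : RCoeff (u + 1) τ n = -RCoeff u τ n := by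
    rw [RCoeff_eq_exp, RCoeff_eq_exp, neg_cexp]
    refine exp_eq_of_sub (-(n + 1)) ?_
    push_cast
    ring
  rw [h1, h2, mul_neg]

lemma R_add_one_right (u τ : ℂ) : R u (τ + 1) = cexp (-(π * I / 4)) * R u τ := by
  rw [R_eq_tsum, R_eq_tsum, ← tsum_mul_left]
  refine tsum_congr fun n => ?_
  have h1 : RFactor u (τ + 1) n = RFactor u τ n := by simp [RFactor]
  have h2 : RCoeff u (τ + 1) n = cexp (-(π * I / 4)) * RCoeff u τ n := by
    rw [RCoeff_eq_exp, RCoeff_eq_exp, ← Complex.exp_add]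
    obtain ⟨k, hk⟩ := Int.even_mul_succ_self n
    have hk' : (n : ℂ) * (n + 1) = k + k := by exact_mod_cast hk
    refine exp_eq_of_sub (-k) ?_
    push_cast
    linear_combination (-π * I) * hk'
  rw [h1, h2]
  ring

/-- Translation by τ shifts the index, and the argument of E moves along with it; only sgn(m) fails
to, and its jump between -1/2 and 1/2 yields the single extra term. -/
lemma R_add_tau (u : ℂ) {τ : ℂ} (hτ : 0 < τ.im) :
    R (u + τ) τ = cexp (2 * π * I * u + π * I * τ) *
      (-R u τ + 2 * cexp (-(π * I * u) - π * I * τ / 4)) := by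
  have h1 := (hasSum_ite_eq (0 : ℤ) (2 * cexp (-(π * I * u) - π * I * τ / 4)))
  have h2 := ((summable_RTerm u hτ).hasSum.neg.add h1).mul_left (cexp (2 * π * I * u + π * I * τ))
  rw [R_eq_tsum (u + τ), R_eq_tsum u]
  refine (hasSum_of_eq ((Equiv.addRight (1 : ℤ)).hasSum_iff.mpr h2) (fun n => ?_) rfl).tsum_eq
  simp only [Function.comp_apply, Equiv.coe_addRight]
  have e1 : RCoeff (u + τ) τ n = -cexp (2 * π * I * u + π * I * τ) * RCoeff u τ (n + 1) := by
    rw [RCoeff_eq_exp, RCoeff_eq_exp, neg_cexp, ← Complex.exp_add]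
    refine exp_eq_of_sub (-1) ?_
    push_cast
    ring
  have e2 : RFactor (u + τ) τ n = RFactor u τ (n + 1) +
      (Real.sign ((n : ℝ) + 1 / 2) - Real.sign ((n : ℝ) + 1 + 1 / 2)) := by
    have : (n : ℝ) + 1 / 2 + (u + τ).im / τ.im = ((n + 1 : ℤ) : ℝ) + 1 / 2 + u.im / τ.im := by
      rw [add_im, add_div, div_self hτ.ne']
      push_cast
      ring
    rw [RFactor, RFactor, this]
    push_cast
    ring
  rw [e1, e2]
  rcases lt_trichotomy n (-1) with h | rfl | h
  · have hn : (n : ℝ) + 1 ≤ -1 := by exact_mod_cast (by omega : n + 1 ≤ -1)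
    rw [if_neg (by omega), Real.sign_of_neg (by linarith), Real.sign_of_neg (by linarith)]
    push_cast
    ring
  · have e3 : RCoeff u τ (-1 + 1) = cexp (-(π * I * u) - π * I * τ / 4) := by
      rw [RCoeff_eq_exp]
      congr 1
      push_cast
      ring
    rw [if_pos (by norm_num), Real.sign_of_neg (by norm_num), Real.sign_of_pos (by norm_num), e3]
    push_cast
    ring
  · have hn : (0 : ℝ) ≤ n := by exact_mod_cast (by omega : 0 ≤ n)
    rw [if_neg (by omega), Real.sign_of_pos (by linarith), Real.sign_of_pos (by linarith)]
    push_cast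
    ring

lemma R_sub_tau (u : ℂ) {τ : ℂ} (hτ : 0 < τ.im) :
    R (u - τ) τ = cexp (-(2 * π * I * u) + π * I * τ) *
      (-R u τ + 2 * cexp (π * I * u - π * I * τ / 4)) := by
  have := R_add_tau (u - τ) hτ
  rw [sub_add_cancel] at this
  rw [this]
  have e1 : cexp (2 * π * I * (u - τ) + π * I * τ) =
      (cexp (-(2 * π * I * u) + π * I * τ))⁻¹ := by
    rw [← Complex.exp_neg]; congr 1; ring
  have e2 : cexp (π * I * u - π * I * τ / 4) = (cexp (-(2 * π * I * u) + π * I * τ))⁻¹ *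
      cexp (-(π * I * (u - τ)) - π * I * τ / 4) := by
    rw [← Complex.exp_neg, ← Complex.exp_add]; congr 1; ring
  have := Complex.exp_ne_zero (-(2 * π * I * u) + π * I * τ)
  rw [e1, e2]
  field_simp
  ring

/-! ### Wirtinger derivatives -/

/-- The real linear map `h ↦ p h + s h̄`. -/
def wirtingerMap (p s : ℂ) : ℂ →L[ℝ] ℂ :=
  p • ContinuousLinearMap.id ℝ ℂ + s • (conjCLE : ℂ →L[ℝ] ℂ)

@[simp] lemma wirtingerMap_apply (p s h : ℂ) : wirtingerMap p s h = p * h + s * conj h := by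
  simp [wirtingerMap]

lemma norm_wirtingerMap_le (p s : ℂ) : ‖wirtingerMap p s‖ ≤ ‖p‖ + ‖s‖ := by
  refine ContinuousLinearMap.opNorm_le_bound _ (by positivity) fun h => ?_
  rw [wirtingerMap_apply]
  refine (norm_add_le _ _).trans_eq ?_
  rw [norm_mul, norm_mul, RCLike.norm_conj, add_mul]

/-- `f` has Wirtinger derivatives `∂f = p` and `∂̄f = s` at `u`. -/
def HasWirtinger (f : ℂ → ℂ) (p s u : ℂ) : Prop := HasFDerivAt f (wirtingerMap p s) u

lemma HasWirtinger.of_hasDerivAt {f : ℂ → ℂ} {p u : ℂ} (h : HasDerivAt f p u) :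
    HasWirtinger f p 0 u := by
  have := h.hasFDerivAt.restrictScalars ℝ
  refine this.congr_fderiv ?_
  ext x
  simp [mul_comm]

lemma HasWirtinger.differentiableAt {f : ℂ → ℂ} {p u : ℂ} (h : HasWirtinger f p 0 u) :
    DifferentiableAt ℂ f u := by
  rw [differentiableAt_complex_iff_differentiableAt_real]
  refine ⟨HasFDerivAt.differentiableAt h, ?_⟩
  rw [HasFDerivAt.fderiv h]
  simp [mul_comm]

lemma HasWirtinger.add {f g : ℂ → ℂ} {p s p' s' u : ℂ} (hf : HasWirtinger f p s u)
    (hg : HasWirtinger g p' s' u) : HasWirtinger (fun z => f z + g z) (p + p') (s + s') u := by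
  refine (HasFDerivAt.add hf hg).congr_fderiv ?_
  ext x
  simp
  ring

lemma HasWirtinger.mul {f g : ℂ → ℂ} {p s p' s' u : ℂ} (hf : HasWirtinger f p s u)
    (hg : HasWirtinger g p' s' u) :
    HasWirtinger (fun z => f z * g z) (f u * p' + g u * p) (f u * s' + g u * s) u := by
  refine (HasFDerivAt.mul hf hg).congr_fderiv ?_
  ext x
  simp
  ring

lemma HasWirtinger.comp_mul_left {f : ℂ → ℂ} {p s k u : ℂ} (hf : HasWirtinger f p s (k * u)) :
    HasWirtinger (fun z => f (k * z)) (p * k) (s * conj k) u := by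
  have h1 : HasFDerivAt (fun z : ℂ => k * z) (wirtingerMap k 0) u :=
    HasWirtinger.of_hasDerivAt (by simpa using (hasDerivAt_id u).const_mul k)
  refine (HasFDerivAt.comp u hf h1).congr_fderiv ?_
  ext x
  simp
  ring

/-! ### The antiholomorphic derivative of `R` -/

/-- The real factor `2√(2y)/y · exp(-2πy(m + a)²)` in the derivative of the terms of `R`. -/
def RKernel (u τ : ℂ) (n : ℤ) : ℝ :=
  2 * (√(2 * τ.im) / τ.im) * Real.exp (-(2 * π * τ.im * ((n : ℝ) + 1 / 2 + u.im / τ.im) ^ 2))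

lemma hasWirtinger_RFactor (u : ℂ) {τ : ℂ} (hτ : 0 < τ.im) (n : ℤ) :
    HasWirtinger (fun z => (RFactor z τ n : ℂ)) (RKernel u τ n / 2 * I)
      (-(RKernel u τ n / 2 * I)) u := by
  have h1 : HasFDerivAt (fun z : ℂ => ((n : ℝ) + 1 / 2 + z.im / τ.im) * √(2 * τ.im))
      ((√(2 * τ.im) / τ.im) • imCLM) u := by
    have := ((imCLM.hasFDerivAt (x := u)).mul_const (τ.im)⁻¹).const_add ((n : ℝ) + 1 / 2)
    have := this.mul_const (√(2 * τ.im))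
    refine this.congr_fderiv ?_
    ext x
    simp
    ring
  have h2 := ((hasDerivAt_E _).comp_hasFDerivAt u h1).const_sub (Real.sign ((n : ℝ) + 1 / 2))
  have h3 := (ofRealCLM.hasFDerivAt).comp u h2
  refine h3.congr_fderiv ?_
  have hsq : -π * (((n : ℝ) + 1 / 2 + u.im / τ.im) * √(2 * τ.im)) ^ 2 =
      -(2 * π * τ.im * ((n : ℝ) + 1 / 2 + u.im / τ.im) ^ 2) := by
    rw [mul_pow, Real.sq_sqrt (by positivity)]
    ring
  rw [hsq]
  ext x
  have hx : x - conj x = 2 * x.im * I := by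
    rw [Complex.sub_conj]; push_cast; ring
  simp only [ContinuousLinearMap.comp_apply, neg_apply,
    smul_apply, ofRealCLM_apply, wirtingerMap_apply, smul_eq_mul, imCLM_apply]
  rw [RKernel]
  push_cast
  generalize cexp _ = e
  linear_combination (-(√(2 * τ.im) / τ.im * e * I) : ℂ) * hx -
    2 * (√(2 * τ.im) / τ.im * e * x.im : ℂ) * I_sq

lemma hasDerivAt_RCoeff (u τ : ℂ) (n : ℤ) :
    HasDerivAt (fun z => RCoeff z τ n) (-(2 * π * I * ((n : ℂ) + 1 / 2)) * RCoeff u τ n) u := by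
  have h := ((((hasDerivAt_id u).const_mul (2 * π * I * ((n : ℂ) + 1 / 2))).const_sub
    (-(π * I * ((n : ℂ) + 1 / 2) ^ 2 * τ))).cexp).const_mul ((-1 : ℂ) ^ n)
  refine h.congr_deriv ?_
  rw [RCoeff]
  simp only [id, mul_one]
  ring

/-- The antiholomorphic derivative of `R`. -/
def RBar (u τ : ℂ) : ℂ :=
  (√(2 * τ.im) / τ.im * Real.exp (-(2 * π * u.im ^ 2 / τ.im)) : ℝ) * conj (theta u τ)

/-- Term by term: completing the square against the Gaussian from E' turns the holomorphic
coefficient into the complex conjugate of a theta term. -/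
lemma hasSum_RBar (u : ℂ) {τ : ℂ} (hτ : 0 < τ.im) :
    HasSum (fun n : ℤ => RCoeff u τ n * -(RKernel u τ n / 2 * I)) (RBar u τ) := by
  have h := ((summable_theta u hτ).hasSum.map (starRingEnd ℂ) continuous_conj).mul_left
    ((√(2 * τ.im) / τ.im * Real.exp (-(2 * π * u.im ^ 2 / τ.im)) : ℝ) : ℂ)
  refine hasSum_of_eq h (fun n => ?_) rfl
  simp only [Function.comp_apply]
  rw [RCoeff_eq_exp, RKernel, ← Complex.exp_conj]
  push_cast
  have hI : -I = cexp (-(π / 2 * I)) := by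
    rw [Complex.exp_neg, Complex.exp_pi_div_two_mul_I, inv_I]
  have hτc : conj τ = τ - 2 * I * τ.im := by
    have := Complex.sub_conj τ
    push_cast at this
    linear_combination -this
  have huc : conj u = u - 2 * I * u.im := by
    have := Complex.sub_conj u
    push_cast at this
    linear_combination -this
  have hy : (τ.im : ℂ) ≠ 0 := by exact_mod_cast hτ.ne'
  have key : cexp (n * (π * I) + (-(π * I * ((n : ℂ) + 1 / 2) ^ 2 * τ) -
        2 * π * I * ((n : ℂ) + 1 / 2) * u)) *
      (cexp (-(2 * π * τ.im * ((n : ℂ) + 1 / 2 + u.im / τ.im) ^ 2)) * -I) =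
      cexp (-(2 * π * u.im ^ 2 / τ.im)) * cexp (conj (π * I * ((n : ℂ) + 1 / 2) ^ 2 * τ +
        2 * π * I * ((n : ℂ) + 1 / 2) * (u + 1 / 2))) := by
    rw [hI, ← Complex.exp_add, ← Complex.exp_add, ← Complex.exp_add]
    refine exp_eq_of_sub n ?_
    simp only [map_add, map_mul, map_pow, map_div₀, map_one, map_ofNat, conj_I, conj_ofReal,
      map_intCast, hτc, huc]
    field_simp
    ring_nf
    rw [I_sq]
    ring
  linear_combination ((√(2 * τ.im) : ℂ) / τ.im) * key

/-- Termwise real differentiation on a horizontal strip with a uniform summable majorant. Only ∂̄R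
is needed later, so ∂R stays unspecified. -/
lemma exists_hasWirtinger_R (u : ℂ) {τ : ℂ} (hτ : 0 < τ.im) :
    ∃ p, HasWirtinger (fun z => R z τ) p (RBar u τ) u := by
  set B := |u.im / τ.im| + 1 with hB
  set U : Set ℂ := {z | |z.im / τ.im| < B} with hU
  have hUo : IsOpen U := isOpen_lt (by fun_prop) (by fun_prop)
  have hUc : IsPreconnected U := by
    refine Convex.isPreconnected fun z hz w hw a b ha hb hab => ?_
    simp only [hU, Set.mem_ofPred_eq] at hz hw ⊢
    have e : (a • z + b • w).im / τ.im = a * (z.im / τ.im) + b * (w.im / τ.im) := by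
      simp; ring
    rw [e]
    have h1 := abs_add_le (a * (z.im / τ.im)) (b * (w.im / τ.im))
    rw [abs_mul, abs_mul, abs_of_nonneg ha, abs_of_nonneg hb] at h1
    rcases ha.eq_or_lt with rfl | ha'
    · have : b = 1 := by linarith
      subst this
      linarith
    · have h2 : 0 < a * (B - |z.im / τ.im|) := mul_pos ha' (by linarith)
      have h3 : 0 ≤ b * (B - |w.im / τ.im|) := mul_nonneg hb (by linarith)
      have h4 : B = a * B + b * B := by rw [← add_mul, hab, one_mul]
      linarith
  have hu : u ∈ U := by
    change |u.im / τ.im| < |u.im / τ.im| + 1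
    linarith
  set p : ℂ → ℤ → ℂ := fun z n => RFactor z τ n * (-(2 * π * I * ((n : ℂ) + 1 / 2)) *
    RCoeff z τ n) + RCoeff z τ n * (RKernel z τ n / 2 * I) with hp
  set s : ℂ → ℤ → ℂ := fun z n => RCoeff z τ n * -(RKernel z τ n / 2 * I) with hs
  have hterm (n : ℤ) (z : ℂ) : HasFDerivAt (fun z => (RFactor z τ n : ℂ) * RCoeff z τ n)
      (wirtingerMap (p z n) (s z n)) z := by
    have := (hasWirtinger_RFactor z hτ n).mul (.of_hasDerivAt (hasDerivAt_RCoeff z τ n))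
    rwa [HasWirtinger, mul_zero, zero_add] at this
  set C := 2 * π * (2 * Real.exp (2 * π * τ.im * B ^ 2)) + 2 * (√(2 * τ.im) / τ.im) with hC
  have hbound (n : ℤ) (z : ℂ) (hz : z ∈ U) : ‖p z n‖ + ‖s z n‖ ≤ C * RBound B τ.im n := by
    have b1 := norm_RTerm_le hτ (le_of_lt hz) n
    have b2 := norm_RCoeff_mul_le hτ (le_of_lt hz) n
    have hm : ‖(n : ℂ) + 1 / 2‖ ≤ |(n : ℝ)| + 1 := by
      refine (norm_add_le _ _).trans ?_
      rw [Complex.norm_intCast]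
      norm_num
    have hK : 0 ≤ RKernel z τ n := by unfold RKernel; positivity
    have c1 : ‖(RFactor z τ n : ℂ) * (-(2 * π * I * ((n : ℂ) + 1 / 2)) * RCoeff z τ n)‖ ≤
        2 * π * ((|(n : ℝ)| + 1) * ‖(RFactor z τ n : ℂ) * RCoeff z τ n‖) := by
      rw [norm_mul, norm_mul, norm_neg, norm_mul, norm_mul, norm_mul, norm_I, Complex.norm_real π,
        Real.norm_of_nonneg Real.pi_pos.le, norm_mul, Complex.norm_ofNat]
      calc _ = 2 * π * (‖(n : ℂ) + 1 / 2‖ * (‖(RFactor z τ n : ℂ)‖ * ‖RCoeff z τ n‖)) := by ring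
        _ ≤ _ := by gcongr
    have c2 : ‖RCoeff z τ n * (RKernel z τ n / 2 * I)‖ = (√(2 * τ.im) / τ.im) *
        (‖RCoeff z τ n‖ *
          Real.exp (-(2 * π * τ.im * ((n : ℝ) + 1 / 2 + z.im / τ.im) ^ 2))) := by
      rw [norm_mul, norm_mul, norm_I, norm_div, Complex.norm_real, Real.norm_of_nonneg hK,
        Complex.norm_ofNat, RKernel]
      ring
    have c3 : ‖s z n‖ = ‖RCoeff z τ n * (RKernel z τ n / 2 * I)‖ := by
      rw [hs]; simp only [mul_neg, norm_neg]
    have c4 : ‖RCoeff z τ n‖ * Real.exp (-(2 * π * τ.im * ((n : ℝ) + 1 / 2 + z.im / τ.im) ^ 2)) ≤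
        RBound B τ.im n := by
      refine le_trans (le_mul_of_one_le_left (by positivity) ?_) b2
      linarith [abs_nonneg (n : ℝ)]
    have c5 := norm_add_le ((RFactor z τ n : ℂ) * (-(2 * π * I * ((n : ℂ) + 1 / 2)) *
      RCoeff z τ n)) (RCoeff z τ n * (RKernel z τ n / 2 * I))
    have c6 : 0 ≤ √(2 * τ.im) / τ.im := by positivity
    calc ‖p z n‖ + ‖s z n‖ ≤ 2 * π * ((|(n : ℝ)| + 1) * ‖(RFactor z τ n : ℂ) * RCoeff z τ n‖) +
          2 * ((√(2 * τ.im) / τ.im) * (‖RCoeff z τ n‖ *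
          Real.exp (-(2 * π * τ.im * ((n : ℝ) + 1 / 2 + z.im / τ.im) ^ 2)))) := by
          rw [c3, ← c2]
          linarith
      _ ≤ 2 * π * (2 * Real.exp (2 * π * τ.im * B ^ 2) * RBound B τ.im n) +
          2 * ((√(2 * τ.im) / τ.im) * RBound B τ.im n) := by gcongr
      _ = _ := by rw [hC]; ring
  have hsum := (summable_RBound B hτ).mul_left C
  have hmain := hasFDerivAt_tsum_of_isPreconnected hsum hUo hUc (fun n z _ => hterm n z)
    (fun n z hz => (norm_wirtingerMap_le _ _).trans (hbound n z hz)) hu (summable_RTerm u hτ) hu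
  have hps : Summable (p u) := Summable.of_norm_bounded hsum fun n =>
    (le_add_of_nonneg_right (norm_nonneg _)).trans (hbound n u hu)
  refine ⟨∑' n, p u n, ?_⟩
  rw [HasWirtinger]
  have e : ∑' n, wirtingerMap (p u n) (s u n) = wirtingerMap (∑' n, p u n) (RBar u τ) :=
    ((hps.hasSum.smul_const _).add ((hasSum_RBar u hτ).smul_const _)).tsum_eq
  rw [← e]
  refine hmain.congr_of_eventuallyEq (Eventually.of_forall fun z => ?_)
  exact R_eq_tsum z τ

/-- The conjugate of `theta_S` makes both terms multiples of the conjugate of ϑ(w;τ). The squared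
modulus of exp(πiw²/τ) matches the two Gaussians, and the remaining scalar is -1. -/
lemma RBar_S (w : ℂ) {τ : ℂ} (hτ : 0 < τ.im) :
    RBar w τ + ((-I * τ) ^ (1 / 2 : ℂ))⁻¹ * cexp (π * I * w ^ 2 / τ) *
      (RBar (τ⁻¹ * w) (-1 / τ) * conj τ⁻¹) = 0 := by
  have h0 := ne_zero_of_im_pos hτ
  have hN : 0 < normSq τ := normSq_pos.mpr h0
  set s := (-I * τ) ^ (1 / 2 : ℂ) with hs
  have hs2 : s ^ 2 = -I * τ := by
    rw [hs, ← Complex.cpow_nat_mul]; norm_num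
  have hs0 : s ≠ 0 := by
    intro h; rw [h] at hs2; simp [h0] at hs2
  have him : (-1 / τ).im = τ.im / normSq τ := by
    rw [neg_div, neg_im, one_div, inv_im, neg_div, neg_neg]
  have hsqrt : √(2 * (τ.im / normSq τ)) / (τ.im / normSq τ) =
      √(normSq τ) * (√(2 * τ.im) / τ.im) := by
    rw [← mul_div_assoc, Real.sqrt_div (by positivity)]
    have h1 : √(normSq τ) ≠ 0 := (Real.sqrt_pos.mpr hN).ne'
    field_simp
    rw [Real.sq_sqrt hN.le]
  -- absolute value of the exponential factor
  have hexp : cexp (π * I * w ^ 2 / τ) * conj (cexp (π * I * w ^ 2 / τ)) *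
      (Real.exp (-(2 * π * (τ⁻¹ * w).im ^ 2 / (τ.im / normSq τ))) : ℝ) =
      (Real.exp (-(2 * π * w.im ^ 2 / τ.im)) : ℝ) := by
    rw [Complex.mul_conj, Complex.normSq_eq_norm_sq, Complex.norm_exp]
    norm_cast
    rw [← Real.exp_nat_mul, ← Real.exp_add]
    congr 1
    have e1 : (π * I * w ^ 2 / τ).re = -(π * (w ^ 2 * τ⁻¹).im) := by
      rw [show (π * I * w ^ 2 / τ : ℂ) = (π : ℂ) * (I * (w ^ 2 * τ⁻¹)) by
        rw [div_eq_mul_inv]; ring, re_ofReal_mul, I_mul_re]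
      ring
    rw [e1]
    simp only [mul_im, inv_re, inv_im, pow_two, mul_re]
    rw [Complex.normSq_apply] at hN ⊢
    field_simp
    ring
  have hθ := theta_S w hτ
  rw [← hs] at hθ
  rw [RBar, RBar, show τ⁻¹ * w = w / τ by rw [mul_comm, div_eq_mul_inv], hθ, him, hsqrt]
  rw [show τ⁻¹ * w = w / τ by rw [mul_comm, div_eq_mul_inv]] at hexp
  simp only [map_mul, map_neg, conj_I, map_inv₀]
  push_cast at hexp ⊢
  rw [← hexp]
  -- the scalar identity
  have hnorm : s * conj s = √(normSq τ) := by
    rw [Complex.mul_conj, Complex.normSq_eq_norm_sq, ← norm_pow, hs2, norm_mul, norm_neg, norm_I,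
      one_mul, Complex.norm_def]
  have hcc : (√(normSq τ) : ℂ) ^ 2 = τ * conj τ := by
    rw [Complex.mul_conj]; norm_cast; exact Real.sq_sqrt hN.le
  have hcτ : conj τ ≠ 0 := by simpa using h0
  have hscal : s⁻¹ * (√(normSq τ) * I * conj s * (conj τ)⁻¹) = -1 := by
    have : conj s = √(normSq τ) * s⁻¹ := by rw [← hnorm]; field_simp
    rw [this]
    field_simp
    rw [hs2, hcc]
    field_simp
  generalize cexp (π * I * w ^ 2 / τ) = X at *
  linear_combination ((√(2 * τ.im) : ℂ) / τ.im * X * conj X *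
    cexp (-(2 * π * (w / τ).im ^ 2 / (τ.im / normSq τ))) * conj (theta w τ)) * hscal

/-- The combination of `R` with its image under `τ ↦ -1/τ` is entire. -/
lemma differentiable_R_add_R_S {τ : ℂ} (hτ : 0 < τ.im) :
    Differentiable ℂ fun w => R w τ +
      ((-I * τ) ^ (1 / 2 : ℂ))⁻¹ * cexp (π * I * w ^ 2 / τ) * R (τ⁻¹ * w) (-1 / τ) := by
  intro w
  obtain ⟨p, hp⟩ := exists_hasWirtinger_R w hτ
  obtain ⟨p', hp'⟩ := exists_hasWirtinger_R (τ⁻¹ * w) (neg_one_div_im_pos hτ)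
  have hd : DifferentiableAt ℂ
      (fun w => ((-I * τ) ^ (1 / 2 : ℂ))⁻¹ * cexp (π * I * w ^ 2 / τ)) w := by fun_prop
  have h1 := hp.add ((HasWirtinger.of_hasDerivAt hd.hasDerivAt).mul hp'.comp_mul_left)
  rw [mul_zero, add_zero, RBar_S w hτ] at h1
  exact h1.differentiableAt

/-! ### Elliptic transformations of `μ̃` -/

lemma muTilde_add_one_left (u v τ : ℂ) : muTilde (u + 1) v τ = -muTilde u v τ := by
  rw [muTilde, muTilde, mu_add_one_left, show u + 1 - v = u - v + 1 by ring, R_add_one]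
  ring

/-- The inhomogeneous terms of μ and of (i/2)R cancel; this is what the completion achieves. -/
lemma muTilde_add_tau_left {u v τ : ℂ} (hτ : 0 < τ.im) (hu : ¬ InLattice u τ)
    (hv : ¬ InLattice v τ) :
    muTilde (u + τ) v τ = -cexp (2 * π * I * (u - v) + π * I * τ) * muTilde u v τ := by
  rw [muTilde, muTilde, mu_add_tau_left hτ hu hv, show u + τ - v = u - v + τ by ring,
    R_add_tau _ hτ]
  ring

lemma muTilde_add_tau_right {u v τ : ℂ} (hτ : 0 < τ.im) (hu : ¬ InLattice u τ)
    (hv : ¬ InLattice v τ) :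
    muTilde u (v + τ) τ = -cexp (2 * π * I * (v - u) + π * I * τ) * muTilde u v τ := by
  rw [muTilde, muTilde, mu_add_tau_right hτ hu hv, show u - (v + τ) = u - v - τ by ring,
    R_sub_tau _ hτ, show -(2 * π * I * (u - v)) + π * I * τ = 2 * π * I * (v - u) + π * I * τ by
      ring]
  ring

lemma muTilde_sub_tau_left {u v τ : ℂ} (hτ : 0 < τ.im) (hu : ¬ InLattice u τ)
    (hv : ¬ InLattice v τ) :
    muTilde (u - τ) v τ = -cexp (-(2 * π * I * (u - v)) + π * I * τ) * muTilde u v τ := by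
  have hu' : ¬ InLattice (u - τ) τ := fun h => hu (by
    rw [← inLattice_add_tau, sub_add_cancel] at h; exact h)
  have := muTilde_add_tau_left hτ hu' hv
  rw [sub_add_cancel] at this
  rw [this, ← mul_assoc, neg_mul_neg, ← Complex.exp_add]
  ring_nf
  simp

lemma muTilde_add_one_tau (u v τ : ℂ) :
    muTilde u v (τ + 1) = cexp (-(π * I / 4)) * muTilde u v τ := by
  rw [muTilde, muTilde, mu_add_one_tau, R_add_one_right]
  ring

/-! ### Elliptic functions with removable singularities -/

lemma eq_zero_of_inLattice {z τ : ℂ} (h1 : |z.im| < τ.im) (h2 : |z.im| * |τ.re| < τ.im / 2)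
    (h3 : |z.re| < 1 / 2) (h : InLattice z τ) : z = 0 := by
  obtain ⟨m, n, rfl⟩ := h
  have hτ : 0 < τ.im := (abs_nonneg _).trans_lt h1
  have him : ((m : ℂ) * τ + n).im = m * τ.im := by simp
  have hre : ((m : ℂ) * τ + n).re = m * τ.re + n := by simp
  rw [him, abs_mul, abs_of_pos hτ] at h1
  have hm : m = 0 := by
    by_contra hm
    have : 1 ≤ |(m : ℝ)| := by exact_mod_cast Int.one_le_abs hm
    nlinarith
  subst hm
  have hn : n = 0 := by
    by_contra hn
    have : 1 ≤ |(n : ℝ)| := by exact_mod_cast Int.one_le_abs hn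
    rw [hre] at h3
    simp only [Int.cast_zero, zero_mul, zero_add] at h3
    linarith
  simp [hn]

lemma eventually_eq_zero_of_inLattice {τ : ℂ} (hτ : 0 < τ.im) :
    ∀ᶠ z in 𝓝 (0 : ℂ), InLattice z τ → z = 0 := by
  have h1 : ∀ᶠ z in 𝓝 (0 : ℂ), |z.im| < τ.im :=
    (continuous_im.abs.tendsto 0).eventually_lt_const (by simpa using hτ)
  have h2 : ∀ᶠ z in 𝓝 (0 : ℂ), |z.im| * |τ.re| < τ.im / 2 :=
    ((continuous_im.abs.mul continuous_const).tendsto 0).eventually_lt_const (by simpa using hτ)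
  have h3 : ∀ᶠ z in 𝓝 (0 : ℂ), |z.re| < 1 / 2 :=
    (continuous_re.abs.tendsto 0).eventually_lt_const (by norm_num)
  filter_upwards [h1, h2, h3] with z a b c
  exact eq_zero_of_inLattice a b c

lemma periodic_lattice {F : ℂ → ℂ} {τ : ℂ} (h1 : ∀ u, F (u + 1) = F u)
    (h2 : ∀ u, F (u + τ) = F u) (m n : ℤ) (u : ℂ) : F (u + (m * τ + n)) = F u := by
  have p1 : Function.Periodic F 1 := h1
  have p2 : Function.Periodic F τ := h2
  rw [← add_assoc]
  have e1 := p1.int_mul n (u + m * τ)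
  have e2 := p2.int_mul m u
  rw [mul_one] at e1
  rw [e1, e2]

/-- An elliptic function which is holomorphic outside the lattice, with removable singularities
at the lattice points, is constant. -/
lemma elliptic_eq_of_removable {f : ℂ → ℂ} {τ : ℂ} (hτ : 0 < τ.im)
    (h1 : ∀ u, ¬ InLattice u τ → f (u + 1) = f u)
    (h2 : ∀ u, ¬ InLattice u τ → f (u + τ) = f u)
    (hd : ∀ u, ¬ InLattice u τ → DifferentiableAt ℂ f u)
    (h0 : Tendsto (fun u => u * f u) (𝓝[≠] 0) (𝓝 0)) {u w : ℂ}
    (hu : ¬ InLattice u τ) (hw : ¬ InLattice w τ) : f u = f w := by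
  classical
  -- Every lattice point receives the limit at 0, so the extension is doubly periodic by
  -- construction and need only be shown differentiable at 0.
  set ℓ := limUnder (𝓝[≠] (0 : ℂ)) f with hℓ
  set F : ℂ → ℂ := fun z => if InLattice z τ then ℓ else f z with hF
  have F1 (z : ℂ) : F (z + 1) = F z := by
    simp only [hF, inLattice_add_one]
    split_ifs with h
    · rfl
    · exact h1 z h
  have F2 (z : ℂ) : F (z + τ) = F z := by
    simp only [hF, inLattice_add_tau]
    split_ifs with h
    · rfl
    · exact h2 z h
  have FL := periodic_lattice F1 F2
  -- Growth o(1/z) is the criterion for a removable singularity; the value `f 0` has no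
  -- significance, since subtracting a constant does not affect it.
  have hlit : (fun z => f z - f 0) =o[𝓝[≠] (0 : ℂ)] fun z => (z - 0)⁻¹ := by
    rw [Asymptotics.isLittleO_iff_tendsto' (by
      filter_upwards [self_mem_nhdsWithin] with z hz h
      simp only [sub_zero, inv_eq_zero] at h
      exact absurd h hz)]
    have h3 : Tendsto (fun z : ℂ => z * f 0) (𝓝[≠] 0) (𝓝 0) := by
      have : Tendsto (fun z : ℂ => z * f 0) (𝓝 0) (𝓝 (0 * f 0)) :=
        (continuous_id.mul continuous_const).tendsto 0
      rw [zero_mul] at this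
      exact this.mono_left nhdsWithin_le_nhds
    have := h0.sub h3
    rw [sub_zero] at this
    refine this.congr fun z => ?_
    rw [sub_zero, div_inv_eq_mul]
    ring
  have hF0 : DifferentiableAt ℂ F 0 := by
    have hs := eventually_eq_zero_of_inLattice hτ
    have hdo : DifferentiableOn ℂ f ({z | InLattice z τ → z = 0} \ {0}) := fun z hz =>
      (hd z fun h => hz.2 (hz.1 h)).differentiableWithinAt
    have := (differentiableOn_update_limUnder_of_isLittleO hs hdo hlit).differentiableAt hs
    refine this.congr_of_eventuallyEq ?_
    filter_upwards [hs] with z hz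
    by_cases h : InLattice z τ
    · rw [hz h]
      simp [hF, inLattice_zero, hℓ]
    · have : z ≠ 0 := fun h' => h (h' ▸ inLattice_zero τ)
      simp [hF, h, Function.update_of_ne this]
  have hFd : Differentiable ℂ F := by
    intro z
    by_cases h : InLattice z τ
    · obtain ⟨m, n, rfl⟩ := h
      have e : F = fun z => F (z - (m * τ + n)) := by
        funext z
        conv_lhs => rw [← sub_add_cancel z (m * τ + n)]
        exact FL m n _
      rw [e]
      refine DifferentiableAt.comp (𝕜 := ℂ) _ (g := F) (f := fun z => z - (m * τ + n)) ?_
        (by fun_prop)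
      rwa [sub_self]
    · refine (hd z h).congr_of_eventuallyEq ?_
      filter_upwards [eventually_not_inLattice hτ h] with y hy
      simp [hF, hy]
  -- All values are taken on the compact fundamental parallelogram, so Liouville's theorem applies.
  have hbd : Bornology.IsBounded (Set.range F) := by
    have hK : IsCompact ((fun p : ℝ × ℝ => F (p.1 * τ + p.2)) ''
        (Set.Icc 0 1 ×ˢ Set.Icc 0 1)) :=
      (isCompact_Icc.prod isCompact_Icc).image (hFd.continuous.comp (by fun_prop))
    refine hK.isBounded.subset ?_
    rintro _ ⟨z, rfl⟩
    set a := z.im / τ.im with ha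
    set b := z.re - a * τ.re with hb
    have hz : z = a * τ + b := by
      apply Complex.ext
      · simp [hb]
      · simp [ha]; field_simp
    refine ⟨(Int.fract a, Int.fract b), ⟨⟨Int.fract_nonneg a, (Int.fract_lt_one a).le⟩,
      ⟨Int.fract_nonneg b, (Int.fract_lt_one b).le⟩⟩, ?_⟩
    have : z = (Int.fract a * τ + Int.fract b : ℂ) + (⌊a⌋ * τ + ⌊b⌋) := by
      rw [hz]
      have ea : (a : ℂ) = ⌊a⌋ + Int.fract a := by exact_mod_cast (Int.floor_add_fract a).symm
      have eb : (b : ℂ) = ⌊b⌋ + Int.fract b := by exact_mod_cast (Int.floor_add_fract b).symm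
      rw [ea, eb]
      ring
    conv_rhs => rw [this]
    exact (FL _ _ _).symm
  have := hFd.apply_eq_apply_of_bounded hbd u w
  simpa [hF, hu, hw] using this

/-! ### The inversion `τ ↦ -1/τ` -/

lemma inLattice_S {u τ : ℂ} (hτ : 0 < τ.im) : InLattice (u / τ) (-1 / τ) ↔ InLattice u τ := by
  have h0 := ne_zero_of_im_pos hτ
  constructor
  · rintro ⟨m, n, h⟩
    refine ⟨n, -m, ?_⟩
    field_simp at h
    push_cast
    linear_combination h
  · rintro ⟨m, n, h⟩
    refine ⟨-n, m, ?_⟩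
    rw [h]
    push_cast
    field_simp
    ring

/-- The defect `D` of the law is holomorphic off the lattice and has the multipliers inverse to
those of ϑ(u - v), so the product is constant in u. Dividing by ϑ(u - v) is the reason for assuming
u - v off the lattice. -/
lemma muTilde_S {u v τ : ℂ} (hτ : 0 < τ.im) (hu : ¬ InLattice u τ) (hv : ¬ InLattice v τ)
    (huv : ¬ InLattice (u - v) τ) :
    muTilde (u / τ) (v / τ) (-1 / τ) =
      -((-I * τ) ^ (1 / 2 : ℂ) * cexp (-(π * I * (u - v) ^ 2 / τ))) * muTilde u v τ := by
  have h0 := ne_zero_of_im_pos hτ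
  have hτ' := neg_one_div_im_pos hτ
  set s := (-I * τ) ^ (1 / 2 : ℂ) with hs
  have hs2 : s ^ 2 = -I * τ := by
    rw [hs, ← Complex.cpow_nat_mul]; norm_num
  have hs0 : s ≠ 0 := by
    intro h; rw [h] at hs2; simp [h0] at hs2
  have hvS : ¬ InLattice (v / τ) (-1 / τ) := mt (inLattice_S hτ).mp hv
  set D : ℂ → ℂ := fun u => muTilde u v τ +
    s⁻¹ * cexp (π * I * (u - v) ^ 2 / τ) * muTilde (u / τ) (v / τ) (-1 / τ) with hD
  have hDd (u : ℂ) (hu : ¬ InLattice u τ) : DifferentiableAt ℂ D u := by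
    have e : D = fun u => (mu u v τ +
        s⁻¹ * cexp (π * I * (u - v) ^ 2 / τ) * mu (u / τ) (v / τ) (-1 / τ)) +
        I / 2 * (R (u - v) τ + s⁻¹ * cexp (π * I * (u - v) ^ 2 / τ) *
          R (τ⁻¹ * (u - v)) (-1 / τ)) := by
      funext z
      rw [hD]
      simp only [muTilde]
      rw [show z / τ - v / τ = τ⁻¹ * (z - v) by rw [← sub_div, div_eq_mul_inv, mul_comm]]
      ring
    rw [e]
    have d1 := differentiableAt_mu hτ hu hv
    have d2 : DifferentiableAt ℂ (fun u => mu (u / τ) (v / τ) (-1 / τ)) u :=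
      DifferentiableAt.comp (𝕜 := ℂ) u (f := fun u => u / τ)
        (differentiableAt_mu hτ' (mt (inLattice_S hτ).mp hu) hvS) (by fun_prop)
    have d3 : DifferentiableAt ℂ (fun u => R (u - v) τ + s⁻¹ *
        cexp (π * I * (u - v) ^ 2 / τ) * R (τ⁻¹ * (u - v)) (-1 / τ)) u :=
      DifferentiableAt.comp (𝕜 := ℂ) u (f := fun u => u - v)
        (differentiable_R_add_R_S hτ (u - v)) (by fun_prop)
    exact (d1.add (DifferentiableAt.mul (by fun_prop) d2)).add (d3.const_mul _)
  have hD1 (u : ℂ) (hu : ¬ InLattice u τ) : D (u + 1) = -D u := by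
    have e := muTilde_sub_tau_left hτ' (mt (inLattice_S hτ).mp hu) hvS
    have e1 : (u + 1) / τ = u / τ - -1 / τ := by ring
    have e2 : cexp (π * I * (u + 1 - v) ^ 2 / τ) *
        cexp (-(2 * π * I * (u / τ - v / τ)) + π * I * (-1 / τ)) =
        cexp (π * I * (u - v) ^ 2 / τ) := by
      rw [← Complex.exp_add]
      congr 1
      field_simp
      ring
    simp only [hD]
    rw [muTilde_add_one_left, e1, e, ← e2]
    ring
  have hD2 (u : ℂ) (hu : ¬ InLattice u τ) :
      D (u + τ) = -cexp (2 * π * I * (u - v) + π * I * τ) * D u := by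
    have e1 : (u + τ) / τ = u / τ + 1 := by field_simp
    have e2 : cexp (π * I * (u + τ - v) ^ 2 / τ) =
        cexp (π * I * (u - v) ^ 2 / τ) * cexp (2 * π * I * (u - v) + π * I * τ) := by
      rw [← Complex.exp_add]
      congr 1
      field_simp
      ring
    simp only [hD]
    rw [muTilde_add_tau_left hτ hu hv, e1, muTilde_add_one_left, e2]
    ring
  -- The residues of the two μ-terms at 0 cancel by the inversion formula for ϑ at v; the R-terms
  -- together are entire and contribute nothing.
  have hD0 : Tendsto (fun u => u * D u) (𝓝[≠] 0) (𝓝 0) := by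
    have t1 := tendsto_mul_mu v hτ
    have t2 : Tendsto (fun u => u / τ * mu (u / τ) (v / τ) (-1 / τ)) (𝓝[≠] 0)
        (𝓝 (-1 / (2 * π * I) / theta (v / τ) (-1 / τ))) := by
      refine (tendsto_mul_mu (v / τ) hτ').comp
        (tendsto_nhdsWithin_iff.mpr ⟨?_, ?_⟩) (f := fun u => u / τ)
      · have : Tendsto (fun u : ℂ => u / τ) (𝓝 0) (𝓝 (0 / τ)) :=
          (continuous_id.div_const τ).tendsto 0
        rw [zero_div] at this
        exact this.mono_left nhdsWithin_le_nhds
      · filter_upwards [self_mem_nhdsWithin] with z hz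
        exact div_ne_zero hz h0
    have cont {g : ℂ → ℂ} (hg : ContinuousAt g 0) : Tendsto g (𝓝[≠] 0) (𝓝 (g 0)) :=
      hg.tendsto.mono_left nhdsWithin_le_nhds
    have t3 := cont (g := fun u => s⁻¹ * cexp (π * I * (u - v) ^ 2 / τ) * τ) (by fun_prop)
    have t4 := cont (g := fun u => u * (I / 2 * (R (u - v) τ + s⁻¹ *
        cexp (π * I * (u - v) ^ 2 / τ) * R (τ⁻¹ * (u - v)) (-1 / τ)))) (by
      have : ContinuousAt (fun u => R (u - v) τ + s⁻¹ *
          cexp (π * I * (u - v) ^ 2 / τ) * R (τ⁻¹ * (u - v)) (-1 / τ)) 0 :=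
        ContinuousAt.comp (f := fun u => u - v)
          (differentiable_R_add_R_S hτ _).continuousAt (by fun_prop)
      exact continuousAt_id.mul (continuousAt_const.mul this))
    have := (t1.add (t3.mul t2)).add t4
    refine Tendsto.congr' ?_ (this.trans (le_of_eq ?_))
    · filter_upwards with z
      simp only [hD, muTilde]
      rw [show z / τ - v / τ = τ⁻¹ * (z - v) by rw [← sub_div, div_eq_mul_inv, mul_comm]]
      field_simp
      ring
    · congr 1
      have hθ := theta_ne_zero hτ hv
      rw [theta_S v hτ, ← hs]
      have hsI : s ^ 2 * I = τ := by rw [hs2]; linear_combination (-τ) * I_sq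
      have := Complex.exp_ne_zero (π * I * v ^ 2 / τ)
      have hpi : (π : ℂ) ≠ 0 := by exact_mod_cast Real.pi_ne_zero
      have hI := I_ne_zero
      simp only [zero_sub, neg_sq, zero_mul, add_zero]
      field_simp
      rw [← hsI]
      ring
  have key := elliptic_eq_of_removable (f := fun u => D u * theta (u - v) τ) hτ
    (fun u hu => by
      rw [hD1 u hu, show u + 1 - v = u - v + 1 by ring, theta_add_one]; ring)
    (fun u hu => by
      rw [hD2 u hu, show u + τ - v = u - v + τ by ring, theta_add_tau]
      have : cexp (2 * π * I * (u - v) + π * I * τ) *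
          cexp (-(π * I * τ) - 2 * π * I * (u - v)) = 1 := by
        rw [← Complex.exp_add, ← Complex.exp_zero]; congr 1; ring
      linear_combination (D u * theta (u - v) τ) * this)
    (fun u hu => (hDd u hu).mul (DifferentiableAt.comp (𝕜 := ℂ) u (f := fun u => u - v)
      (differentiable_theta hτ (u - v)) (by fun_prop)))
    (by
      have c : Tendsto (fun u => theta (u - v) τ) (𝓝[≠] 0) (𝓝 (theta (0 - v) τ)) :=
        ((differentiable_theta hτ).continuous.comp (by fun_prop :
          Continuous fun u : ℂ => u - v)).continuousAt.tendsto.mono_left nhdsWithin_le_nhds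
      have := hD0.mul c
      rw [zero_mul] at this
      refine this.congr fun u => ?_
      ring) hu hv
  -- The constant is evaluated at u = v, where ϑ(u - v) vanishes and `D` is still defined because v
  -- is not a lattice point.
  rw [sub_self, theta_zero, mul_zero] at key
  have hDu : muTilde u v τ +
    s⁻¹ * cexp (π * I * (u - v) ^ 2 / τ) * muTilde (u / τ) (v / τ) (-1 / τ) = 0 :=
    (mul_eq_zero.mp key).resolve_right (theta_ne_zero hτ huv)
  rw [Complex.exp_neg]
  have := Complex.exp_ne_zero (π * I * (u - v) ^ 2 / τ)
  field_simp at hDu ⊢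
  linear_combination hDu

/-! ### Transformations under `SL₂(ℤ)` -/

/-- The automorphy factor `γτ + δ`. -/
def autFactor (A : SL(2, ℤ)) (τ : ℍ) : ℂ := ((A 1 0 : ℤ) : ℂ) * τ + ((A 1 1 : ℤ) : ℂ)

/-- The quotient `η(Aτ)/η(τ)`, a multiplier of weight `1/2`. -/
def etaQuot (A : SL(2, ℤ)) (τ : ℍ) : ℂ := ModularForm.eta (A • τ : ℍ) / ModularForm.eta τ

lemma coe_smul_eq (A : SL(2, ℤ)) (τ : ℍ) : ((A • τ : ℍ) : ℂ) =
    (((A 0 0 : ℤ) : ℂ) * τ + ((A 0 1 : ℤ) : ℂ)) / autFactor A τ := by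
  rw [UpperHalfPlane.coe_specialLinearGroup_apply]
  simp [autFactor]

lemma det_eq_one (A : SL(2, ℤ)) : A 0 0 * A 1 1 - A 0 1 * A 1 0 = 1 := by
  have := A.det_coe
  rwa [Matrix.det_fin_two] at this

lemma det_eq_one' (A : SL(2, ℤ)) : ((A 0 0 : ℤ) : ℂ) * ((A 1 1 : ℤ) : ℂ) -
    ((A 0 1 : ℤ) : ℂ) * ((A 1 0 : ℤ) : ℂ) = 1 := by
  exact_mod_cast det_eq_one A

lemma autFactor_ne_zero (A : SL(2, ℤ)) (τ : ℍ) : autFactor A τ ≠ 0 := by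
  intro h
  have him : (A 1 0 : ℝ) * τ.im = 0 := by
    have := congrArg Complex.im h
    simpa [autFactor] using this
  have h1 : A 1 0 = 0 := by
    rcases mul_eq_zero.mp him with h | h
    · exact_mod_cast h
    · exact absurd h τ.im_pos.ne'
  have h2 : A 1 1 = 0 := by
    rw [autFactor, h1] at h
    simpa using h
  have := det_eq_one A
  rw [h1, h2] at this
  simp at this

lemma autFactor_mul (A B : SL(2, ℤ)) (τ : ℍ) :
    autFactor (A * B) τ = autFactor A (B • τ) * autFactor B τ := by
  have h := autFactor_ne_zero B τ
  rw [autFactor, autFactor, coe_smul_eq]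
  simp only [Matrix.SpecialLinearGroup.coe_mul, Matrix.mul_apply, Fin.sum_univ_two]
  field_simp
  rw [autFactor]
  push_cast
  ring

/-- This additive cocycle relation for γ/(γτ + δ) is what makes the exponential factors of the
transformation law compose. -/
lemma autFactor_cocycle (A B : SL(2, ℤ)) (τ : ℍ) :
    (((A * B) 1 0 : ℤ) : ℂ) / autFactor (A * B) τ =
      ((A 1 0 : ℤ) : ℂ) / (autFactor A (B • τ) * autFactor B τ ^ 2) +
      ((B 1 0 : ℤ) : ℂ) / autFactor B τ := by
  have h1 := autFactor_ne_zero B τ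
  have h2 := autFactor_ne_zero A (B • τ)
  have hd := det_eq_one' B
  have hm : (((A * B) 1 0 : ℤ) : ℂ) * autFactor B τ = A 1 0 +
      B 1 0 * (autFactor A (B • τ) * autFactor B τ) := by
    rw [← autFactor_mul, autFactor, autFactor]
    simp only [Matrix.SpecialLinearGroup.coe_mul, Matrix.mul_apply, Fin.sum_univ_two]
    push_cast
    linear_combination ((A 1 0 : ℤ) : ℂ) * hd
  rw [autFactor_mul]
  field_simp
  linear_combination hm

lemma etaQuot_mul (A B : SL(2, ℤ)) (τ : ℍ) :
    etaQuot (A * B) τ = etaQuot A (B • τ) * etaQuot B τ := by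
  have := ModularForm.eta_ne_zero (B • τ).2
  rw [etaQuot, etaQuot, etaQuot, mul_smul]
  field_simp

lemma etaQuot_ne_zero (A : SL(2, ℤ)) (τ : ℍ) : etaQuot A τ ≠ 0 :=
  div_ne_zero (ModularForm.eta_ne_zero (A • τ).2) (ModularForm.eta_ne_zero τ.2)

/-- The transformation law of weight `1/2` with the exponential factor
`exp(m π i γ Q(z) / (γτ + δ))`. -/
def TransformsUnder {V : Type*} [AddCommGroup V] [Module ℂ V] (f : V → ℍ → ℂ) (Q : V → ℂ) (m : ℂ)
    (A : SL(2, ℤ)) : Prop :=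
  ∃ χ : ℂ, χ ≠ 0 ∧ ∀ (τ : ℍ) (z : V), f ((autFactor A τ)⁻¹ • z) (A • τ) =
    χ * etaQuot A τ * cexp (m * (π * I) * (((A 1 0 : ℤ) : ℂ) / autFactor A τ * Q z)) * f z τ

lemma SL2Z_induction {C : SL(2, ℤ) → Prop} (one : C 1) (mul : ∀ A B, C A → C B → C (A * B))
    (hS : C ModularGroup.S) (hT : C ModularGroup.T) (A : SL(2, ℤ)) : C A := by
  induction A using (FixedDetMatrices.induction_on one_ne_zero) with
  | h0 A a1 a4 _ a6 =>
    rw [FixedDetMatrices.reps_one_id A a1 a4 a6]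
    exact one
  | hS B hb => exact mul _ _ hS hb
  | hT B hb => exact mul _ _ hT hb

lemma autFactor_one (τ : ℍ) : autFactor 1 τ = 1 := by simp [autFactor]

lemma etaQuot_one (τ : ℍ) : etaQuot 1 τ = 1 := by
  rw [etaQuot, one_smul, div_self (ModularForm.eta_ne_zero τ.2)]

/-- η(Aτ)/η(τ) is a cocycle exactly, and the exponential factor is one because Q is homogeneous of
degree 2. The law is thus closed under products and only needs S and T, the constant χ being left
free. -/
lemma transformsUnder_all {V : Type*} [AddCommGroup V] [Module ℂ V] {f : V → ℍ → ℂ} {Q : V → ℂ}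
    {m : ℂ} (hQ : ∀ (r : ℂ) (z : V), Q (r • z) = r ^ 2 * Q z)
    (hS : TransformsUnder f Q m ModularGroup.S) (hT : TransformsUnder f Q m ModularGroup.T)
    (A : SL(2, ℤ)) : TransformsUnder f Q m A := by
  refine SL2Z_induction (C := TransformsUnder f Q m) ?_ ?_ hS hT A
  · refine ⟨1, one_ne_zero, fun τ z => ?_⟩
    simp [autFactor_one, etaQuot_one]
  · rintro A B ⟨χ, hχ, hA⟩ ⟨χ', hχ', hB⟩
    refine ⟨χ * χ', mul_ne_zero hχ hχ', fun τ z => ?_⟩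
    rw [autFactor_cocycle, autFactor_mul, mul_inv, mul_smul, mul_smul, hA, hB, etaQuot_mul, hQ,
      add_mul, mul_add, Complex.exp_add]
    have : ((A 1 0 : ℤ) : ℂ) / autFactor A (B • τ) * ((autFactor B τ)⁻¹ ^ 2 * Q z) =
        ((A 1 0 : ℤ) : ℂ) / (autFactor A (B • τ) * autFactor B τ ^ 2) * Q z := by
      have := autFactor_ne_zero B τ
      have := autFactor_ne_zero A (B • τ)
      field_simp
    rw [this]
    ring

lemma coe_S_smul (τ : ℍ) : ((ModularGroup.S • τ : ℍ) : ℂ) = -1 / τ := by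
  rw [coe_smul_eq, autFactor]
  simp [ModularGroup.S]

lemma coe_T_smul (τ : ℍ) : ((ModularGroup.T • τ : ℍ) : ℂ) = τ + 1 := by
  rw [coe_smul_eq, autFactor]
  simp [ModularGroup.T]

lemma autFactor_S (τ : ℍ) : autFactor ModularGroup.S τ = τ := by
  simp [autFactor, ModularGroup.S]

lemma autFactor_T (τ : ℍ) : autFactor ModularGroup.T τ = 1 := by
  simp [autFactor, ModularGroup.T]

lemma etaQuot_T (τ : ℍ) : etaQuot ModularGroup.T τ = cexp (π * I / 12) := by
  have hη := ModularForm.eta_ne_zero τ.2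
  rw [etaQuot, coe_T_smul, div_eq_iff hη, eta_eq_qPoch, eta_eq_qPoch, ← mul_assoc,
    ← Complex.exp_add]
  have : cexp (2 * π * I * (τ + 1)) = cexp (2 * π * I * τ) :=
    exp_eq_of_sub 1 (by push_cast; ring)
  rw [this]
  ring_nf

lemma etaQuot_S (τ : ℍ) : etaQuot ModularGroup.S τ = (sqrt I)⁻¹ * sqrt τ := by
  have hη := ModularForm.eta_ne_zero τ.2
  have := ModularForm.eta_comp_eq_csqrt_I_inv τ.2
  rw [etaQuot, coe_S_smul, div_eq_iff hη]
  simpa [mul_assoc] using this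

lemma sqrt_sq' (z : ℂ) : sqrt z ^ 2 = z := by
  rw [Complex.sqrt, ← Complex.cpow_nat_mul]
  norm_num

/-- Squaring removes the choice of root, so the comparison with γτ + δ is a cocycle identity up to a
constant. -/
lemma exists_etaQuot_sq (A : SL(2, ℤ)) :
    ∃ κ : ℂ, κ ≠ 0 ∧ ∀ τ : ℍ, etaQuot A τ ^ 2 = κ * autFactor A τ := by
  refine SL2Z_induction (C := fun A => ∃ κ : ℂ, κ ≠ 0 ∧ ∀ τ : ℍ,
    etaQuot A τ ^ 2 = κ * autFactor A τ) ?_ ?_ ?_ ?_ A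
  · exact ⟨1, one_ne_zero, fun τ => by simp [autFactor_one, etaQuot_one]⟩
  · rintro A B ⟨κ, hκ, hA⟩ ⟨κ', hκ', hB⟩
    refine ⟨κ * κ', mul_ne_zero hκ hκ', fun τ => ?_⟩
    rw [etaQuot_mul, autFactor_mul, mul_pow, hA, hB]
    ring
  · refine ⟨I⁻¹, inv_ne_zero I_ne_zero, fun τ => ?_⟩
    rw [etaQuot_S, autFactor_S, mul_pow, inv_pow, sqrt_sq', sqrt_sq']
  · refine ⟨cexp (π * I / 12) ^ 2, pow_ne_zero _ (Complex.exp_ne_zero _), fun τ => ?_⟩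
    rw [etaQuot_T, autFactor_T, mul_one]

/-- Both square roots in the transformation laws under `S` agree up to a constant. -/
lemma exists_cpow_half_eq : ∃ κ : ℂ, κ ≠ 0 ∧ ∀ τ : ℍ,
    (-I * (τ : ℂ)) ^ (1 / 2 : ℂ) = κ * etaQuot ModularGroup.S τ := by
  have hI : sqrt I ≠ 0 := by
    intro h
    have := sqrt_sq' I
    rw [h, zero_pow two_ne_zero] at this
    exact I_ne_zero this.symm
  refine ⟨(-I) ^ (1 / 2 : ℂ) * sqrt I, mul_ne_zero ?_ hI, fun τ => ?_⟩
  · rw [Ne, cpow_eq_zero_iff]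
    simp
  · rw [etaQuot_S, Complex.sqrt, Complex.sqrt, ← one_div (2 : ℂ)]
    have hτ := τ.im_pos
    -- The arguments of -i and τ add up to a value in (-π, π], so the principal logarithm is
    -- additive on this product.
    have h1 : 0 < arg (τ : ℂ) :=
      lt_of_le_of_ne (arg_nonneg_iff.mpr hτ.le) (Ne.symm fun h =>
        hτ.ne' (arg_eq_zero_iff.mp h).2)
    have h2 := arg_le_pi (τ : ℂ)
    have h3 : arg (-I) = -(π / 2) := arg_neg_I
    rw [cpow_def_of_ne_zero (mul_ne_zero (neg_ne_zero.mpr I_ne_zero) τ.ne_zero),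
      cpow_def_of_ne_zero (neg_ne_zero.mpr I_ne_zero) (1 / 2),
      cpow_def_of_ne_zero τ.ne_zero,
      Complex.log_mul (neg_ne_zero.mpr I_ne_zero) τ.ne_zero
        ⟨by rw [h3]; linarith [Real.pi_pos], by rw [h3]; linarith [Real.pi_pos]⟩,
      add_mul, Complex.exp_add]
    have : I ^ (1 / 2 : ℂ) ≠ 0 := by
      rw [Ne, cpow_eq_zero_iff]
      simp
    field_simp

/-- The transformation law of `ϑ`. -/
lemma theta_transforms (A : SL(2, ℤ)) :
    TransformsUnder (V := ℂ) (fun z τ => theta z τ) (fun z => z ^ 2) 1 A := by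
  refine transformsUnder_all (fun r z => by rw [smul_eq_mul, mul_pow]) ?_ ?_ A
  · obtain ⟨κ, hκ, h⟩ := exists_cpow_half_eq
    refine ⟨-I * κ, mul_ne_zero (neg_ne_zero.mpr I_ne_zero) hκ, fun τ z => ?_⟩
    beta_reduce
    rw [coe_S_smul, autFactor_S, smul_eq_mul, inv_mul_eq_div, theta_S z τ.im_pos, h]
    have e : π * I * z ^ 2 / τ =
        1 * (π * I) * (((ModularGroup.S 1 0 : ℤ) : ℂ) / τ * z ^ 2) := by
      simp [ModularGroup.S]
      ring
    rw [e]
    ring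
  · refine ⟨cexp (π * I / 4) * (cexp (π * I / 12))⁻¹, mul_ne_zero (Complex.exp_ne_zero _)
      (inv_ne_zero (Complex.exp_ne_zero _)), fun τ z => ?_⟩
    beta_reduce
    rw [coe_T_smul, autFactor_T, etaQuot_T, inv_one, one_smul, theta_add_one_right]
    have := Complex.exp_ne_zero (π * I / 12)
    simp [ModularGroup.T]

/-- Pairs `(u,v)` at which the modular transformation of `μ̃` is considered. -/
def Admissible (z : ℂ × ℂ) (τ : ℂ) : Prop :=
  ¬ InLattice z.1 τ ∧ ¬ InLattice z.2 τ ∧ ¬ InLattice (z.1 - z.2) τ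

lemma inLattice_T {u τ : ℂ} : InLattice u (τ + 1) ↔ InLattice u τ := by
  constructor
  · rintro ⟨m, n, h⟩
    exact ⟨m, n + m, by push_cast; linear_combination h⟩
  · rintro ⟨m, n, h⟩
    exact ⟨m, n - m, by push_cast; linear_combination h⟩

open Classical in
/-- `μ̃` on admissible pairs, extended by zero. -/
def muHat (z : ℂ × ℂ) (τ : ℍ) : ℂ := if Admissible z τ then muTilde z.1 z.2 τ else 0

/-- The transformation law of `μ̃`. -/
lemma muHat_transforms (A : SL(2, ℤ)) :
    TransformsUnder muHat (fun z => (z.1 - z.2) ^ 2) (-1) A := by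
  refine transformsUnder_all (fun r z => by
    simp only [Prod.smul_fst, Prod.smul_snd, smul_eq_mul]; ring) ?_ ?_ A
  · obtain ⟨κ, hκ, h⟩ := exists_cpow_half_eq
    refine ⟨-κ, neg_ne_zero.mpr hκ, fun τ z => ?_⟩
    -- Admissibility is invariant under the action, so at excluded points both sides are 0 and the
    -- law holds for all pairs.
    have hz : Admissible ((autFactor ModularGroup.S τ)⁻¹ • z) (ModularGroup.S • τ : ℍ) ↔
        Admissible z τ := by
      rw [Admissible, Admissible, coe_S_smul, autFactor_S, Prod.smul_fst, Prod.smul_snd,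
        ← smul_sub, smul_eq_mul, smul_eq_mul, smul_eq_mul, inv_mul_eq_div, inv_mul_eq_div,
        inv_mul_eq_div, inLattice_S τ.im_pos, inLattice_S τ.im_pos, inLattice_S τ.im_pos]
    by_cases hadm : Admissible z τ
    · rw [muHat, muHat, if_pos (hz.mpr hadm), if_pos hadm]
      obtain ⟨h1, h2, h3⟩ := hadm
      rw [coe_S_smul, autFactor_S, Prod.smul_fst, Prod.smul_snd, smul_eq_mul, smul_eq_mul,
        inv_mul_eq_div, inv_mul_eq_div, muTilde_S τ.im_pos h1 h2 h3, h]
      have e : -(π * I * (z.1 - z.2) ^ 2 / τ) =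
          -1 * (π * I) * (((ModularGroup.S 1 0 : ℤ) : ℂ) / τ * (z.1 - z.2) ^ 2) := by
        simp [ModularGroup.S]
        ring
      rw [e]
      ring
    · rw [muHat, muHat, if_neg (mt hz.mp hadm), if_neg hadm, mul_zero]
  · refine ⟨cexp (-(π * I / 4)) * (cexp (π * I / 12))⁻¹, mul_ne_zero (Complex.exp_ne_zero _)
      (inv_ne_zero (Complex.exp_ne_zero _)), fun τ z => ?_⟩
    have hz : Admissible ((autFactor ModularGroup.T τ)⁻¹ • z) (ModularGroup.T • τ : ℍ) ↔
        Admissible z τ := by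
      rw [Admissible, Admissible, coe_T_smul, autFactor_T, inv_one, one_smul, inLattice_T,
        inLattice_T, inLattice_T]
    by_cases hadm : Admissible z τ
    · rw [muHat, muHat, if_pos (hz.mpr hadm), if_pos hadm, etaQuot_T, coe_T_smul, autFactor_T, inv_one, one_smul, muTilde_add_one_tau]
      have := Complex.exp_ne_zero (π * I / 12)
      simp [ModularGroup.T]
    · rw [muHat, muHat, if_neg (mt hz.mp hadm), if_neg hadm, mul_zero]

/-! ### Continuity of the multipliers in τ. -/

lemma continuous_eta_comp : Continuous fun τ : ℍ => ModularForm.eta τ := by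
  rw [continuous_iff_continuousAt]
  intro τ
  exact (ModularForm.differentiableAt_eta_of_mem_upperHalfPlaneSet τ.2).continuousAt.comp
    UpperHalfPlane.continuous_coe.continuousAt

lemma continuous_autFactor (A : SL(2, ℤ)) : Continuous (autFactor A) := by
  unfold autFactor
  have := UpperHalfPlane.continuous_coe
  fun_prop

lemma continuous_smul_SL (A : SL(2, ℤ)) : Continuous fun τ : ℍ => A • τ := by
  rw [UpperHalfPlane.isEmbedding_coe.continuous_iff]
  have : (UpperHalfPlane.coe ∘ fun τ : ℍ => A • τ) = fun τ : ℍ =>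
      (((A 0 0 : ℤ) : ℂ) * τ + ((A 0 1 : ℤ) : ℂ)) / autFactor A τ :=
    funext fun τ => coe_smul_eq A τ
  rw [this]
  have h1 := UpperHalfPlane.continuous_coe
  have h2 := continuous_autFactor A
  exact Continuous.div (by fun_prop) h2 (autFactor_ne_zero A)

lemma continuous_etaQuot (A : SL(2, ℤ)) : Continuous (etaQuot A) :=
  (continuous_eta_comp.comp (continuous_smul_SL A)).div continuous_eta_comp
    fun τ => ModularForm.eta_ne_zero τ.2

/-- A continuous function on `ℍ` with constant nonzero square is constant. -/
lemma eq_const_of_sq_eq_const {h : ℍ → ℂ} (hc : Continuous h) {κ : ℂ} (hκ : κ ≠ 0)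
    (hsq : ∀ τ, h τ ^ 2 = κ) : ∃ χ : ℂ, χ ≠ 0 ∧ ∀ τ, h τ = χ := by
  have hne (τ : ℍ) : h τ ≠ 0 := fun h0 => hκ (by rw [← hsq τ, h0]; simp)
  refine ⟨h UpperHalfPlane.I, hne _, fun τ => ?_⟩
  exact isPreconnected_univ.eq_of_sq_eq (S := Set.univ) (f := h)
    (g := fun _ => h UpperHalfPlane.I) hc.continuousOn continuousOn_const
    (fun x _ => by simp [hsq]) (fun _ => hne _) (Set.mem_univ UpperHalfPlane.I) rfl
    (Set.mem_univ τ)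

/-! ### Lattice points in real coordinates -/

/-- The point `xτ + s` is not in the lattice. -/
def OffLattice (x s : ℝ) : Prop := ¬ ∃ m n : ℤ, x = m ∧ s = n

lemma inLattice_iff {x s : ℝ} {τ : ℂ} (hτ : 0 < τ.im) :
    InLattice (x * τ + s) τ ↔ ∃ m n : ℤ, x = m ∧ s = n := by
  constructor
  · rintro ⟨m, n, h⟩
    have him := congrArg Complex.im h
    have hre := congrArg Complex.re h
    simp at him hre
    have hx : x = m := by
      rcases him with h | h
      · exact h
      · exact absurd h hτ.ne'
    rw [hx] at hre
    exact ⟨m, n, hx, by linarith⟩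
  · rintro ⟨m, n, rfl, rfl⟩
    exact ⟨m, n, by push_cast; rfl⟩

lemma not_inLattice {x s : ℝ} (h : OffLattice x s) {τ : ℂ} (hτ : 0 < τ.im) :
    ¬ InLattice (x * τ + s) τ := mt (inLattice_iff hτ).mp h

lemma offLattice_add_int {x s : ℝ} (k : ℤ) : OffLattice (x + k) s ↔ OffLattice x s := by
  refine not_congr ⟨?_, ?_⟩
  · rintro ⟨m, n, h, h'⟩
    exact ⟨m - k, n, by push_cast; linarith, h'⟩
  · rintro ⟨m, n, h, h'⟩
    exact ⟨m + k, n, by push_cast; linarith, h'⟩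

lemma inLattice_smul_iff (B : SL(2, ℤ)) (z : ℂ) (τ : ℍ) :
    InLattice ((autFactor B τ)⁻¹ * z) (B • τ : ℍ) ↔ InLattice z τ := by
  have hJ := autFactor_ne_zero B τ
  have hd := det_eq_one' B
  rw [coe_smul_eq]
  constructor
  · rintro ⟨m, n, h⟩
    refine ⟨m * B 0 0 + n * B 1 0, m * B 0 1 + n * B 1 1, ?_⟩
    field_simp at h
    rw [h, autFactor]
    push_cast
    ring
  · rintro ⟨m, n, h⟩
    refine ⟨m * B 1 1 - n * B 1 0, n * B 0 0 - m * B 0 1, ?_⟩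
    field_simp
    rw [h, autFactor]
    push_cast
    linear_combination (-(m * (τ : ℂ) + n)) * hd

/-! ### The normalized functions -/

/-- `exp(-πi(x - y)²τ) μ̃(xτ + s, yτ + t; τ)`. -/
def Zmu (x s y t : ℝ) (τ : ℂ) : ℂ :=
  cexp (-(π * I * (x - y) ^ 2 * τ)) * muTilde (x * τ + s) (y * τ + t) τ

/-- `exp(πix²τ) ϑ(xτ + s; τ)`. -/
def Ztheta (x s : ℝ) (τ : ℂ) : ℂ := cexp (π * I * x ^ 2 * τ) * theta (x * τ + s) τ

lemma Ztheta_ne_zero {x s : ℝ} (h : OffLattice x s) {τ : ℂ} (hτ : 0 < τ.im) :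
    Ztheta x s τ ≠ 0 :=
  mul_ne_zero (Complex.exp_ne_zero _) (theta_ne_zero hτ (not_inLattice h hτ))

/-- The Gaussian normalisation absorbs the τ-dependence of the quasi-period, leaving a nonzero
constant. The same happens for `Zmu`, so orders depend on x and y only modulo 1. -/
lemma Ztheta_add_one (x s : ℝ) (τ : ℂ) :
    Ztheta (x + 1) s τ = -cexp (-(2 * π * I * s)) * Ztheta x s τ := by
  rw [Ztheta, Ztheta, show ((x + 1 : ℝ) : ℂ) * τ + s = x * τ + s + τ by push_cast; ring,
    theta_add_tau]
  have : cexp (π * I * ((x + 1 : ℝ) : ℂ) ^ 2 * τ) *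
      cexp (-(π * I * τ) - 2 * π * I * (x * τ + s)) =
      cexp (-(2 * π * I * s)) * cexp (π * I * x ^ 2 * τ) := by
    rw [← Complex.exp_add, ← Complex.exp_add]
    congr 1
    push_cast
    ring
  linear_combination (-theta (x * τ + s) τ) * this

lemma Zmu_add_one_left {x s y t : ℝ} (h : OffLattice x s) (h' : OffLattice y t) {τ : ℂ}
    (hτ : 0 < τ.im) :
    Zmu (x + 1) s y t τ = -cexp (2 * π * I * (s - t)) * Zmu x s y t τ := by
  rw [Zmu, Zmu, show ((x + 1 : ℝ) : ℂ) * τ + s = x * τ + s + τ by push_cast; ring,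
    muTilde_add_tau_left hτ (not_inLattice h hτ) (not_inLattice h' hτ)]
  have : cexp (-(π * I * (((x + 1 : ℝ) : ℂ) - y) ^ 2 * τ)) *
      cexp (2 * π * I * (x * τ + s - (y * τ + t)) + π * I * τ) =
      cexp (2 * π * I * (s - t)) * cexp (-(π * I * (x - y) ^ 2 * τ)) := by
    rw [← Complex.exp_add, ← Complex.exp_add]
    congr 1
    push_cast
    ring
  linear_combination (-muTilde (x * τ + s) (y * τ + t) τ) * this

lemma Zmu_add_one_right {x s y t : ℝ} (h : OffLattice x s) (h' : OffLattice y t) {τ : ℂ}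
    (hτ : 0 < τ.im) :
    Zmu x s (y + 1) t τ = -cexp (2 * π * I * (t - s)) * Zmu x s y t τ := by
  rw [Zmu, Zmu, show ((y + 1 : ℝ) : ℂ) * τ + t = y * τ + t + τ by push_cast; ring,
    muTilde_add_tau_right hτ (not_inLattice h hτ) (not_inLattice h' hτ)]
  have : cexp (-(π * I * (x - ((y + 1 : ℝ) : ℂ)) ^ 2 * τ)) *
      cexp (2 * π * I * (y * τ + t - (x * τ + s)) + π * I * τ) =
      cexp (2 * π * I * (t - s)) * cexp (-(π * I * (x - y) ^ 2 * τ)) := by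
    rw [← Complex.exp_add, ← Complex.exp_add]
    congr 1
    push_cast
    ring
  linear_combination (-muTilde (x * τ + s) (y * τ + t) τ) * this

lemma exists_shift_const {F : ℝ → ℂ → ℂ} {s : ℝ}
    (hF : ∀ x, OffLattice x s → ∃ C : ℂ, C ≠ 0 ∧ ∀ τ : ℂ, 0 < τ.im → F (x + 1) τ = C * F x τ)
    {x : ℝ} (hx : OffLattice x s) (k : ℤ) :
    ∃ C : ℂ, C ≠ 0 ∧ ∀ τ : ℂ, 0 < τ.im → F (x + k) τ = C * F x τ := by
  induction k using Int.induction_on with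
  | zero => exact ⟨1, one_ne_zero, fun τ _ => by simp⟩
  | succ k ih =>
    obtain ⟨C, hC, h⟩ := ih
    obtain ⟨C', hC', h'⟩ := hF (x + (k : ℤ)) ((offLattice_add_int _).mpr hx)
    refine ⟨C' * C, mul_ne_zero hC' hC, fun τ hτ => ?_⟩
    rw [show x + ((k : ℤ) + 1 : ℤ) = x + (k : ℤ) + 1 by push_cast; ring, h' τ hτ, h τ hτ, mul_assoc]
  | pred k ih =>
    obtain ⟨C, hC, h⟩ := ih
    obtain ⟨C', hC', h'⟩ := hF (x + (-(k : ℤ) - 1 : ℤ)) ((offLattice_add_int _).mpr hx)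
    refine ⟨C'⁻¹ * C, mul_ne_zero (inv_ne_zero hC') hC, fun τ hτ => ?_⟩
    have := h' τ hτ
    rw [show x + (-(k : ℤ) - 1 : ℤ) + 1 = x + (-(k : ℤ) : ℤ) by push_cast; ring, h τ hτ] at this
    rw [mul_assoc, this]
    field_simp

/-! ### The functions at the cusps -/

/-- This is the role of the prefactor q^(-1/4) in `N`: added to the exponent of the transformation
law it removes the denominator and leaves a polynomial of degree one in τ. -/
lemma cusp_exponent (B : SL(2, ℤ)) (τ : ℍ) :
    ((B 1 0 : ℤ) : ℂ) / autFactor B τ *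
        (((B 0 0 : ℤ) / 2 : ℝ) * τ + ((B 0 1 : ℤ) / 2 : ℝ) : ℂ) ^ 2 + (B • τ : ℍ) / 4 =
      ((B 0 0 : ℤ) / 2 : ℂ) ^ 2 * τ + (B 0 0 : ℤ) * (B 0 1 : ℤ) / 4 := by
  have hJ := autFactor_ne_zero B τ
  have hd := det_eq_one' B
  have hV : ((B 1 0 : ℤ) : ℂ) * (((B 0 0 : ℤ) : ℂ) * τ + ((B 0 1 : ℤ) : ℂ)) =
      ((B 0 0 : ℤ) : ℂ) * autFactor B τ - 1 := by
    rw [autFactor]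
    linear_combination -hd
  rw [coe_smul_eq]
  push_cast
  field_simp
  linear_combination 4 * (((B 0 0 : ℤ) : ℂ) * τ + ((B 0 1 : ℤ) : ℂ)) * hV

/-- If both coordinates were integers, the determinant relation would exhibit ρ as an integer
combination of them. -/
lemma offLattice_of_real {ρ : ℝ} (hρ : ∀ n : ℤ, ρ ≠ n) (B : SL(2, ℤ)) :
    OffLattice ((B 1 0 : ℤ) * ρ) ((B 1 1 : ℤ) * ρ) := by
  rintro ⟨m, n, h1, h2⟩
  refine hρ (B 0 0 * n - B 0 1 * m) ?_
  have hd : ((B 0 0 : ℤ) : ℝ) * ((B 1 1 : ℤ) : ℝ) - ((B 0 1 : ℤ) : ℝ) * ((B 1 0 : ℤ) : ℝ) = 1 := by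
    exact_mod_cast det_eq_one B
  push_cast
  rw [← h1, ← h2]
  linear_combination (-ρ) * hd

lemma offLattice_half (B : SL(2, ℤ)) : OffLattice ((B 0 0 : ℤ) / 2) ((B 0 1 : ℤ) / 2) := by
  rintro ⟨m, n, h1, h2⟩
  have h1' : B 0 0 = 2 * m := by
    have : ((B 0 0 : ℤ) : ℝ) = 2 * m := by linarith
    exact_mod_cast this
  have h2' : B 0 1 = 2 * n := by
    have : ((B 0 1 : ℤ) : ℝ) = 2 * n := by linarith
    exact_mod_cast this
  have hd := det_eq_one B
  rw [h1', h2'] at hd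
  have : 2 * (m * B 1 1 - n * B 1 0) = 1 := by linarith
  omega

lemma autFactor_mul_rho (B : SL(2, ℤ)) (ρ : ℝ) (τ : ℍ) :
    (autFactor B τ)⁻¹ * ((((B 1 0 : ℤ) * ρ : ℝ) : ℂ) * τ + (((B 1 1 : ℤ) * ρ : ℝ) : ℂ)) = ρ := by
  have hJ := autFactor_ne_zero B τ
  field_simp
  rw [autFactor]
  push_cast
  ring

lemma autFactor_mul_half (B : SL(2, ℤ)) (τ : ℍ) :
    (autFactor B τ)⁻¹ * ((((B 0 0 : ℤ) / 2 : ℝ) : ℂ) * τ + (((B 0 1 : ℤ) / 2 : ℝ) : ℂ)) =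
      (B • τ : ℍ) / 2 := by
  have hJ := autFactor_ne_zero B τ
  rw [coe_smul_eq]
  push_cast
  field_simp

/-- The law of μ̃ is applied at U = Jρ and V = J·Bτ/2, with J the automorphy factor. Both are
real-affine in τ with the displayed characteristics, and the constant part of the exponent goes into
C. -/
lemma exists_muTilde_smul {ρ : ℝ} (hρ : ∀ n : ℤ, ρ ≠ n) (B : SL(2, ℤ)) :
    ∃ C : ℂ, C ≠ 0 ∧ ∀ τ : ℍ, cexp (-(π * I * (B • τ : ℍ) / 4)) *
      muTilde ρ ((B • τ : ℍ) / 2) (B • τ : ℍ) = C * etaQuot B τ *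
        Zmu ((B 1 0 : ℤ) * ρ) ((B 1 1 : ℤ) * ρ) ((B 0 0 : ℤ) / 2) ((B 0 1 : ℤ) / 2) τ := by
  obtain ⟨χ, hχ, h⟩ := muHat_transforms B
  refine ⟨χ * cexp (-(π * I) * ((B 1 0 : ℤ) * (B 1 1 : ℤ) * ρ ^ 2 - ρ * (B 1 0 : ℤ) * (B 0 1 : ℤ)
    + (B 0 0 : ℤ) * (B 0 1 : ℤ) / 4)),
    mul_ne_zero hχ (Complex.exp_ne_zero _), fun τ => ?_⟩
  have hJ := autFactor_ne_zero B τ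
  have hBim : 0 < ((B • τ : ℍ) : ℂ).im := (B • τ).im_pos
  set U : ℂ := (((B 1 0 : ℤ) * ρ : ℝ) : ℂ) * τ + (((B 1 1 : ℤ) * ρ : ℝ) : ℂ) with hU
  set V : ℂ := (((B 0 0 : ℤ) / 2 : ℝ) : ℂ) * τ + (((B 0 1 : ℤ) / 2 : ℝ) : ℂ) with hV
  have hUJ : U = autFactor B τ * ρ := by
    rw [hU, autFactor]; push_cast; ring
  have hadm : Admissible (U, V) τ := by
    refine ⟨not_inLattice (offLattice_of_real hρ B) τ.im_pos,
      not_inLattice (offLattice_half B) τ.im_pos, fun hL => ?_⟩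
    rw [← inLattice_smul_iff B, mul_sub, autFactor_mul_rho, autFactor_mul_half,
      show (ρ : ℂ) - (B • τ : ℍ) / 2 = ((-1 / 2 : ℝ) : ℂ) * (B • τ : ℍ) + (ρ : ℝ) by
        push_cast; ring, inLattice_iff hBim] at hL
    obtain ⟨m, n, h1, h2⟩ := hL
    exact hρ n h2
  have hadm' : Admissible ((autFactor B τ)⁻¹ • (U, V)) (B • τ : ℍ) := by
    obtain ⟨h1, h2, h3⟩ := hadm
    refine ⟨?_, ?_, ?_⟩
    · rw [Prod.smul_fst, smul_eq_mul, inLattice_smul_iff]; exact h1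
    · rw [Prod.smul_snd, smul_eq_mul, inLattice_smul_iff]; exact h2
    · rw [Prod.smul_fst, Prod.smul_snd, ← smul_sub, smul_eq_mul, inLattice_smul_iff]; exact h3
  have key := h τ (U, V)
  rw [muHat, muHat, if_pos hadm, if_pos hadm'] at key
  simp only [Prod.smul_fst, Prod.smul_snd, smul_eq_mul] at key
  rw [autFactor_mul_rho, autFactor_mul_half] at key
  rw [key, Zmu]
  have hc := cusp_exponent B τ
  rw [← hV] at hc
  have he : cexp (-(π * I * (B • τ : ℍ) / 4)) *
      cexp (-1 * (π * I) * (((B 1 0 : ℤ) : ℂ) / autFactor B τ * (U - V) ^ 2)) =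
      cexp (-(π * I) * ((B 1 0 : ℤ) * (B 1 1 : ℤ) * ρ ^ 2 - ρ * (B 1 0 : ℤ) * (B 0 1 : ℤ)
        + (B 0 0 : ℤ) * (B 0 1 : ℤ) / 4)) *
      cexp (-(π * I * ((((B 1 0 : ℤ) * ρ : ℝ) : ℂ) - ((B 0 0 : ℤ) / 2 : ℝ)) ^ 2 * τ)) := by
    rw [← Complex.exp_add, ← Complex.exp_add]
    congr 1
    have e1 : ((B 1 0 : ℤ) : ℂ) / autFactor B τ * (U - V) ^ 2 =
        (B 1 0 : ℤ) * ρ ^ 2 * autFactor B τ - 2 * ρ * (B 1 0 : ℤ) * V +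
        ((B 1 0 : ℤ) : ℂ) / autFactor B τ * V ^ 2 := by
      rw [hUJ]
      field_simp
      ring
    rw [e1]
    have e2 : autFactor B τ = (B 1 0 : ℤ) * τ + (B 1 1 : ℤ) := rfl
    rw [hV] at hc ⊢
    push_cast at hc ⊢
    linear_combination (-(π * I)) * hc - (π * I) * ((B 1 0 : ℤ) * ρ ^ 2) * e2
  linear_combination (χ * etaQuot B τ * muTilde U V τ) * he

lemma exists_theta_quot_smul {ρ : ℝ} (B : SL(2, ℤ)) :
    ∃ C : ℂ, C ≠ 0 ∧ ∀ τ : ℍ, cexp (-(π * I * (B • τ : ℍ) / 4)) *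
      (ModularForm.eta (B • τ : ℍ) ^ 3 /
        (theta ρ (B • τ : ℍ) * theta ((B • τ : ℍ) / 2) (B • τ : ℍ))) = C * etaQuot B τ *
        (ModularForm.eta τ ^ 3 / (Ztheta ((B 1 0 : ℤ) * ρ) ((B 1 1 : ℤ) * ρ) τ *
          Ztheta ((B 0 0 : ℤ) / 2) ((B 0 1 : ℤ) / 2) τ)) := by
  obtain ⟨χ, hχ, h⟩ := theta_transforms B
  refine ⟨χ⁻¹ ^ 2 * cexp (-(π * I) * ((B 1 0 : ℤ) * (B 1 1 : ℤ) * ρ ^ 2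
    + (B 0 0 : ℤ) * (B 0 1 : ℤ) / 4)),
    mul_ne_zero (pow_ne_zero _ (inv_ne_zero hχ)) (Complex.exp_ne_zero _), fun τ => ?_⟩
  have hJ := autFactor_ne_zero B τ
  have hη := ModularForm.eta_ne_zero τ.2
  have hq := etaQuot_ne_zero B τ
  set U : ℂ := (((B 1 0 : ℤ) * ρ : ℝ) : ℂ) * τ + (((B 1 1 : ℤ) * ρ : ℝ) : ℂ) with hU
  set V : ℂ := (((B 0 0 : ℤ) / 2 : ℝ) : ℂ) * τ + (((B 0 1 : ℤ) / 2 : ℝ) : ℂ) with hV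
  have hUJ : U = autFactor B τ * ρ := by
    rw [hU, autFactor]; push_cast; ring
  have k1 := h τ U
  have k2 := h τ V
  simp only [smul_eq_mul] at k1 k2
  rw [autFactor_mul_rho] at k1
  rw [autFactor_mul_half] at k2
  have hηB : ModularForm.eta (B • τ : ℍ) = etaQuot B τ * ModularForm.eta τ := by
    rw [etaQuot]; field_simp
  rw [k1, k2, hηB, Ztheta, Ztheta, ← hU, ← hV]
  have hc := cusp_exponent B τ
  rw [← hV] at hc
  have he : cexp (-(π * I) * ((B 1 0 : ℤ) * (B 1 1 : ℤ) * ρ ^ 2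
        + (B 0 0 : ℤ) * (B 0 1 : ℤ) / 4)) *
      (cexp (1 * (π * I) * (((B 1 0 : ℤ) : ℂ) / autFactor B τ * U ^ 2)) *
      cexp (1 * (π * I) * (((B 1 0 : ℤ) : ℂ) / autFactor B τ * V ^ 2))) =
      cexp (-(π * I * (B • τ : ℍ) / 4)) *
      (cexp (π * I * (((B 1 0 : ℤ) * ρ : ℝ) : ℂ) ^ 2 * τ) *
        cexp (π * I * (((B 0 0 : ℤ) / 2 : ℝ) : ℂ) ^ 2 * τ)) := by
    rw [← Complex.exp_add, ← Complex.exp_add, ← Complex.exp_add, ← Complex.exp_add]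
    congr 1
    have e1 : ((B 1 0 : ℤ) : ℂ) / autFactor B τ * U ^ 2 =
        (B 1 0 : ℤ) * ρ ^ 2 * autFactor B τ := by
      rw [hUJ]
      field_simp
    rw [e1]
    have e2 : autFactor B τ = (B 1 0 : ℤ) * τ + (B 1 1 : ℤ) := rfl
    push_cast at hc ⊢
    linear_combination (π * I) * hc + (π * I) * ((B 1 0 : ℤ) * ρ ^ 2) * e2
  have n1 := Complex.exp_ne_zero (1 * (π * I) * (((B 1 0 : ℤ) : ℂ) / autFactor B τ * U ^ 2))
  have n2 := Complex.exp_ne_zero (1 * (π * I) * (((B 1 0 : ℤ) : ℂ) / autFactor B τ * V ^ 2))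
  have n3 := Complex.exp_ne_zero (π * I * (((B 1 0 : ℤ) * ρ : ℝ) : ℂ) ^ 2 * τ)
  have n4 := Complex.exp_ne_zero (π * I * (((B 0 0 : ℤ) / 2 : ℝ) : ℂ) ^ 2 * τ)
  generalize cexp (1 * (π * I) * (((B 1 0 : ℤ) : ℂ) / autFactor B τ * U ^ 2)) = E₁ at *
  generalize cexp (1 * (π * I) * (((B 1 0 : ℤ) : ℂ) / autFactor B τ * V ^ 2)) = E₂ at *
  generalize cexp (π * I * (((B 1 0 : ℤ) * ρ : ℝ) : ℂ) ^ 2 * τ) = E₃ at *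
  generalize cexp (π * I * (((B 0 0 : ℤ) / 2 : ℝ) : ℂ) ^ 2 * τ) = E₄ at *
  generalize cexp (-(π * I * (B • τ : ℍ) / 4)) = E₅ at *
  generalize cexp (-(π * I) * ((B 1 0 : ℤ) * (B 1 1 : ℤ) * ρ ^ 2
        + (B 0 0 : ℤ) * (B 0 1 : ℤ) / 4)) = E₆ at *
  -- Here ρ may be an integer; then the theta product vanishes and both quotients are 0 by
  -- convention.
  by_cases hT : theta U τ * theta V τ = 0
  · have : (E₃ * theta U τ * (E₄ * theta V τ)) = 0 := by
      linear_combination (E₃ * E₄) * hT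
    rw [this]
    have : χ * etaQuot B τ * E₁ * theta U τ * (χ * etaQuot B τ * E₂ * theta V τ) = 0 := by
      linear_combination (χ * etaQuot B τ * E₁ * (χ * etaQuot B τ * E₂)) * hT
    rw [this]
    simp
  · have hT1 := left_ne_zero_of_mul hT
    have hT2 := right_ne_zero_of_mul hT
    field_simp
    linear_combination -he

/-- The affine map `τ ↦ κτ + σ` of the upper half plane. -/
def affineMap (κ σ : ℝ) (hκ : 0 < κ) (τ : ℍ) : ℍ :=
  ⟨κ * τ + σ, by simpa using mul_pos hκ τ.im_pos⟩

@[simp] lemma coe_affineMap (κ σ : ℝ) (hκ : 0 < κ) (τ : ℍ) :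
    (affineMap κ σ hκ τ : ℂ) = κ * τ + σ := rfl

lemma continuous_affineMap (κ σ : ℝ) (hκ : 0 < κ) : Continuous (affineMap κ σ hκ) := by
  rw [UpperHalfPlane.isEmbedding_coe.continuous_iff]
  have := UpperHalfPlane.continuous_coe
  change Continuous fun τ : ℍ => (κ * τ + σ : ℂ)
  fun_prop

/-- If γ = 0 the factor is constant, possibly on the branch cut; if γ > 0 its values stay in the
upper half plane, where the principal power is continuous. -/
lemma continuous_autFactor_cpow {A : SL(2, ℤ)} (hA : 0 ≤ A 1 0) (k : ℂ) :
    Continuous fun τ : ℍ => autFactor A τ ^ k := by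
  rcases hA.eq_or_lt with h | h
  · have : (fun τ : ℍ => autFactor A τ ^ k) = fun _ => ((A 1 1 : ℤ) : ℂ) ^ k := by
      funext τ
      rw [autFactor, ← h]
      simp
    rw [this]
    exact continuous_const
  · refine (continuous_autFactor A).cpow continuous_const fun τ => Or.inr ?_
    have h' : (0 : ℝ) < A 1 0 := by exact_mod_cast h
    have : (autFactor A τ).im = A 1 0 * τ.im := by simp [autFactor]
    rw [this]
    exact (mul_pos h' τ.im_pos).ne'

/-- The product has constant square because the square of the eta quotient is proportional to γτ +
δ; continuity on the connected half plane then makes it constant. -/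
lemma exists_multiplier {A B : SL(2, ℤ)} (hA : 0 ≤ A 1 0) {κ σ : ℝ} (hκ : 0 < κ) {l : ℂ}
    (hl : l ≠ 0) (hJ : ∀ τ, autFactor B (affineMap κ σ hκ τ) = l * autFactor A τ) :
    ∃ C : ℂ, C ≠ 0 ∧ ∀ τ : ℍ, autFactor A τ ^ (-((1 / 2 : ℝ) : ℂ)) *
      etaQuot B (affineMap κ σ hκ τ) = C := by
  obtain ⟨k, hk, h⟩ := exists_etaQuot_sq B
  refine eq_const_of_sq_eq_const (κ := k * l) ?_ (mul_ne_zero hk hl) fun τ => ?_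
  · exact (continuous_autFactor_cpow hA _).mul
      ((continuous_etaQuot B).comp (continuous_affineMap κ σ hκ))
  · rw [mul_pow, h, hJ, ← Complex.cpow_nat_mul]
    have := autFactor_ne_zero A τ
    rw [show ((2 : ℕ) : ℂ) * (-((1 / 2 : ℝ) : ℂ)) = -1 by push_cast; norm_num, cpow_neg_one]
    field_simp

lemma exists_weightAct_N {a c : ℤ} {ρ : ℝ} (hρc : (ρ : ℂ) = 2 * a / c) (hρ : ∀ n : ℤ, ρ ≠ n)
    {A B : SL(2, ℤ)} (hA : 0 ≤ A 1 0) {κ σ : ℝ} (hκ : 0 < κ) {l : ℂ}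
    (hl : l ≠ 0) (hJ : ∀ τ, autFactor B (affineMap κ σ hκ τ) = l * autFactor A τ)
    (hAB : ∀ τ, ((B • affineMap κ σ hκ τ : ℍ) : ℂ) = 2 * (A • τ : ℍ)) :
    ∃ C : ℂ, C ≠ 0 ∧ ∀ τ : ℍ, weightAct (1 / 2) (N a c) A τ = C *
      Zmu ((B 1 0 : ℤ) * ρ) ((B 1 1 : ℤ) * ρ) ((B 0 0 : ℤ) / 2) ((B 0 1 : ℤ) / 2)
        (κ * τ + σ) := by
  obtain ⟨C, hC, h⟩ := exists_muTilde_smul hρ B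
  obtain ⟨C', hC', h'⟩ := exists_multiplier hA hκ hl hJ
  refine ⟨C' * C, mul_ne_zero hC' hC, fun τ => ?_⟩
  have e := h (affineMap κ σ hκ τ)
  rw [hAB, mul_div_cancel_left₀ _ (two_ne_zero' ℂ)] at e
  rw [weightAct, N, ← hρc, show -(π * I * (A • τ : ℍ) / 2) = -(π * I * (2 * (A • τ : ℍ)) / 4) by
    ring, e, ← h' τ, coe_affineMap, autFactor]
  ring

lemma exists_weightAct_P {a c : ℤ} {ρ : ℝ} (hρc : (ρ : ℂ) = 2 * a / c)
    {A B : SL(2, ℤ)} (hA : 0 ≤ A 1 0) {κ σ : ℝ} (hκ : 0 < κ) {l : ℂ}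
    (hl : l ≠ 0) (hJ : ∀ τ, autFactor B (affineMap κ σ hκ τ) = l * autFactor A τ)
    (hAB : ∀ τ, ((B • affineMap κ σ hκ τ : ℍ) : ℂ) = 2 * (A • τ : ℍ)) :
    ∃ C : ℂ, C ≠ 0 ∧ ∀ τ : ℍ, weightAct (1 / 2) (P a c) A τ = C *
      (ModularForm.eta (κ * τ + σ) ^ 3 /
        (Ztheta ((B 1 0 : ℤ) * ρ) ((B 1 1 : ℤ) * ρ) (κ * τ + σ) *
          Ztheta ((B 0 0 : ℤ) / 2) ((B 0 1 : ℤ) / 2) (κ * τ + σ))) := by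
  obtain ⟨C, hC, h⟩ := exists_theta_quot_smul (ρ := ρ) B
  obtain ⟨C', hC', h'⟩ := exists_multiplier hA hκ hl hJ
  refine ⟨-cexp (-(π * I * ρ)) * (C' * C), mul_ne_zero (neg_ne_zero.mpr (Complex.exp_ne_zero _))
    (mul_ne_zero hC' hC), fun τ => ?_⟩
  have e := h (affineMap κ σ hκ τ)
  rw [hAB, mul_div_cancel_left₀ _ (two_ne_zero' ℂ)] at e
  rw [weightAct, P_eq_theta, ← hρc, mul_assoc (-cexp _), mul_left_comm,
    show -(π * I * (A • τ : ℍ) / 2) = -(π * I * (2 * (A • τ : ℍ)) / 4) by ring, e, ← h' τ,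
    coe_affineMap, autFactor]
  ring

/-! ### Behaviour at `i∞` -/

/-- The filter of neighbourhoods of `i∞`. -/
def atIInf : Filter ℂ := comap Complex.im atTop

lemma eventually_atIInf (A : ℝ) : ∀ᶠ τ in atIInf, A ≤ τ.im :=
  (eventually_ge_atTop A).comap _

lemma tendsto_cexp_atIInf {x : ℝ} (hx : 0 < x) (s : ℂ) :
    Tendsto (fun τ : ℂ => cexp (2 * π * I * (x * τ + s))) atIInf (𝓝 0) := by
  rw [tendsto_zero_iff_norm_tendsto_zero]
  have h : (fun τ : ℂ => ‖cexp (2 * π * I * (x * τ + s))‖) =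
      fun τ => Real.exp (-(2 * π * s.im)) * Real.exp (-(2 * π * x * τ.im)) := by
    funext τ
    rw [Complex.norm_exp, ← Real.exp_add]
    congr 1
    simp
    ring
  rw [h, ← mul_zero (Real.exp (-(2 * π * s.im)))]
  refine Tendsto.const_mul _ (Real.tendsto_exp_neg_atTop_nhds_zero.comp ?_)
  exact Tendsto.const_mul_atTop (by positivity) tendsto_comap

lemma norm_qPoch_sub_one_le (z : ℂ) {q : ℂ} (hq : ‖q‖ < 1) :
    ‖qPoch z q - 1‖ ≤ Real.exp (‖z‖ * (1 - ‖q‖)⁻¹) - 1 := by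
  have h := (qPoch_multipliable hq z).hasProd.tendsto_prod_nat
  refine le_of_tendsto (h.sub_const 1).norm (Eventually.of_forall fun N => ?_)
  have h1 := Finset.norm_prod_one_add_sub_one_le (Finset.range N) (fun j => -(z * q ^ j))
  simp only [← sub_eq_add_neg] at h1
  refine h1.trans (sub_le_sub_right (Real.exp_le_exp.mpr ?_) _)
  have h2 := (hasSum_geometric_of_lt_one (norm_nonneg q) hq).mul_left ‖z‖
  refine le_trans (le_of_eq ?_) (sum_le_hasSum (Finset.range N) (fun j _ => by positivity) h2)
  simp

lemma qPoch_eq_mul (z : ℂ) {q : ℂ} (hq : ‖q‖ < 1) : qPoch z q = (1 - z) * qPoch (z * q) q := by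
  have h := qPoch_multipliable hq (z * q)
  rw [qPoch, qPoch, tprod_eq_zero_mul' (f := fun j : ℕ => 1 - z * q ^ j)
    (by simpa only [pow_succ', ← mul_assoc] using h)]
  simp only [pow_zero, mul_one, pow_succ', ← mul_assoc]

lemma tendsto_qPoch {ι : Type*} {l : Filter ι} {z q : ι → ℂ} (hz : Tendsto z l (𝓝 0))
    (hq : Tendsto q l (𝓝 0)) : Tendsto (fun i => qPoch (z i) (q i)) l (𝓝 1) := by
  rw [tendsto_iff_norm_sub_tendsto_zero]
  have h1 : ∀ᶠ i in l, ‖q i‖ < 1 := by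
    have := hq.norm
    rw [norm_zero] at this
    exact this.eventually (gt_mem_nhds one_pos)
  refine squeeze_zero' (Eventually.of_forall fun i => norm_nonneg _)
    (h1.mono fun i hi => norm_qPoch_sub_one_le (z i) hi) ?_
  have h2 : Tendsto (fun i => Real.exp (‖z i‖ * (1 - ‖q i‖)⁻¹) - 1) l
      (𝓝 (Real.exp (‖(0 : ℂ)‖ * (1 - ‖(0 : ℂ)‖)⁻¹) - 1)) :=
    ((Real.continuous_exp.tendsto _).comp (hz.norm.mul
      ((tendsto_const_nhds.sub hq.norm).inv₀ (by simp)))).sub_const 1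
  simpa using h2

lemma tendsto_nome_atIInf : Tendsto (fun τ : ℂ => cexp (2 * π * I * τ)) atIInf (𝓝 0) := by
  simpa using tendsto_cexp_atIInf one_pos 0

lemma norm_nome_lt_one {τ : ℂ} (hτ : 0 < τ.im) : ‖cexp (2 * π * I * τ)‖ < 1 := by
  rw [Complex.norm_exp]
  refine Real.exp_lt_one_iff.mpr ?_
  simp
  positivity

/-- For 0 < x < 1 all factors tend to 1. For x = 0 the factor 1 - e^(2πis) survives, and it is
nonzero since s is then not an integer. -/
lemma tendsto_jacProd {x s : ℝ} (hx0 : 0 ≤ x) (hx1 : x < 1) (h : OffLattice x s) :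
    ∃ L : ℂ, L ≠ 0 ∧ Tendsto (fun τ : ℂ => jacProd (cexp (2 * π * I * (x * τ + s)))
      (cexp (2 * π * I * τ))) atIInf (𝓝 L) := by
  have h2 : Tendsto (fun τ : ℂ => qPoch (cexp (2 * π * I * τ) / cexp (2 * π * I * (x * τ + s)))
      (cexp (2 * π * I * τ))) atIInf (𝓝 1) := by
    refine tendsto_qPoch ?_ tendsto_nome_atIInf
    have := tendsto_cexp_atIInf (x := 1 - x) (by linarith) (-s)
    refine this.congr fun τ => ?_
    rw [← Complex.exp_sub]
    congr 1
    push_cast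
    ring
  rcases hx0.eq_or_lt with rfl | hx
  · have hs : (1 : ℂ) - cexp (2 * π * I * s) ≠ 0 := by
      intro h0
      have h1 : cexp (2 * π * I * s) = 1 := by linear_combination -h0
      obtain ⟨n, hn⟩ := Complex.exp_eq_one_iff.mp h1
      refine h ⟨0, n, by simp, ?_⟩
      have hn' : (2 * π * I) * ((s : ℂ) - n) = 0 := by linear_combination hn
      rcases mul_eq_zero.mp hn' with h' | h'
      · exact absurd h' Complex.two_pi_I_ne_zero
      · exact_mod_cast sub_eq_zero.mp h'
    refine ⟨1 - cexp (2 * π * I * s), hs, ?_⟩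
    have h1 : Tendsto (fun τ : ℂ => (1 - cexp (2 * π * I * s)) *
        qPoch (cexp (2 * π * I * s) * cexp (2 * π * I * τ)) (cexp (2 * π * I * τ)) *
        qPoch (cexp (2 * π * I * τ) / cexp (2 * π * I * (((0 : ℝ) : ℂ) * τ + s)))
          (cexp (2 * π * I * τ))) atIInf (𝓝 ((1 - cexp (2 * π * I * s)) * 1 * 1)) := by
      refine (Tendsto.const_mul _ (tendsto_qPoch ?_ tendsto_nome_atIInf)).mul h2
      simpa using tendsto_nome_atIInf.const_mul (cexp (2 * π * I * s))
    rw [mul_one, mul_one] at h1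
    refine h1.congr' ?_
    filter_upwards [eventually_atIInf 1] with τ hτ
    rw [jacProd, ← qPoch_eq_mul _ (norm_nome_lt_one (by linarith))]
    simp
  · refine ⟨1, one_ne_zero, ?_⟩
    have h1 := (tendsto_qPoch (tendsto_cexp_atIInf hx s) tendsto_nome_atIInf).mul h2
    rwa [mul_one] at h1

/-- In the exponent, 1/8 and -x/2 are the prefactors of the triple product and x²/2 is the
normalisation. -/
lemma tendsto_Ztheta {x s : ℝ} (hx0 : 0 ≤ x) (hx1 : x < 1) (h : OffLattice x s) :
    ∃ L : ℂ, L ≠ 0 ∧ Tendsto (fun τ : ℂ => cexp (-(2 * π * I * (1 / 8 - x / 2 + x ^ 2 / 2) * τ)) *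
      Ztheta x s τ) atIInf (𝓝 L) := by
  obtain ⟨L, hL, hl⟩ := tendsto_jacProd hx0 hx1 h
  refine ⟨-I * cexp (-(π * I * s)) * 1 * L, by simp [hL], ?_⟩
  have h1 := ((tendsto_qPoch tendsto_nome_atIInf tendsto_nome_atIInf).const_mul
    (-I * cexp (-(π * I * s)))).mul hl
  refine h1.congr' ?_
  filter_upwards [eventually_atIInf 1] with τ hτ
  rw [Ztheta, theta_eq_prod _ (by linarith)]
  have e : cexp (-(π * I * s)) = cexp (-(2 * π * I * (1 / 8 - x / 2 + x ^ 2 / 2) * τ)) *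
      cexp (π * I * x ^ 2 * τ) * cexp (π * I * τ / 4) * cexp (-(π * I * (x * τ + s))) := by
    rw [← Complex.exp_add, ← Complex.exp_add, ← Complex.exp_add]
    congr 1
    ring
  rw [e]
  ring

lemma tendsto_eta : Tendsto (fun τ : ℂ => cexp (-(2 * π * I * (1 / 24) * τ)) *
    ModularForm.eta τ) atIInf (𝓝 1) := by
  refine (tendsto_qPoch tendsto_nome_atIInf tendsto_nome_atIInf).congr fun τ => ?_
  rw [eta_eq_qPoch, ← mul_assoc, ← Complex.exp_add,
    show -(2 * π * I * (1 / 24) * τ) + π * I * τ / 12 = 0 by ring, Complex.exp_zero, one_mul]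

/-! ### The Appell sum along a line -/

/-- The first bound is the efficient one for n ≥ 0; for n < 0 the exponential in the denominator is
large and the second bound exploits its size. -/
lemma exists_lower_bound {x s : ℝ} (hx0 : 0 ≤ x) (hx1 : x < 1) (h : OffLattice x s) {ε : ℝ}
    (hε : 0 < ε) : ∃ c : ℝ, 0 < c ∧ ∀ τ : ℂ, ε ≤ τ.im → ∀ n : ℤ,
      c ≤ ‖1 - cexp (2 * π * I * n * τ + 2 * π * I * (x * τ + s))‖ ∧
      c * Real.exp (-(2 * π * (n + x) * τ.im)) ≤
        ‖1 - cexp (2 * π * I * n * τ + 2 * π * I * (x * τ + s))‖ := by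
  have main (δ : ℝ) (hδ : 0 < δ) (n : ℤ) (hn : δ ≤ |(n : ℝ) + x|) (τ : ℂ) (hτ : ε ≤ τ.im) :
      1 - Real.exp (-(δ * ε)) ≤ ‖1 - cexp (2 * π * I * n * τ + 2 * π * I * (x * τ + s))‖ ∧
      (1 - Real.exp (-(δ * ε))) * Real.exp (-(2 * π * (n + x) * τ.im)) ≤
        ‖1 - cexp (2 * π * I * n * τ + 2 * π * I * (x * τ + s))‖ := by
    set w := 2 * π * I * n * τ + 2 * π * I * (x * τ + s) with hw
    have hre : w.re = -(2 * π * (n + x) * τ.im) := by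
      rw [hw]; simp; ring
    have habs : δ * ε ≤ |w.re| := by
      rw [hre, abs_neg, abs_mul, abs_mul, abs_of_pos (by positivity : 0 < 2 * π),
        abs_of_pos (by linarith : 0 < τ.im)]
      have : 1 ≤ 2 * π := by linarith [Real.pi_gt_three]
      calc δ * ε ≤ |(n : ℝ) + x| * τ.im := by gcongr
        _ = 1 * |(n : ℝ) + x| * τ.im := by ring
        _ ≤ 2 * π * |(n : ℝ) + x| * τ.im := by gcongr; linarith
    refine ⟨norm_one_sub_exp_ge habs, ?_⟩
    have h1 := norm_one_sub_exp_ge (w := -w) (δ := δ * ε) (by rwa [neg_re, abs_neg])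
    have h2 : 1 - cexp w = -(1 - cexp (-w)) * cexp w := by
      rw [Complex.exp_neg]
      field_simp [Complex.exp_ne_zero w]
      ring
    rw [h2, norm_mul, norm_neg, Complex.norm_exp, hre]
    gcongr
  have pos (δ : ℝ) (hδ : 0 < δ) : 0 < 1 - Real.exp (-(δ * ε)) := by
    rw [sub_pos]
    exact Real.exp_lt_one_iff.mpr (by have := mul_pos hδ hε; linarith)
  rcases hx0.eq_or_lt with rfl | hx
  · have hs : 0 < ‖1 - cexp (2 * π * I * s)‖ := by
      have := one_sub_exp_ne_zero (u := (((0 : ℝ) : ℂ) * I + s)) (τ := I)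
        (not_inLattice h (by simp)) 0
      simp only [ofReal_zero, Int.cast_zero, mul_zero, zero_mul, zero_add] at this
      exact norm_pos_iff.mpr this
    refine ⟨min (1 - Real.exp (-(1 * ε))) ‖1 - cexp (2 * π * I * s)‖, lt_min (pos 1 one_pos) hs,
      fun τ hτ n => ?_⟩
    rcases eq_or_ne n 0 with rfl | hn
    · simp
    · have := main 1 one_pos n (by simpa using mod_cast Int.one_le_abs hn) τ hτ
      exact ⟨(min_le_left _ _).trans this.1, le_trans (by gcongr; exact min_le_left _ _) this.2⟩
  · have hδ : 0 < min x (1 - x) := lt_min hx (by linarith)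
    refine ⟨_, pos _ hδ, fun τ hτ n => main _ hδ n ?_ τ hτ⟩
    rcases le_or_gt 0 n with hn | hn
    · have : (0 : ℝ) ≤ n := by exact_mod_cast hn
      rw [abs_of_nonneg (by linarith)]
      exact (min_le_left _ _).trans (by linarith)
    · have : (n : ℝ) ≤ -1 := by exact_mod_cast Int.le_sub_one_of_lt hn
      rw [abs_of_nonpos (by linarith)]
      exact (min_le_right _ _).trans (by linarith)

/-- The n-th term has exponent n(n+1)/2 + ny for n ≥ 0, reduced by n + x for n < 0. The minimum is 0
(at n = 0) or 1 - x - y (at n = -1), and any other term gains at least |n| - 1; the truncated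
subtraction covers n = 0. -/
lemma norm_appell_term_le {x s y t : ℝ} (hx0 : 0 ≤ x) (hx1 : x < 1) (hy0 : 0 ≤ y) (hy1 : y < 1)
    (h : OffLattice x s) {ε : ℝ} (hε : 0 < ε) : ∃ C : ℝ, 0 < C ∧ ∀ τ : ℂ, ε ≤ τ.im → ∀ n : ℤ,
      ‖appellCoeff (y * τ + t) τ n / (1 - cexp (2 * π * I * n * τ + 2 * π * I * (x * τ + s)))‖ ≤
        C * Real.exp (-(2 * π * min 0 (1 - x - y) * τ.im)) *
          Real.exp (-(2 * π * ε * (n.natAbs - 1 : ℕ))) := by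
  obtain ⟨c, hc, hb⟩ := exists_lower_bound hx0 hx1 h hε
  refine ⟨c⁻¹, by positivity, fun τ hτ n => ?_⟩
  obtain ⟨h1, h2⟩ := hb τ hτ n
  set r := min 0 (1 - x - y) with hr
  have hr0 : r ≤ 0 := min_le_left _ _
  have hr1 : r ≤ 1 - x - y := min_le_right _ _
  have hτ0 : 0 < τ.im := hε.trans_le hτ
  have hnorm : ‖appellCoeff (y * τ + t) τ n‖ =
      Real.exp (-(2 * π * ((n : ℝ) * (n + 1) / 2 + n * y) * τ.im)) := by
    rw [appellCoeff_eq_exp, Complex.norm_exp]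
    congr 1
    have : (n : ℂ) * (n + 1) = ((n * (n + 1) : ℝ) : ℂ) := by push_cast; ring
    rw [show (π * I * n * (n + 1) * τ : ℂ) = π * I * ((n * (n + 1) : ℝ) : ℂ) * τ by
      push_cast; ring]
    simp
    ring
  have key (e : ℝ) (he : ((n.natAbs - 1 : ℕ) : ℝ) ≤ e - r) :
      Real.exp (-(2 * π * e * τ.im)) ≤
        Real.exp (-(2 * π * r * τ.im)) * Real.exp (-(2 * π * ε * (n.natAbs - 1 : ℕ))) := by
    rw [← Real.exp_add, Real.exp_le_exp]
    have : ε * ((n.natAbs - 1 : ℕ) : ℝ) ≤ τ.im * (e - r) := by gcongr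
    have := mul_le_mul_of_nonneg_left this (by positivity : 0 ≤ 2 * π)
    linarith
  rw [norm_div, hnorm, mul_assoc c⁻¹]
  rcases le_or_gt 0 n with hn | hn
  · have hn' : (0 : ℝ) ≤ n := by exact_mod_cast hn
    have := key ((n : ℝ) * (n + 1) / 2 + n * y) (by
      have h3 : ((n.natAbs - 1 : ℕ) : ℝ) ≤ n := by
        have : ((n.natAbs - 1 : ℕ) : ℤ) ≤ n := by omega
        exact_mod_cast this
      have h4 : (n : ℝ) ≤ n * (n + 1) / 2 := by
        have : n ≤ n * n := by rcases hn.eq_or_lt with h | h <;> nlinarith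
        have : 2 * n ≤ n * (n + 1) := by linarith
        have : (2 * n : ℝ) ≤ n * (n + 1) := by exact_mod_cast this
        linarith
      have := mul_nonneg hn' hy0
      linarith)
    calc _ ≤ Real.exp (-(2 * π * ((n : ℝ) * (n + 1) / 2 + n * y) * τ.im)) / c :=
          div_le_div_of_nonneg_left (Real.exp_nonneg _) hc h1
      _ = c⁻¹ * Real.exp (-(2 * π * ((n : ℝ) * (n + 1) / 2 + n * y) * τ.im)) := by ring
      _ ≤ _ := mul_le_mul_of_nonneg_left this (inv_nonneg.mpr hc.le)
  · have := key ((n : ℝ) * (n + 1) / 2 + n * y - (n + x)) (by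
      obtain ⟨m, rfl⟩ : ∃ m : ℕ, n = -(m + 1 : ℕ) := ⟨(-n - 1).toNat, by omega⟩
      have h3 : (-((m + 1 : ℕ) : ℤ)).natAbs - 1 = m := by omega
      rw [h3]
      push_cast
      have h4 : (m : ℝ) ≤ m * m := by exact_mod_cast Nat.le_mul_self m
      have h5 : (m : ℝ) * y ≤ m := by
        have := mul_le_mul_of_nonneg_left hy1.le (Nat.cast_nonneg (α := ℝ) m)
        linarith
      nlinarith)
    calc _ ≤ Real.exp (-(2 * π * ((n : ℝ) * (n + 1) / 2 + n * y) * τ.im)) /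
          (c * Real.exp (-(2 * π * (n + x) * τ.im))) :=
          div_le_div_of_nonneg_left (Real.exp_nonneg _) (mul_pos hc (Real.exp_pos _)) h2
      _ = c⁻¹ * Real.exp (-(2 * π * ((n : ℝ) * (n + 1) / 2 + n * y - (n + x)) * τ.im)) := by
        rw [show -(2 * π * ((n : ℝ) * (n + 1) / 2 + n * y - (n + x)) * τ.im) =
          -(2 * π * ((n : ℝ) * (n + 1) / 2 + n * y) * τ.im) - -(2 * π * (n + x) * τ.im) by ring,
          Real.exp_sub]
        field_simp
      _ ≤ _ := mul_le_mul_of_nonneg_left this (inv_nonneg.mpr hc.le)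

lemma summable_exp_natAbs {ε : ℝ} (hε : 0 < ε) :
    Summable fun n : ℤ => Real.exp (-(2 * π * ε * (n.natAbs - 1 : ℕ))) := by
  have h : Summable fun n : ℕ => Real.exp (-(2 * π * ε * (n - 1 : ℕ))) := by
    rw [← summable_nat_add_iff 1]
    have := summable_geometric_of_lt_one (Real.exp_nonneg (-(2 * π * ε)))
      (Real.exp_lt_one_iff.mpr (by have := mul_pos Real.pi_pos hε; linarith))
    refine this.congr fun n => ?_
    rw [← Real.exp_nat_mul, Nat.add_sub_cancel]
    congr 1
    ring
  exact Summable.of_nat_of_neg (by simpa using h) (by simpa using h)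

lemma appell_isBigO {x s y t : ℝ} (hx0 : 0 ≤ x) (hx1 : x < 1) (hy0 : 0 ≤ y) (hy1 : y < 1)
    (h : OffLattice x s) : (fun τ : ℂ => appell (x * τ + s) (y * τ + t) τ) =O[atIInf]
      fun τ => Real.exp (-(2 * π * min 0 (1 - x - y) * τ.im)) := by
  obtain ⟨C, hC, hb⟩ := norm_appell_term_le (t := t) hx0 hx1 hy0 hy1 h one_pos
  refine Asymptotics.IsBigO.of_bound
    (C * ∑' n : ℤ, Real.exp (-(2 * π * 1 * (n.natAbs - 1 : ℕ)))) ?_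
  filter_upwards [eventually_atIInf 1] with τ hτ
  rw [Real.norm_of_nonneg (Real.exp_nonneg _), mul_right_comm]
  exact tsum_of_norm_bounded ((summable_exp_natAbs one_pos).hasSum.mul_left _) (hb τ hτ)

lemma differentiableAt_appell_line {x s y t : ℝ} (hx0 : 0 ≤ x) (hx1 : x < 1) (hy0 : 0 ≤ y)
    (hy1 : y < 1) (h : OffLattice x s) {τ : ℂ} (hτ : 0 < τ.im) :
    DifferentiableAt ℂ (fun τ : ℂ => appell (x * τ + s) (y * τ + t) τ) τ := by
  obtain ⟨C, hC, hb⟩ := norm_appell_term_le (t := t) hx0 hx1 hy0 hy1 h (half_pos hτ)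
  -- The upper bound on Im z is needed because the majorant grows with Im z when 1 - x - y is
  -- negative.
  set U : Set ℂ := {z | τ.im / 2 < z.im ∧ z.im < τ.im + 1}
  have hU : IsOpen U := (isOpen_lt continuous_const Complex.continuous_im).inter
    (isOpen_lt Complex.continuous_im continuous_const)
  refine (differentiableOn_tsum_of_summable_norm
    ((summable_exp_natAbs (half_pos hτ)).mul_left
      (C * Real.exp (2 * π * (-min 0 (1 - x - y)) * (τ.im + 1)))) (fun n => ?_) hU
    (fun n z hz => ?_)).differentiableAt (hU.mem_nhds ⟨by linarith, by linarith⟩)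
  · intro z hz
    have hz0 : 0 < z.im := (half_pos hτ).trans hz.1
    simp only [appellCoeff]
    refine (DifferentiableAt.div (by fun_prop) (by fun_prop) ?_).differentiableWithinAt
    exact one_sub_exp_ne_zero (not_inLattice h hz0) n
  · refine (hb z hz.1.le n).trans ?_
    gcongr
    have : 0 ≤ -min 0 (1 - x - y) := by simp
    have := mul_le_mul_of_nonneg_left hz.2.le (mul_nonneg (by positivity : 0 ≤ 2 * π) this)
    linarith

lemma differentiableAt_mu_line {x s y t : ℝ} (hx0 : 0 ≤ x) (hx1 : x < 1) (hy0 : 0 ≤ y)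
    (hy1 : y < 1) (h : OffLattice x s) (h' : OffLattice y t) {τ : ℂ} (hτ : 0 < τ.im) :
    DifferentiableAt ℂ (fun τ : ℂ => mu (x * τ + s) (y * τ + t) τ) τ := by
  simp only [mu_eq_appell]
  exact ((by fun_prop : DifferentiableAt ℂ (fun τ : ℂ => cexp (π * I * (x * τ + s))) τ).div
    (differentiableAt_theta_line y t hτ) (theta_ne_zero hτ (not_inLattice h' hτ))).mul
    (differentiableAt_appell_line hx0 hx1 hy0 hy1 h hτ)

/-- The two cases of ν record which Appell term dominates, n = 0 or n = -1. -/
lemma nu_eq (x y : ℝ) : nu x y = x / 2 + y / 2 - 1 / 8 + min 0 (1 - x - y) := by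
  rw [nu]
  split_ifs with h
  · rw [min_eq_left (by linarith)]; ring
  · rw [min_eq_right (by linarith)]; ring

/-- The exponent collects x/2 from exp(πiu), y/2 - 1/8 from 1/ϑ and min(0, 1 - x - y) from the
Appell sum, besides the normalisation. -/
lemma mu_isBigO {x s y t : ℝ} (hx0 : 0 ≤ x) (hx1 : x < 1) (hy0 : 0 ≤ y) (hy1 : y < 1)
    (h : OffLattice x s) (h' : OffLattice y t) :
    (fun τ : ℂ => cexp (-(π * I * (x - y) ^ 2 * τ)) * mu (x * τ + s) (y * τ + t) τ) =O[atIInf]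
      fun τ => Real.exp (-(2 * π * (nu x y - (x - y) ^ 2 / 2) * τ.im)) := by
  obtain ⟨L, hL, hl⟩ := tendsto_Ztheta hy0 hy1 h'
  have h1 := (hl.inv₀ hL).isBigO_one ℝ
  have h2 := h1.mul (appell_isBigO (t := t) hx0 hx1 hy0 hy1 h)
  have h3 : (fun τ : ℂ => cexp (-(π * I * (x - y) ^ 2 * τ)) *
      cexp (π * I * (x * τ + s)) * cexp (π * I * y ^ 2 * τ) *
      cexp (-(2 * π * I * (1 / 8 - y / 2 + y ^ 2 / 2) * τ))) =O[atIInf]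
      fun τ => Real.exp (-(2 * π * (x / 2 + y / 2 - 1 / 8 - (x - y) ^ 2 / 2) * τ.im)) := by
    refine Asymptotics.IsBigO.of_bound 1 (Eventually.of_forall fun τ => le_of_eq ?_)
    rw [← Complex.exp_add, ← Complex.exp_add, ← Complex.exp_add, Complex.norm_exp,
      Real.norm_of_nonneg (Real.exp_nonneg _), one_mul]
    congr 1
    rw [show -(π * I * (x - y) ^ 2 * τ) + π * I * (x * τ + s) + π * I * y ^ 2 * τ +
        -(2 * π * I * (1 / 8 - y / 2 + y ^ 2 / 2) * τ) =
      ((π * (x + y - 1 / 4 - (x - y) ^ 2) : ℝ) : ℂ) * (I * τ) + ((π * s : ℝ) : ℂ) * I by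
        push_cast; ring, add_re, re_ofReal_mul, re_ofReal_mul, I_mul_re, I_re]
    ring
  refine (h3.mul h2).congr (fun τ => ?_) (fun τ => ?_)
  · rw [Ztheta, mu_eq_appell]
    have n1 := Complex.exp_ne_zero (-(2 * π * I * (1 / 8 - y / 2 + y ^ 2 / 2) * τ))
    have n2 := Complex.exp_ne_zero (π * I * y ^ 2 * τ)
    generalize cexp (-(2 * π * I * (1 / 8 - y / 2 + y ^ 2 / 2) * τ)) = E₁ at *
    generalize cexp (π * I * y ^ 2 * τ) = E₂ at *
    simp only [mul_inv]
    field_simp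
  · rw [one_mul, ← Real.exp_add, nu_eq]
    congr 1
    ring

/-! ### Rational numbers and periodic holomorphic functions -/

/-- The real number `x` is rational. -/
def IsRat (x : ℝ) : Prop := ∃ q : ℚ, x = q

lemma IsRat.add {x y : ℝ} (hx : IsRat x) (hy : IsRat y) : IsRat (x + y) := by
  obtain ⟨p, rfl⟩ := hx
  obtain ⟨q, rfl⟩ := hy
  exact ⟨p + q, by push_cast; rfl⟩

lemma IsRat.neg {x : ℝ} (hx : IsRat x) : IsRat (-x) := by
  obtain ⟨p, rfl⟩ := hx
  exact ⟨-p, by push_cast; rfl⟩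

lemma IsRat.sub {x y : ℝ} (hx : IsRat x) (hy : IsRat y) : IsRat (x - y) := by
  rw [sub_eq_add_neg]
  exact hx.add hy.neg

lemma IsRat.mul {x y : ℝ} (hx : IsRat x) (hy : IsRat y) : IsRat (x * y) := by
  obtain ⟨p, rfl⟩ := hx
  obtain ⟨q, rfl⟩ := hy
  exact ⟨p * q, by push_cast; rfl⟩

lemma IsRat.div {x y : ℝ} (hx : IsRat x) (hy : IsRat y) : IsRat (x / y) := by
  obtain ⟨p, rfl⟩ := hx
  obtain ⟨q, rfl⟩ := hy
  exact ⟨p / q, by push_cast; rfl⟩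

lemma IsRat.pow {x : ℝ} (hx : IsRat x) (n : ℕ) : IsRat (x ^ n) := by
  obtain ⟨p, rfl⟩ := hx
  exact ⟨p ^ n, by push_cast; rfl⟩

lemma isRat_int (n : ℤ) : IsRat n := ⟨n, by push_cast; rfl⟩

lemma isRat_ofNat (n : ℕ) [n.AtLeastTwo] : IsRat (OfNat.ofNat n) := ⟨OfNat.ofNat n, by simp⟩

lemma isRat_one : IsRat 1 := ⟨1, by simp⟩

lemma isRat_zero : IsRat 0 := ⟨0, by simp⟩

lemma IsRat.fract {x : ℝ} (hx : IsRat x) : IsRat (Int.fract x) := hx.sub (isRat_int _)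

lemma IsRat.min {x y : ℝ} (hx : IsRat x) (hy : IsRat y) : IsRat (min x y) := by
  rcases min_choice x y with h | h <;> rw [h] <;> assumption

lemma IsRat.exists_den {x : ℝ} (hx : IsRat x) : ∃ (d : ℕ) (n : ℤ), 0 < d ∧ x * d = n := by
  obtain ⟨q, rfl⟩ := hx
  exact ⟨q.den, q.num, q.den_pos, by exact_mod_cast Rat.mul_den_eq_num q⟩

/-- Holomorphic functions on the upper half plane having a positive integer as a period. -/
structure PeriodicHol (f : ℂ → ℂ) : Prop where
  differentiableAt : ∀ τ : ℂ, 0 < τ.im → DifferentiableAt ℂ f τ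
  exists_period : ∃ M : ℕ, 0 < M ∧ ∀ τ : ℂ, 0 < τ.im → f (τ + M) = f τ

lemma period_mul {f : ℂ → ℂ} {M : ℕ} (h : ∀ τ : ℂ, 0 < τ.im → f (τ + M) = f τ) (k : ℕ) (τ : ℂ)
    (hτ : 0 < τ.im) : f (τ + (k * M : ℕ)) = f τ := by
  induction k with
  | zero => simp
  | succ k ih =>
    rw [show τ + ((k + 1) * M : ℕ) = τ + (k * M : ℕ) + M by push_cast; ring, h _ (by simpa), ih]

lemma PeriodicHol.mul {f g : ℂ → ℂ} (hf : PeriodicHol f) (hg : PeriodicHol g) :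
    PeriodicHol fun τ => f τ * g τ := by
  refine ⟨fun τ hτ => (hf.1 τ hτ).mul (hg.1 τ hτ), ?_⟩
  obtain ⟨M, hM, h⟩ := hf.2
  obtain ⟨N, hN, h'⟩ := hg.2
  refine ⟨M * N, by positivity, fun τ hτ => ?_⟩
  rw [period_mul h' M τ hτ, mul_comm M N, period_mul h N τ hτ]

lemma PeriodicHol.add {f g : ℂ → ℂ} (hf : PeriodicHol f) (hg : PeriodicHol g) :
    PeriodicHol fun τ => f τ + g τ := by
  refine ⟨fun τ hτ => (hf.1 τ hτ).add (hg.1 τ hτ), ?_⟩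
  obtain ⟨M, hM, h⟩ := hf.2
  obtain ⟨N, hN, h'⟩ := hg.2
  refine ⟨M * N, by positivity, fun τ hτ => ?_⟩
  rw [period_mul h' M τ hτ, mul_comm M N, period_mul h N τ hτ]

lemma PeriodicHol.inv {f : ℂ → ℂ} (hf : PeriodicHol f) (h0 : ∀ τ : ℂ, 0 < τ.im → f τ ≠ 0) :
    PeriodicHol fun τ => (f τ)⁻¹ := by
  refine ⟨fun τ hτ => (hf.1 τ hτ).inv (h0 τ hτ), ?_⟩
  obtain ⟨M, hM, h⟩ := hf.2
  exact ⟨M, hM, fun τ hτ => by rw [h τ hτ]⟩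

lemma periodicHol_const (C : ℂ) : PeriodicHol fun _ => C :=
  ⟨fun _ _ => differentiableAt_const _, 1, one_pos, fun _ _ => rfl⟩

lemma PeriodicHol.const_mul {f : ℂ → ℂ} (hf : PeriodicHol f) (C : ℂ) :
    PeriodicHol fun τ => C * f τ := (periodicHol_const C).mul hf

lemma PeriodicHol.pow {f : ℂ → ℂ} (hf : PeriodicHol f) (n : ℕ) :
    PeriodicHol fun τ => f τ ^ n := by
  induction n with
  | zero => simpa using periodicHol_const 1
  | succ n ih => simpa only [pow_succ] using ih.mul hf

lemma periodicHol_exp {r : ℝ} (hr : IsRat r) : PeriodicHol fun τ => cexp (2 * π * I * r * τ) := by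
  refine ⟨fun τ _ => by fun_prop, ?_⟩
  obtain ⟨d, n, hd, h⟩ := hr.exists_den
  refine ⟨d, hd, fun τ _ => exp_eq_of_sub n ?_⟩
  have h' : (r : ℂ) * d = n := by exact_mod_cast h
  linear_combination (2 * π * I) * h'

lemma PeriodicHol.comp_affine {f : ℂ → ℂ} (hf : PeriodicHol f) {κ : ℝ} (hκ : 0 < κ)
    (hκ' : IsRat κ) (σ : ℝ) : PeriodicHol fun τ => f (κ * τ + σ) := by
  refine ⟨fun τ hτ => ?_, ?_⟩
  · exact (hf.1 (κ * τ + σ) (by simpa using mul_pos hκ hτ)).comp (g := f) τ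
      (f := fun τ : ℂ => κ * τ + σ) (by fun_prop)
  · obtain ⟨M, hM, h⟩ := hf.2
    obtain ⟨d, n, hd, hn⟩ := hκ'.exists_den
    have hn0 : 0 < n := by
      have : (0 : ℝ) < n := by rw [← hn]; positivity
      exact_mod_cast this
    lift n to ℕ using hn0.le
    refine ⟨d * M, by positivity, fun τ hτ => ?_⟩
    have hn' : (κ : ℂ) * d = n := by exact_mod_cast hn
    rw [show κ * (τ + (d * M : ℕ)) + σ = κ * τ + σ + (n * M : ℕ) by
      push_cast; linear_combination (M : ℂ) * hn',
      period_mul h n _ (by simpa using mul_pos hκ hτ)]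

lemma tendsto_affine_atIInf {κ : ℝ} (hκ : 0 < κ) (σ : ℝ) :
    Tendsto (fun τ : ℂ => κ * τ + σ) atIInf atIInf := by
  rw [atIInf, tendsto_comap_iff]
  have : (Complex.im ∘ fun τ : ℂ => κ * τ + σ) = fun τ => κ * τ.im := by funext τ; simp
  rw [this]
  exact Tendsto.const_mul_atTop hκ tendsto_comap

/-! ### Expansions -/

/-- After division by e^(2πirτ) the function is periodic and bounded at i∞, hence a power series in
e^(2πiτ/M). The condition D ∣ M allows the non-holomorphic part to share the same M. -/
lemma exists_hasExpansion {f : ℂ → ℂ} (hf : PeriodicHol f) {r : ℝ} (hr : IsRat r)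
    (hO : f =O[atIInf] fun τ => Real.exp (-(2 * π * r * τ.im))) {D : ℕ} (hD : 0 < D) :
    ∃ (M : ℕ) (m₀ : ℤ) (a : ℕ → ℂ), 0 < M ∧ D ∣ M ∧ (m₀ : ℝ) = r * M ∧
      HasExpansion (fun τ => f τ) M m₀ a ∧
      ∀ L, Tendsto (fun τ => cexp (-(2 * π * I * r * τ)) * f τ) atIInf (𝓝 L) → a 0 = L := by
  obtain ⟨d, n, hd, hn⟩ := hr.exists_den
  obtain ⟨N, hN, hper⟩ := hf.2
  set M : ℕ := N * d * D with hM
  have hM0 : 0 < M := by positivity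
  have hM0' : (0 : ℝ) < M := by exact_mod_cast hM0
  have hm : ((n * N * D : ℤ) : ℝ) = r * M := by
    rw [hM]; push_cast; linear_combination -(N * D : ℝ) * hn
  set G : ℂ → ℂ := fun τ => cexp (-(2 * π * I * r * τ)) * f τ with hG
  have hGper (τ : ℂ) (hτ : 0 < τ.im) : G (τ + M) = G τ := by
    have h1 : f (τ + M) = f τ := by
      rw [show M = (d * D) * N by rw [hM]; ring]; exact period_mul hper _ τ hτ
    rw [hG]
    simp only [h1]
    congr 1
    refine exp_eq_of_sub (-(n * N * D)) ?_
    have h' : ((n * N * D : ℤ) : ℂ) = r * M := by exact_mod_cast hm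
    push_cast at h' ⊢
    linear_combination (2 * π * I) * h'
  have hGdiff (τ : ℂ) (hτ : 0 < τ.im) : DifferentiableAt ℂ G τ :=
    DifferentiableAt.mul (by fun_prop) (hf.1 τ hτ)
  have hGO : G =O[atIInf] fun _ => (1 : ℝ) := by
    have h1 : (fun τ : ℂ => cexp (-(2 * π * I * r * τ))) =O[atIInf]
        fun τ => Real.exp (2 * π * r * τ.im) := by
      refine Asymptotics.IsBigO.of_bound 1 (Eventually.of_forall fun τ => le_of_eq ?_)
      rw [Complex.norm_exp, Real.norm_of_nonneg (Real.exp_nonneg _), one_mul]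
      congr 1
      simp
    refine (h1.mul hO).congr_right fun τ => ?_
    rw [← Real.exp_add]
    simp
  set g : ℍ → ℂ := fun τ => G τ with hg
  have hgc (w : ℂ) (hw : 0 < w.im) : (g ∘ UpperHalfPlane.ofComplex) w = G w := by
    simp [hg, UpperHalfPlane.ofComplex_apply_of_im_pos hw]
  have hgper : Function.Periodic (g ∘ UpperHalfPlane.ofComplex) (M : ℝ) := by
    intro w
    by_cases hw : 0 < w.im
    · have hw' : 0 < (w + (M : ℝ)).im := by simpa
      rw [hgc _ hw', hgc w hw]
      simpa using hGper w hw
    · have hw1 : w.im ≤ 0 := not_lt.mp hw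
      have hw2 : (w + (M : ℝ)).im ≤ 0 := by simpa using hw1
      rw [Function.comp_apply, Function.comp_apply,
        UpperHalfPlane.ofComplex_apply_of_im_nonpos hw1,
        UpperHalfPlane.ofComplex_apply_of_im_nonpos hw2]
  have hghol (τ : ℍ) := (UpperHalfPlane.mdifferentiableAt_iff (f := g) (τ := τ)).mpr <| by
    refine (hGdiff τ τ.im_pos).congr_of_eventuallyEq ?_
    filter_upwards [UpperHalfPlane.isOpen_upperHalfPlaneSet.mem_nhds τ.im_pos] with w hw
    exact hgc w hw
  have hcoe : Tendsto (fun τ : ℍ => (τ : ℂ)) UpperHalfPlane.atImInfty atIInf :=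
    UpperHalfPlane.tendsto_coe_atImInfty
  have hgbdd : UpperHalfPlane.IsBoundedAtImInfty g := hGO.comp_tendsto hcoe
  have hsum := UpperHalfPlane.hasSum_qExpansion hM0' hgper hghol hgbdd
  refine ⟨M, n * N * D, fun k => (UpperHalfPlane.qExpansion M g).coeff k, hM0,
    Dvd.intro_left _ rfl, hm, fun τ => ?_, fun L hL => ?_⟩
  · refine hasSum_of_eq ((hsum τ).mul_left (cexp (2 * π * I * r * τ))) (fun k => ?_) ?_
    · rw [Function.Periodic.qParam, ← Complex.exp_nat_mul, smul_eq_mul, mul_left_comm,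
        ← Complex.exp_add]
      congr 2
      have h' : ((n * N * D : ℤ) : ℂ) = r * M := by exact_mod_cast hm
      have hMc : (M : ℂ) ≠ 0 := by exact_mod_cast hM0.ne'
      rw [h']
      push_cast
      field_simp
    · rw [hg, hG, ← mul_assoc, ← Complex.exp_add]
      simp
  · have h1 := UpperHalfPlane.qExpansion_coeff_zero hM0'
      (UpperHalfPlane.analyticAt_cuspFunction_zero hM0' hgper hghol hgbdd) hgper
    exact h1.trans (hL.comp hcoe).limUnder_eq

lemma HasExpansion.invariantOrderAtLeast {f : ℍ → ℂ} {M : ℕ} {m₀ : ℤ} {a : ℕ → ℂ} (hM : 0 < M)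
    (h : HasExpansion f M m₀ a) : InvariantOrderAtLeast f ((m₀ : ℝ) / M) := by
  by_cases ha : ∀ n, a n = 0
  · left
    funext τ
    refine (h τ).unique ?_
    simp [ha]
  · right
    have ha' : ∃ n, a n ≠ 0 := by push Not at ha; exact ha
    classical
    set k := Nat.find ha' with hk
    refine ⟨((m₀ + k : ℤ) : ℝ) / M, ⟨M, m₀ + k, fun n => a (n + k), hM, fun τ => ?_, ?_, rfl⟩, ?_⟩
    · have h1 := (hasSum_nat_add_iff' k).mpr (h τ)
      rw [Finset.sum_eq_zero (fun i hi => by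
        rw [not_not.mp (Nat.find_min ha' (Finset.mem_range.mp hi)), zero_mul]), sub_zero] at h1
      refine hasSum_of_eq h1 (fun n => ?_) rfl
      rw [show ((m₀ + k : ℤ) : ℂ) + n = (m₀ : ℂ) + (n + k : ℕ) by push_cast; ring]
    · simpa using Nat.find_spec ha'
    · gcongr
      linarith [Nat.cast_nonneg (α := ℝ) k]

lemma hasInvariantOrder_of_tendsto {f : ℂ → ℂ} (hf : PeriodicHol f) {r : ℝ} (hr : IsRat r)
    {L : ℂ} (hL : L ≠ 0)
    (h : Tendsto (fun τ => cexp (-(2 * π * I * r * τ)) * f τ) atIInf (𝓝 L)) :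
    HasInvariantOrder (fun τ => f τ) r := by
  have hO : f =O[atIInf] fun τ => Real.exp (-(2 * π * r * τ.im)) := by
    have h1 : (fun τ : ℂ => cexp (2 * π * I * r * τ)) =O[atIInf]
        fun τ => Real.exp (-(2 * π * r * τ.im)) := by
      refine Asymptotics.IsBigO.of_bound 1 (Eventually.of_forall fun τ => le_of_eq ?_)
      rw [Complex.norm_exp, Real.norm_of_nonneg (Real.exp_nonneg _), one_mul]
      congr 1
      simp
    refine (h1.mul (h.isBigO_one ℝ)).congr (fun τ => ?_) (fun τ => mul_one _)
    rw [← mul_assoc, ← Complex.exp_add]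
    simp
  obtain ⟨M, m₀, a, hM, -, hm, hexp, ha⟩ := exists_hasExpansion hf hr hO one_pos
  refine ⟨M, m₀, a, hM, hexp, by rwa [ha L h], ?_⟩
  have : (M : ℝ) ≠ 0 := by exact_mod_cast hM.ne'
  rw [hm]
  field_simp

/-! ### The periodic holomorphic functions occurring at the cusps -/

lemma mu_add_even (u v τ : ℂ) (m n : ℤ) : mu (u + 2 * m) (v + 2 * n) τ = mu u v τ := by
  have h1 (v : ℂ) : Function.Periodic (fun u => mu u v τ) 2 := fun u => by
    rw [show u + 2 = u + 1 + 1 by ring]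
    simp only [mu_add_one_left, neg_neg]
  have h2 (u : ℂ) : Function.Periodic (fun v => mu u v τ) 2 := fun v => by
    rw [show v + 2 = v + 1 + 1 by ring]
    simp only [mu_add_one_right, neg_neg]
  have e1 := (h1 (v + 2 * n)).int_mul m u
  have e2 := (h2 u).int_mul n v
  simp only [mul_comm _ (2 : ℂ)] at e1 e2
  rw [e1, e2]

lemma theta_add_even (z τ : ℂ) (n : ℤ) : theta (z + 2 * n) τ = theta z τ := by
  have h : Function.Periodic (fun z => theta z τ) 2 := fun z => by
    rw [show z + 2 = z + 1 + 1 by ring]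
    simp only [theta_add_one, neg_neg]
  have e := h.int_mul n z
  simp only [mul_comm _ (2 : ℂ)] at e
  exact e

lemma periodic_of_multiplier {f : ℂ → ℂ} {k : ℕ} {w : ℂ} (hw : w ^ k = 1)
    (h : ∀ τ, f (τ + 1) = w * f τ) (d : ℕ) (τ : ℂ) : f (τ + (d * k : ℕ)) = f τ := by
  have h1 (n : ℕ) : f (τ + n) = w ^ n * f τ := by
    induction n with
    | zero => simp
    | succ n ih =>
      rw [show τ + ((n + 1 : ℕ) : ℂ) = τ + n + 1 by push_cast; ring, h, ih, pow_succ]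
      ring
  rw [h1, mul_comm d k, pow_mul, hw, one_pow, one_mul]

lemma mu_add_eight (u v τ : ℂ) (d : ℕ) : mu u v (τ + (d * 8 : ℕ)) = mu u v τ := by
  refine periodic_of_multiplier (f := fun τ => mu u v τ) (w := cexp (-(π * I / 4))) ?_
    (mu_add_one_tau u v) d τ
  rw [← Complex.exp_nat_mul, show ((8 : ℕ) : ℂ) * -(π * I / 4) = (-1 : ℤ) * (2 * π * I) by
    push_cast; ring, Complex.exp_int_mul_two_pi_mul_I]

lemma theta_add_eight (z τ : ℂ) (d : ℕ) : theta z (τ + (d * 8 : ℕ)) = theta z τ := by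
  refine periodic_of_multiplier (f := fun τ => theta z τ) (w := cexp (π * I / 4)) ?_
    (theta_add_one_right z) d τ
  rw [← Complex.exp_nat_mul, show ((8 : ℕ) : ℂ) * (π * I / 4) = (1 : ℤ) * (2 * π * I) by
    push_cast; ring, Complex.exp_int_mul_two_pi_mul_I]

lemma periodicHol_mu {x s y t : ℝ} (hx : IsRat x) (hy : IsRat y) (hx0 : 0 ≤ x) (hx1 : x < 1)
    (hy0 : 0 ≤ y) (hy1 : y < 1) (h : OffLattice x s) (h' : OffLattice y t) :
    PeriodicHol fun τ => mu (x * τ + s) (y * τ + t) τ := by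
  refine ⟨fun τ hτ => differentiableAt_mu_line hx0 hx1 hy0 hy1 h h' hτ, ?_⟩
  obtain ⟨d, n, hd, hn⟩ := hx.exists_den
  obtain ⟨e, m, he, hm⟩ := hy.exists_den
  -- The factor 8 kills the eighth root of unity from τ ↦ τ + 1 and makes the induced integer shifts
  -- of u and v even, so that no sign appears.
  refine ⟨d * e * 8, by positivity, fun τ _ => ?_⟩
  have hn' : (x : ℂ) * d = n := by exact_mod_cast hn
  have hm' : (y : ℂ) * e = m := by exact_mod_cast hm
  rw [show x * (τ + (d * e * 8 : ℕ)) + s = x * τ + s + 2 * (4 * e * n : ℤ) by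
    push_cast; linear_combination (8 * e : ℂ) * hn',
    show y * (τ + (d * e * 8 : ℕ)) + t = y * τ + t + 2 * (4 * d * m : ℤ) by
    push_cast; linear_combination (8 * d : ℂ) * hm', mu_add_even, mu_add_eight]

lemma periodicHol_Ztheta {x : ℝ} (hx : IsRat x) (s : ℝ) : PeriodicHol (Ztheta x s) := by
  have h1 : PeriodicHol fun τ => theta (x * τ + s) τ := by
    refine ⟨fun τ hτ => differentiableAt_theta_line x s hτ, ?_⟩
    obtain ⟨d, n, hd, hn⟩ := hx.exists_den
    refine ⟨d * 8, by positivity, fun τ _ => ?_⟩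
    have hn' : (x : ℂ) * d = n := by exact_mod_cast hn
    rw [show x * (τ + (d * 8 : ℕ)) + s = x * τ + s + 2 * (4 * n : ℤ) by
      push_cast; linear_combination (8 : ℂ) * hn', theta_add_even, theta_add_eight]
  have h2 := (periodicHol_exp ((hx.pow 2).div (isRat_ofNat 2))).mul h1
  have e : (fun τ => cexp (2 * π * I * ((x ^ 2 / 2 : ℝ) : ℂ) * τ) * theta (x * τ + s) τ) =
      Ztheta x s := by
    funext τ
    rw [Ztheta]
    congr 2
    push_cast
    ring
  rwa [e] at h2

lemma periodicHol_eta : PeriodicHol ModularForm.eta := by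
  refine ⟨fun τ hτ => ModularForm.differentiableAt_eta_of_mem_upperHalfPlaneSet hτ, 24,
    by norm_num, fun τ _ => ?_⟩
  rw [eta_eq_qPoch, eta_eq_qPoch]
  have e1 : cexp (π * I * (τ + (24 : ℕ)) / 12) = cexp (π * I * τ / 12) :=
    exp_eq_of_sub 1 (by push_cast; ring)
  have e2 : cexp (2 * π * I * (τ + (24 : ℕ))) = cexp (2 * π * I * τ) :=
    exp_eq_of_sub 24 (by push_cast; ring)
  rw [e1, e2]

/-- The quotient of theta functions describing `P` at the cusps. -/
lemma hasInvariantOrder_theta_quot {x s y t : ℝ} (hx : IsRat x) (hy : IsRat y) (hx0 : 0 ≤ x)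
    (hx1 : x < 1) (hy0 : 0 ≤ y) (hy1 : y < 1) (h : OffLattice x s) (h' : OffLattice y t)
    {κ σ : ℝ} (hκ : 0 < κ) (hκ' : IsRat κ) {C : ℂ} (hC : C ≠ 0) :
    HasInvariantOrder (fun τ : ℍ => C * (ModularForm.eta (κ * τ + σ) ^ 3 /
      (Ztheta x s (κ * τ + σ) * Ztheta y t (κ * τ + σ))))
      (κ * (x / 2 - x ^ 2 / 2 + y / 2 - y ^ 2 / 2 - 1 / 8)) := by
  set r : ℝ := x / 2 - x ^ 2 / 2 + y / 2 - y ^ 2 / 2 - 1 / 8 with hr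
  have hrr : IsRat r := by
    have h2 := isRat_ofNat 2
    exact ((((hx.div h2).sub ((hx.pow 2).div h2)).add (hy.div h2)).sub ((hy.pow 2).div h2)).sub
      (isRat_one.div (isRat_ofNat 8))
  obtain ⟨L₁, hL₁, hl₁⟩ := tendsto_Ztheta hx0 hx1 h
  obtain ⟨L₂, hL₂, hl₂⟩ := tendsto_Ztheta hy0 hy1 h'
  have hper : PeriodicHol fun τ => C * (ModularForm.eta τ ^ 3 * (Ztheta x s τ * Ztheta y t τ)⁻¹) :=
    ((periodicHol_eta.pow 3).mul (((periodicHol_Ztheta hx s).mul (periodicHol_Ztheta hy t)).inv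
      fun τ hτ => mul_ne_zero (Ztheta_ne_zero h hτ) (Ztheta_ne_zero h' hτ))).const_mul C
  have hlim : Tendsto (fun τ => cexp (-(2 * π * I * r * τ)) *
      (C * (ModularForm.eta τ ^ 3 * (Ztheta x s τ * Ztheta y t τ)⁻¹))) atIInf
      (𝓝 (C * (1 ^ 3 * (L₁ * L₂)⁻¹))) := by
    refine (((tendsto_eta.pow 3).mul ((hl₁.mul hl₂).inv₀ (mul_ne_zero hL₁ hL₂))).const_mul
      C).congr fun τ => ?_
    have e : cexp (-(2 * π * I * r * τ)) = cexp (-(2 * π * I * (1 / 24) * τ)) ^ 3 *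
        (cexp (-(2 * π * I * (1 / 8 - x / 2 + x ^ 2 / 2) * τ)) *
          cexp (-(2 * π * I * (1 / 8 - y / 2 + y ^ 2 / 2) * τ)))⁻¹ := by
      rw [← Complex.exp_add, ← Complex.exp_neg, ← Complex.exp_nat_mul, ← Complex.exp_add, hr]
      congr 1
      push_cast
      ring
    rw [e]
    simp only [mul_inv]
    ring
  have haff := tendsto_affine_atIInf hκ σ
  have hlim' := (hlim.comp haff).const_mul (cexp (2 * π * I * r * σ))
  have := hasInvariantOrder_of_tendsto (hper.comp_affine hκ hκ' σ) (hκ'.mul hrr)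
    (L := cexp (2 * π * I * r * σ) * (C * (1 ^ 3 * (L₁ * L₂)⁻¹)))
    (mul_ne_zero (Complex.exp_ne_zero _) (by simp [hC, hL₁, hL₂])) (hlim'.congr fun τ => by
      simp only [Function.comp_apply]
      rw [← mul_assoc, ← Complex.exp_add]
      congr 2
      push_cast
      ring)
  simpa only [div_eq_mul_inv] using this

/-! ### The incomplete Gamma function -/

lemma integrableOn_incGamma {x : ℝ} (hx : 0 ≤ x) :
    MeasureTheory.IntegrableOn (fun t : ℝ => Real.exp (-t) * t ^ ((1 - 1 / 2 : ℝ) - 1))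
      (Set.Ioi x) :=
  (Real.GammaIntegral_convergent (by norm_num)).mono_set (Set.Ioi_subset_Ioi hx)

/-- Substitution t = πw² in the incomplete Gamma integral with parameter 1/2. -/
lemma one_sub_E_eq {x : ℝ} (hx : 0 < x) :
    1 - E x = (√π)⁻¹ * incGamma (1 - 1 / 2) (π * x ^ 2) := by
  have hg (w : ℝ) (hw : 0 < w) : Real.exp (-(π * w ^ 2)) * (π * w ^ 2) ^ ((1 - 1 / 2 : ℝ) - 1) *
      (2 * π * w) = 2 * √π * Real.exp (-π * w ^ 2) := by
    rw [show (1 - 1 / 2 : ℝ) - 1 = -(1 / 2) by norm_num, Real.rpow_neg (by positivity),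
      ← Real.sqrt_eq_rpow, Real.sqrt_mul Real.pi_pos.le, Real.sqrt_sq hw.le, neg_mul]
    have h1 : √π ≠ 0 := (Real.sqrt_pos.mpr Real.pi_pos).ne'
    field_simp
    rw [Real.sq_sqrt Real.pi_pos.le]
  have himg : (fun w : ℝ => π * w ^ 2) '' Set.Ici x ⊆ Set.Ioi 0 := by
    rintro _ ⟨w, hw, rfl⟩
    have : 0 < w := hx.trans_le hw
    simp only [Set.mem_Ioi]
    positivity
  have h := MeasureTheory.integral_comp_mul_deriv_Ioi (f := fun w : ℝ => π * w ^ 2)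
    (f' := fun w => 2 * π * w) (g := fun t : ℝ => Real.exp (-t) * t ^ ((1 - 1 / 2 : ℝ) - 1))
    (a := x) (by fun_prop)
    ((tendsto_pow_atTop two_ne_zero).const_mul_atTop Real.pi_pos)
    (fun w _ => by
      have := ((hasDerivAt_pow 2 w).const_mul π).hasDerivWithinAt (s := Set.Ioi w)
      refine this.congr_deriv ?_
      push_cast
      ring)
    (by
      refine ContinuousOn.mono (s := Set.Ioi 0) (fun t ht => ?_)
        ((Set.image_mono Set.Ioi_subset_Ici_self).trans himg)
      exact ((Real.continuous_exp.comp continuous_neg).continuousAt.mul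
        (Real.continuousAt_rpow_const t _ (Or.inl (ne_of_gt ht)))).continuousWithinAt)
    ((integrableOn_incGamma le_rfl).mono_set himg)
    (by
      refine MeasureTheory.IntegrableOn.congr_fun (f := fun w => 2 * √π * Real.exp (-π * w ^ 2))
        ?_ (fun w hw => ?_) measurableSet_Ici
      · exact ((integrable_exp_neg_mul_sq Real.pi_pos).const_mul _).integrableOn
      · exact (hg w (hx.trans_le hw)).symm)
  rw [incGamma, ← h, one_sub_E]
  have : (∫ w in Set.Ioi x, ((fun t : ℝ => Real.exp (-t) * t ^ ((1 - 1 / 2 : ℝ) - 1)) ∘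
      fun w : ℝ => π * w ^ 2) w * (2 * π * w)) =
      ∫ w in Set.Ioi x, 2 * √π * Real.exp (-π * w ^ 2) :=
    MeasureTheory.setIntegral_congr_fun measurableSet_Ioi fun w hw => hg w (hx.trans hw)
  rw [this, MeasureTheory.integral_const_mul, ← mul_assoc, ← mul_assoc]
  have h1 : √π ≠ 0 := (Real.sqrt_pos.mpr Real.pi_pos).ne'
  field_simp

lemma sign_sub_E_eq (x : ℝ) :
    Real.sign x - E x = Real.sign x * (√π)⁻¹ * incGamma (1 - 1 / 2) (π * x ^ 2) := by
  rcases lt_trichotomy x 0 with h | rfl | h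
  · have := one_sub_E_eq (neg_pos.mpr h)
    rw [E_neg, neg_sq] at this
    rw [Real.sign_of_neg h]
    linarith
  · simp [E]
  · rw [Real.sign_of_pos h, one_sub_E_eq h]
    ring

lemma tendsto_incGamma : Tendsto (fun x => incGamma (1 - 1 / 2) x) atTop (𝓝 0) := by
  refine squeeze_zero' ?_ ?_ Real.tendsto_exp_neg_atTop_nhds_zero
  · filter_upwards [eventually_ge_atTop 0] with x hx
    exact MeasureTheory.setIntegral_nonneg measurableSet_Ioi fun t ht =>
      mul_nonneg (Real.exp_nonneg _) (Real.rpow_nonneg (hx.trans (le_of_lt ht)) _)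
  · filter_upwards [eventually_ge_atTop 1] with x hx
    rw [← integral_exp_neg_Ioi]
    refine MeasureTheory.setIntegral_mono_on (integrableOn_incGamma (by linarith))
      (integrableOn_exp_neg_Ioi x) measurableSet_Ioi fun t ht => ?_
    refine mul_le_of_le_one_right (Real.exp_nonneg _) ?_
    exact Real.rpow_le_one_of_one_le_of_nonpos (hx.trans (le_of_lt ht)) (by norm_num)

/-! ### Uniqueness of the holomorphic part -/

/-- Convergence at x = 0 already gives absolute summability of the coefficients, so integrating
termwise against a character over a period isolates each of them. -/
lemma eq_zero_of_hasSum_fourier {A : ℤ → ℂ}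
    (h : ∀ x : ℝ, HasSum (fun j : ℤ => A j * cexp (2 * π * I * j * x)) 0) : A = 0 := by
  funext k
  let f (j : ℤ) : C(ℝ, ℂ) := ⟨fun x => A j * cexp (2 * π * I * (j - k) * x), by fun_prop⟩
  have hA : Summable fun j => ‖A j‖ := by
    have := (h 0).summable.norm
    simpa using this
  have hf : Summable fun j => ‖(f j).restrict
      (⟨Set.uIcc (0 : ℝ) 1, isCompact_uIcc⟩ : TopologicalSpace.Compacts ℝ)‖ := by
    refine Summable.of_nonneg_of_le (fun j => norm_nonneg _) (fun j => ?_) hA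
    rw [ContinuousMap.norm_le _ (norm_nonneg _)]
    rintro ⟨x, hx⟩
    change ‖A j * cexp (2 * π * I * (j - k) * x)‖ ≤ _
    rw [norm_mul, show 2 * π * I * (j - k) * x = ((2 * π * (j - k) * x : ℝ) : ℂ) * I by
      push_cast; ring, Complex.norm_exp_ofReal_mul_I, mul_one]
  have h1 := intervalIntegral.hasSum_intervalIntegral_of_summable_norm hf
  have h2 (x : ℝ) : ∑' j, f j x = 0 := by
    refine (hasSum_of_eq ((h x).mul_left (cexp (-(2 * π * I * k * x)))) (fun j => ?_)
      (mul_zero _).symm).tsum_eq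
    change A j * cexp (2 * π * I * (j - k) * x) = _
    rw [mul_left_comm, ← Complex.exp_add]
    congr 2
    ring
  simp only [h2, intervalIntegral.integral_zero] at h1
  have h3 (j : ℤ) : ∫ x in (0 : ℝ)..1, f j x = if j = k then A k else 0 := by
    change ∫ x in (0 : ℝ)..1, A j * cexp (2 * π * I * (j - k) * x) = _
    rw [intervalIntegral.integral_const_mul]
    split_ifs with hj
    · simp [hj]
    · have hc : 2 * π * I * ((j : ℂ) - k) ≠ 0 :=
        mul_ne_zero Complex.two_pi_I_ne_zero (sub_ne_zero.mpr (by exact_mod_cast hj))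
      rw [integral_exp_mul_complex hc]
      have : cexp (2 * π * I * ((j : ℂ) - k) * (1 : ℝ)) = 1 := by
        have := Complex.exp_int_mul_two_pi_mul_I (j - k)
        rw [← this]
        congr 1
        push_cast
        ring
      rw [this]
      simp
  simp only [h3] at h1
  exact (hasSum_ite_eq k (A k)).unique h1

lemma hasSum_extend {N : ℕ → ℤ} (hN : Function.Injective N) {a : ℕ → ℂ} {e : ℤ → ℂ} {S : ℂ}
    (h : HasSum (fun n => a n * e (N n)) S) :
    HasSum (fun j => Function.extend N a 0 j * e j) S := by
  refine (hN.hasSum_iff (f := fun j => Function.extend N a 0 j * e j) fun j hj => ?_).mp ?_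
  · rw [Function.extend_apply' _ _ _ hj, Pi.zero_apply, zero_mul]
  · simpa only [Function.comp_def, hN.extend_apply] using h

/-- Re-indexing over ℤ with any multiple L of M, so that two decompositions with different
denominators can be compared. -/
lemma IsHolomorphicPart.exists_fourier {F g : ℍ → ℂ} (h : IsHolomorphicPart (1 / 2) F g) :
    ∃ M : ℕ, 0 < M ∧ ∀ L : ℕ, 0 < L → M ∣ L → ∃ α β : ℤ → ℂ, (∀ j, 0 ≤ j → β j = 0) ∧
      (∀ τ : ℍ, HasSum (fun j : ℤ => α j * cexp (2 * π * I * τ * j / L)) (g τ)) ∧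
      ∀ τ : ℍ, HasSum (fun j : ℤ => β j * (incGamma (1 - 1 / 2) (4 * π * (-j) * τ.im / L) *
        cexp (2 * π * I * τ * j / L))) (F τ - g τ) := by
  obtain ⟨M, n₀, a, b, hM, hg, hF⟩ := h
  refine ⟨M, hM, fun L hL ⟨K, hK⟩ => ?_⟩
  have hK0 : 0 < K := Nat.pos_of_mul_pos_left (hK ▸ hL)
  have hM' : (M : ℂ) ≠ 0 := by exact_mod_cast hM.ne'
  have hK' : (K : ℂ) ≠ 0 := by exact_mod_cast hK0.ne'
  have hMr : (M : ℝ) ≠ 0 := by exact_mod_cast hM.ne'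
  have hKr : (K : ℝ) ≠ 0 := by exact_mod_cast hK0.ne'
  have hKz : (K : ℤ) ≠ 0 := by exact_mod_cast hK0.ne'
  set N₁ : ℕ → ℤ := fun n => (n₀ + n) * K with hN₁
  set N₂ : ℕ → ℤ := fun n => -((n + 1) * K) with hN₂
  have hi₁ : Function.Injective N₁ := fun m n hmn => by
    have := mul_right_cancel₀ hKz hmn
    omega
  have hi₂ : Function.Injective N₂ := fun m n hmn => by
    have := mul_right_cancel₀ hKz (neg_injective hmn)
    omega
  refine ⟨Function.extend N₁ a 0, Function.extend N₂ b 0, fun j hj => ?_, fun τ => ?_,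
    fun τ => ?_⟩
  · rw [Function.extend_apply', Pi.zero_apply]
    rintro ⟨n, rfl⟩
    have : 0 < ((n : ℤ) + 1) * K := by positivity
    rw [hN₂] at hj
    simp only at hj
    omega
  · refine hasSum_extend hi₁ (e := fun j : ℤ => cexp (2 * π * I * τ * j / L))
      (hasSum_of_eq (hg τ) (fun n => ?_) rfl)
    simp only [hN₁, hK]
    congr 2
    push_cast
    field_simp
  · refine hasSum_extend hi₂ (e := fun j : ℤ => (incGamma (1 - 1 / 2) (4 * π * (-j) * τ.im / L) *
        cexp (2 * π * I * τ * j / L))) (hasSum_of_eq (hF τ) (fun n => ?_) rfl)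
    simp only [hN₂, hK]
    rw [← mul_assoc, show 4 * π * (-((-((n + 1) * K) : ℤ) : ℝ)) * τ.im / ((M * K : ℕ) : ℝ) =
        4 * π * (n + 1) * τ.im / M by push_cast; field_simp,
      show 2 * π * I * τ * ((-((n + 1) * K) : ℤ) : ℂ) / ((M * K : ℕ) : ℂ) =
        -(2 * π * I * τ * (n + 1) / M) by push_cast; field_simp]

/-- At each height the Fourier coefficients in the real part agree. For j ≥ 0 there is no Gamma
term; for j < 0 the height tends to infinity, where the Gamma factor tends to 0 and the holomorphic
coefficients must coincide. -/
lemma IsHolomorphicPart.unique {F g g' : ℍ → ℂ} (h : IsHolomorphicPart (1 / 2) F g)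
    (h' : IsHolomorphicPart (1 / 2) F g') : g = g' := by
  obtain ⟨M, hM, hs⟩ := h.exists_fourier
  obtain ⟨M', hM', hs'⟩ := h'.exists_fourier
  obtain ⟨α, β, hβ, hα, hF⟩ := hs (M * M') (by positivity) (Dvd.intro _ rfl)
  obtain ⟨α', β', hβ', hα', hF'⟩ := hs' (M * M') (by positivity) (Dvd.intro_left _ rfl)
  set L : ℕ := M * M'
  have hL : 0 < L := by positivity
  have hLr : (0 : ℝ) < L := by exact_mod_cast hL
  have hLc : (L : ℂ) ≠ 0 := by exact_mod_cast hL.ne'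
  have key (y : ℝ) (hy : 0 < y) (j : ℤ) :
      α j - α' j + (β j - β' j) * incGamma (1 - 1 / 2) (4 * π * (-j) * y / L) = 0 := by
    have h0 := eq_zero_of_hasSum_fourier (A := fun j : ℤ => (α j - α' j + (β j - β' j) *
      incGamma (1 - 1 / 2) (4 * π * (-j) * y / L)) * cexp (-(2 * π * j * y / L))) fun x => by
        let τ : ℍ := ⟨L * x + y * I, by simpa using hy⟩
        have him : τ.im = y := by
          change (L * x + y * I : ℂ).im = y
          simp
        refine hasSum_of_eq (((hα τ).add (hF τ)).sub ((hα' τ).add (hF' τ))) (fun j => ?_) (by ring)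
        rw [him]
        have e : cexp (2 * π * I * τ * j / L) =
            cexp (-(2 * π * j * y / L)) * cexp (2 * π * I * j * x) := by
          rw [← Complex.exp_add]
          congr 1
          change 2 * π * I * (L * x + y * I : ℂ) * j / L = _
          field_simp
          linear_combination (y * j : ℂ) * I_sq
        rw [e]
        ring
    have := congrFun h0 j
    simpa using this
  have hαα : α = α' := by
    funext j
    rcases le_or_gt 0 j with hj | hj
    · have := key 1 one_pos j
      rw [hβ j hj, hβ' j hj] at this
      linear_combination this
    · have hj' : (0 : ℝ) < -j := by
        have : (j : ℝ) < 0 := by exact_mod_cast hj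
        linarith
      have h1 : Tendsto (fun y : ℝ => 4 * π * (-j) * y / L) atTop atTop :=
        (tendsto_id.const_mul_atTop (by positivity)).atTop_div_const hLr
      have h2 : Tendsto (fun y : ℝ => α j - α' j + (β j - β' j) *
          (incGamma (1 - 1 / 2) (4 * π * (-j) * y / L) : ℂ)) atTop
          (𝓝 (α j - α' j + (β j - β' j) * ((0 : ℝ) : ℂ))) :=
        ((((Complex.continuous_ofReal.tendsto 0).comp
          (tendsto_incGamma.comp h1)).const_mul _).const_add _)
      have h3 : Tendsto (fun y : ℝ => α j - α' j + (β j - β' j) *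
          (incGamma (1 - 1 / 2) (4 * π * (-j) * y / L) : ℂ)) atTop (𝓝 0) := by
        refine tendsto_const_nhds.congr' ?_
        filter_upwards [eventually_gt_atTop 0] with y hy
        exact (key y hy j).symm
      have := tendsto_nhds_unique h2 h3
      rw [ofReal_zero, mul_zero, add_zero] at this
      exact sub_eq_zero.mp this
  funext τ
  subst hαα
  exact (hα τ).unique (hα' τ)

/-! ### The expansion of `R` along a line -/

/-- The exponential factors of the terms of `exp(-πia²τ) R(aτ + b; τ)`. -/
def RTerm (a b : ℝ) (τ : ℂ) (n : ℤ) : ℂ :=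
  (-1 : ℂ) ^ n * cexp (-(2 * π * I * ((n : ℂ) + 1 / 2) * b)) *
    cexp (-(π * I * ((n : ℂ) + 1 / 2 + a) ^ 2 * τ))

/-- The coefficients of the holomorphic part of `exp(-πia²τ) R(aτ + b; τ)`. -/
def signDiff (a : ℝ) (n : ℤ) : ℝ := Real.sign ((n : ℝ) + 1 / 2) - Real.sign ((n : ℝ) + 1 / 2 + a)

/-- The holomorphic part of `exp(-πia²τ) R(aτ + b; τ)` for `|a| < 1`. -/
def RHol (a b : ℝ) (τ : ℂ) : ℂ := signDiff a (-1) * RTerm a b τ (-1) + signDiff a 0 * RTerm a b τ 0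

lemma exp_mul_RCoeff (a b : ℝ) (τ : ℂ) (n : ℤ) :
    cexp (-(π * I * a ^ 2 * τ)) * RCoeff (a * τ + b) τ n = RTerm a b τ n := by
  rw [RCoeff, RTerm, mul_left_comm, mul_assoc ((-1 : ℂ) ^ n), ← Complex.exp_add, ← Complex.exp_add]
  congr 2
  ring

lemma norm_RTerm (a b : ℝ) (τ : ℂ) (n : ℤ) :
    ‖RTerm a b τ n‖ = Real.exp (-(2 * π * (-((n : ℝ) + 1 / 2 + a) ^ 2 / 2) * τ.im)) := by
  rw [RTerm, norm_mul, norm_mul, norm_zpow, norm_neg, norm_one, one_zpow, one_mul,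
    show -(2 * π * I * ((n : ℂ) + 1 / 2) * b) = ((-(2 * π * ((n : ℝ) + 1 / 2) * b) : ℝ) : ℂ) * I by
      push_cast; ring, Complex.norm_exp_ofReal_mul_I, one_mul, Complex.norm_exp,
    show -(π * I * ((n : ℂ) + 1 / 2 + a) ^ 2 * τ) =
      ((-(π * ((n : ℝ) + 1 / 2 + a) ^ 2) : ℝ) : ℂ) * (I * τ) by push_cast; ring,
    re_ofReal_mul, I_mul_re]
  congr 1
  ring

/-- A shift by less than 1 cannot change the sign of a half-integer other than ±1/2. -/
lemma signDiff_eq_zero {a : ℝ} (ha : |a| < 1) {n : ℤ} (hn : n ∉ ({-1, 0} : Finset ℤ)) :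
    signDiff a n = 0 := by
  rw [abs_lt] at ha
  simp only [Finset.mem_insert, Finset.mem_singleton, not_or] at hn
  rcases lt_or_ge n 0 with h | h
  · have : n ≤ -2 := by omega
    have : (n : ℝ) ≤ -2 := by exact_mod_cast this
    rw [signDiff, Real.sign_of_neg (by linarith), Real.sign_of_neg (by linarith), sub_self]
  · have : 1 ≤ n := by omega
    have : (1 : ℝ) ≤ n := by exact_mod_cast this
    rw [signDiff, Real.sign_of_pos (by linarith), Real.sign_of_pos (by linarith), sub_self]

lemma sign_mul_of_pos {x y : ℝ} (hy : 0 < y) : Real.sign (x * y) = Real.sign x := by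
  rcases lt_trichotomy x 0 with h | rfl | h
  · rw [Real.sign_of_neg h, Real.sign_of_neg (mul_neg_of_neg_of_pos h hy)]
  · simp
  · rw [Real.sign_of_pos h, Real.sign_of_pos (mul_pos h hy)]

/-- Replacing sgn(m) by sgn(m + a) matches the sign with the argument of E, so each remaining term
is an incomplete Gamma value; the discrepancy is the finite sum `RHol`. -/
lemma hasSum_R_sub_RHol {a : ℝ} (ha : |a| < 1) (b : ℝ) {τ : ℂ} (hτ : 0 < τ.im) :
    HasSum (fun n : ℤ => ((Real.sign ((n : ℝ) + 1 / 2 + a) * (√π)⁻¹ *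
      incGamma (1 - 1 / 2) (2 * π * ((n : ℝ) + 1 / 2 + a) ^ 2 * τ.im) : ℝ) : ℂ) * RTerm a b τ n)
      (cexp (-(π * I * a ^ 2 * τ)) * R (a * τ + b) τ - RHol a b τ) := by
  have h1 := (summable_RTerm (a * τ + b) hτ).hasSum.mul_left (cexp (-(π * I * a ^ 2 * τ)))
  rw [← R_eq_tsum] at h1
  have h2 : HasSum (fun n => (signDiff a n : ℂ) * RTerm a b τ n)
      (∑ n ∈ ({-1, 0} : Finset ℤ), (signDiff a n : ℂ) * RTerm a b τ n) :=
    hasSum_sum_of_ne_finset_zero fun n hn => by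
      rw [signDiff_eq_zero ha hn, ofReal_zero, zero_mul]
  rw [Finset.sum_pair (by norm_num)] at h2
  refine hasSum_of_eq (h1.sub h2) (fun n => ?_) rfl
  have him : (a * τ + b : ℂ).im / τ.im = a := by
    simp
    field_simp
  have hs := sign_sub_E_eq (((n : ℝ) + 1 / 2 + a) * √(2 * τ.im))
  rw [sign_mul_of_pos (Real.sqrt_pos.mpr (by linarith)), mul_pow,
    Real.sq_sqrt (by linarith)] at hs
  rw [mul_left_comm, exp_mul_RCoeff, ← sub_mul, RFactor, him, signDiff, ← ofReal_sub]
  congr 2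
  rw [show 2 * π * ((n : ℝ) + 1 / 2 + a) ^ 2 * τ.im =
    π * (((n : ℝ) + 1 / 2 + a) ^ 2 * (2 * τ.im)) by ring, ← hs]
  ring

lemma periodicHol_RTerm {a : ℝ} (ha : IsRat a) (b : ℝ) (n : ℤ) :
    PeriodicHol fun τ => RTerm a b τ n := by
  have h := (periodicHol_exp (r := -((n : ℝ) + 1 / 2 + a) ^ 2 / 2)
    ((((((isRat_int n).add (isRat_one.div (isRat_ofNat 2))).add ha).pow 2).neg).div
      (isRat_ofNat 2))).const_mul ((-1 : ℂ) ^ n * cexp (-(2 * π * I * ((n : ℂ) + 1 / 2) * b)))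
  have e : (fun τ => (-1 : ℂ) ^ n * cexp (-(2 * π * I * ((n : ℂ) + 1 / 2) * b)) *
      cexp (2 * π * I * ((-((n : ℝ) + 1 / 2 + a) ^ 2 / 2 : ℝ) : ℂ) * τ)) =
      fun τ => RTerm a b τ n := by
    funext τ
    rw [RTerm]
    congr 2
    push_cast
    ring
  rwa [e] at h

/-! ### The holomorphic part of the normalized `μ̃` -/

/-- The holomorphic part of `Zmu` for `|x - y| < 1`. -/
def ZHol (x s y t : ℝ) (τ : ℂ) : ℂ :=
  cexp (-(π * I * (x - y) ^ 2 * τ)) * mu (x * τ + s) (y * τ + t) τ + I / 2 * RHol (x - y) (s - t) τ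

lemma hasSum_Zmu_sub_ZHol {x y : ℝ} (hxy : |x - y| < 1) (s t : ℝ) {τ : ℂ} (hτ : 0 < τ.im) :
    HasSum (fun n : ℤ => I / 2 * (((Real.sign ((n : ℝ) + 1 / 2 + (x - y)) * (√π)⁻¹ *
      incGamma (1 - 1 / 2) (2 * π * ((n : ℝ) + 1 / 2 + (x - y)) ^ 2 * τ.im) : ℝ) : ℂ) *
        RTerm (x - y) (s - t) τ n)) (Zmu x s y t τ - ZHol x s y t τ) := by
  refine hasSum_of_eq ((hasSum_R_sub_RHol hxy (s - t) hτ).mul_left (I / 2)) (fun n => rfl) ?_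
  rw [Zmu, ZHol, muTilde, show x * τ + s - (y * τ + t) = ((x - y : ℝ) : ℂ) * τ + (s - t : ℝ) by
    push_cast; ring]
  push_cast
  ring

lemma periodicHol_ZHol {x s y t : ℝ} (hx : IsRat x) (hy : IsRat y) (hx0 : 0 ≤ x) (hx1 : x < 1)
    (hy0 : 0 ≤ y) (hy1 : y < 1) (h : OffLattice x s) (h' : OffLattice y t) :
    PeriodicHol (ZHol x s y t) := by
  have hxy := hx.sub hy
  have h1 := periodicHol_exp (r := -(x - y) ^ 2 / 2) ((hxy.pow 2).neg.div (isRat_ofNat 2))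
  have e : (fun τ => cexp (2 * π * I * ((-(x - y) ^ 2 / 2 : ℝ) : ℂ) * τ)) =
      fun τ => cexp (-(π * I * (x - y) ^ 2 * τ)) := by
    funext τ
    congr 1
    push_cast
    ring
  rw [e] at h1
  exact (h1.mul (periodicHol_mu hx hy hx0 hx1 hy0 hy1 h h')).add
    ((((periodicHol_RTerm hxy (s - t) (-1)).const_mul _).add
      ((periodicHol_RTerm hxy (s - t) 0).const_mul _)).const_mul _)

lemma kFun_le_nu {x y : ℝ} (hx0 : 0 ≤ x) (hx1 : x < 1) (hy0 : 0 ≤ y) (hy1 : y < 1) :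
    kFun x y ≤ nu x y := by
  rw [kFun, Int.fract_eq_self.mpr ⟨hx0, hx1⟩, Int.fract_eq_self.mpr ⟨hy0, hy1⟩]
  split_ifs
  · exact min_le_right _ _
  · exact le_rfl

lemma isRat_kFun {x y : ℝ} (hx : IsRat x) (hy : IsRat y) : IsRat (kFun x y) := by
  have h2 := isRat_ofNat 2
  have h8 := isRat_ofNat 8
  have hnu : IsRat (nu (Int.fract x) (Int.fract y)) := by
    rw [nu_eq]
    exact (((hx.fract.div h2).add (hy.fract.div h2)).sub (isRat_one.div h8)).add
      (isRat_zero.min ((isRat_one.sub hx.fract).sub hy.fract))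
  rw [kFun]
  split_ifs
  · exact (isRat_one.div h8).min hnu
  · exact hnu

/-- For x - y = ±1/2 the surviving exponential is constant, and the cap 1/8 in `kFun` is exactly (x
- y)²/2. The only other case is y = 0, x > 1/2, n = -1, where ν(x, 0) - x²/2 equals -(x - 1/2)²/2.
-/
lemma kFun_le_of_signDiff_ne_zero {x y : ℝ} (hx0 : 0 ≤ x) (hx1 : x < 1)
    (hy : y = 0 ∨ y = 1 / 2) {n : ℤ} (hn : n = -1 ∨ n = 0) (h : signDiff (x - y) n ≠ 0) :
    kFun x y - (x - y) ^ 2 / 2 ≤ -((n : ℝ) + 1 / 2 + (x - y)) ^ 2 / 2 := by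
  have hy0 : 0 ≤ y := by rcases hy with rfl | rfl <;> norm_num
  have hy1 : y < 1 := by rcases hy with rfl | rfl <;> norm_num
  have hk : x - y = 1 / 2 ∨ x - y = -(1 / 2) → kFun x y ≤ 1 / 8 := fun h => by
    rw [kFun, Int.fract_eq_self.mpr ⟨hx0, hx1⟩, Int.fract_eq_self.mpr ⟨hy0, hy1⟩, if_pos h]
    exact min_le_left _ _
  rcases hn with rfl | rfl
  · have ha : 1 / 2 ≤ x - y := by
      by_contra hlt
      rw [not_le] at hlt
      refine h ?_
      rw [signDiff, Real.sign_of_neg (by norm_num), Real.sign_of_neg (by push_cast; linarith),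
        sub_self]
    rcases ha.eq_or_lt with he | hlt
    · have := hk (Or.inl he.symm)
      rw [← he]
      push_cast
      linarith
    · have h0 : y = 0 := by
        rcases hy with h0 | h0
        · exact h0
        · linarith
      have h1 := kFun_le_nu hx0 hx1 hy0 hy1
      rw [nu, h0, if_pos (by linarith)] at h1
      rw [h0]
      push_cast
      nlinarith
  · have ha : x - y ≤ -(1 / 2) := by
      by_contra hlt
      rw [not_le] at hlt
      refine h ?_
      rw [signDiff, Real.sign_of_pos (by norm_num), Real.sign_of_pos (by push_cast; linarith),
        sub_self]
    have he : x - y = -(1 / 2) := by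
      rcases hy with h0 | h0 <;> linarith
    have := hk (Or.inr he)
    rw [he]
    push_cast
    linarith

lemma ZHol_isBigO {x s y t : ℝ} (hx0 : 0 ≤ x) (hx1 : x < 1) (hy : y = 0 ∨ y = 1 / 2)
    (h : OffLattice x s) (h' : OffLattice y t) : ZHol x s y t =O[atIInf]
      fun τ => Real.exp (-(2 * π * (kFun x y - (x - y) ^ 2 / 2) * τ.im)) := by
  have hy0 : 0 ≤ y := by rcases hy with rfl | rfl <;> norm_num
  have hy1 : y < 1 := by rcases hy with rfl | rfl <;> norm_num
  have mono {r r' : ℝ} (hr : r ≤ r') : (fun τ : ℂ => Real.exp (-(2 * π * r' * τ.im))) =O[atIInf]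
      fun τ => Real.exp (-(2 * π * r * τ.im)) := by
    refine Asymptotics.IsBigO.of_bound 1 ?_
    filter_upwards [eventually_atIInf 0] with τ hτ
    rw [Real.norm_of_nonneg (Real.exp_nonneg _), Real.norm_of_nonneg (Real.exp_nonneg _), one_mul,
      Real.exp_le_exp]
    gcongr
  have hR (n : ℤ) (hn : n = -1 ∨ n = 0) :
      (fun τ => (signDiff (x - y) n : ℂ) * RTerm (x - y) (s - t) τ n) =O[atIInf]
      fun τ => Real.exp (-(2 * π * (kFun x y - (x - y) ^ 2 / 2) * τ.im)) := by
    by_cases h0 : signDiff (x - y) n = 0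
    · simp only [h0, ofReal_zero, zero_mul]
      exact Asymptotics.isBigO_zero _ _
    · refine Asymptotics.IsBigO.trans ?_ (mono (kFun_le_of_signDiff_ne_zero hx0 hx1 hy hn h0))
      refine Asymptotics.IsBigO.const_mul_left ?_ _
      refine Asymptotics.IsBigO.of_bound 1 (Eventually.of_forall fun τ => ?_)
      rw [norm_RTerm, Real.norm_of_nonneg (Real.exp_nonneg _), one_mul]
  have hmu := (mu_isBigO hx0 hx1 hy0 hy1 h h').trans
    (mono (sub_le_sub_right (kFun_le_nu hx0 hx1 hy0 hy1) _))
  exact hmu.add (((hR (-1) (Or.inl rfl)).add (hR 0 (Or.inr rfl))).const_mul_left _)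

/-- Distinct n may give the same exponent (n + 1/2 + a)², whereas the non-holomorphic part allows
one coefficient per exponent and none at 0. -/
lemma hasSum_fiber {c : ℤ → ℂ} {K : ℤ → ℕ} {Φ : ℕ → ℂ} {S : ℂ} (hc : ∀ n, K n = 0 → c n = 0)
    (h : HasSum (fun n => c n * Φ (K n)) S) :
    HasSum (fun k : ℕ => (∑' n : K ⁻¹' {k + 1}, c n) * Φ (k + 1)) S := by
  have h1 := h.tsum_fiberwise K
  have h2 : (fun k : ℕ => ∑' n : K ⁻¹' {k}, c n * Φ (K n)) =
      fun k : ℕ => (∑' n : K ⁻¹' {k}, c n) * Φ k := by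
    funext k
    rw [← tsum_mul_right]
    exact tsum_congr fun n => by rw [show K n = k from n.2]
  rw [h2] at h1
  have h3 := (hasSum_nat_add_iff' 1).mpr h1
  have h4 : ∑' n : K ⁻¹' {0}, c n = 0 := by
    rw [tsum_congr fun n : K ⁻¹' {0} => hc n n.2, tsum_zero]
  simpa [h4] using h3

lemma exists_den_sq {κ a : ℝ} (hκ : 0 < κ) (hκ' : IsRat κ) (ha : IsRat a) :
    ∃ (D : ℕ) (K : ℤ → ℕ), 0 < D ∧ ∀ n : ℤ, κ * ((n : ℝ) + 1 / 2 + a) ^ 2 / 2 * D = K n := by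
  obtain ⟨d, p, hd, hp⟩ := (hκ'.div (isRat_ofNat 8)).exists_den
  obtain ⟨e, q, he, hq⟩ := ha.exists_den
  have hp0 : 0 ≤ p := by
    have : (0 : ℝ) ≤ p := by rw [← hp]; positivity
    exact_mod_cast this
  lift p to ℕ using hp0
  -- The quantity is (κ/8)(2n + 1 + 2a)²; here d clears κ/8, and e², e being a denominator of a,
  -- clears the square.
  refine ⟨d * e ^ 2, fun n => p * (2 * n * e + e + 2 * q).natAbs ^ 2, by positivity, fun n => ?_⟩
  have h1 : ((((2 * n * e + e + 2 * q).natAbs : ℕ) : ℝ)) ^ 2 = (2 * n * e + e + 2 * q) ^ 2 := by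
    rw [Nat.cast_natAbs, Int.cast_abs, sq_abs]
    push_cast
    ring
  push_cast at h1 hp ⊢
  rw [h1, ← hp, ← hq]
  ring

/-- The holomorphic part is C·`ZHol` at κτ + σ; the incomplete Gamma terms of `hasSum_Zmu_sub_ZHol`,
grouped by exponent, form the rest. -/
lemma exists_holomorphicPart_Zmu {x s y t : ℝ} (hx : IsRat x) (hx0 : 0 ≤ x) (hx1 : x < 1)
    (hy : y = 0 ∨ y = 1 / 2) (h : OffLattice x s) (h' : OffLattice y t) {κ σ : ℝ} (hκ : 0 < κ)
    (hκ' : IsRat κ) (C : ℂ) : ∃ g : ℍ → ℂ,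
      IsHolomorphicPart (1 / 2) (fun τ => C * Zmu x s y t (κ * τ + σ)) g ∧
      InvariantOrderAtLeast g (κ * (kFun x y - (x - y) ^ 2 / 2)) := by
  have hy0 : 0 ≤ y := by rcases hy with rfl | rfl <;> norm_num
  have hy1 : y < 1 := by rcases hy with rfl | rfl <;> norm_num
  have hyr : IsRat y := by
    rcases hy with rfl | rfl
    · exact isRat_zero
    · exact isRat_one.div (isRat_ofNat 2)
  have hxy : |x - y| < 1 := by rw [abs_lt]; constructor <;> linarith
  obtain ⟨D, K, hD, hK⟩ := exists_den_sq hκ hκ' (hx.sub hyr)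
  have hper := ((periodicHol_ZHol hx hyr hx0 hx1 hy0 hy1 h h').const_mul C).comp_affine hκ hκ' σ
  have hr : IsRat (kFun x y - (x - y) ^ 2 / 2) :=
    (isRat_kFun hx hyr).sub (((hx.sub hyr).pow 2).div (isRat_ofNat 2))
  have hO : (fun τ => C * ZHol x s y t (κ * τ + σ)) =O[atIInf]
      fun τ => Real.exp (-(2 * π * (κ * (kFun x y - (x - y) ^ 2 / 2)) * τ.im)) := by
    refine (((ZHol_isBigO hx0 hx1 hy h h').comp_tendsto (tendsto_affine_atIInf hκ σ)).const_mul_left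
      C).congr_right fun τ => ?_
    simp only [Function.comp_apply]
    congr 1
    simp
    ring
  obtain ⟨M, m₀, a, hM, ⟨L, hL⟩, hm, hexp, -⟩ := exists_hasExpansion hper (hκ'.mul hr) hO hD
  have hM' : (M : ℝ) ≠ 0 := by exact_mod_cast hM.ne'
  refine ⟨fun τ : ℍ => C * ZHol x s y t (κ * τ + σ), ?_, ?_⟩
  swap
  · have := hexp.invariantOrderAtLeast hM
    rwa [hm, mul_div_cancel_right₀ _ hM'] at this
  set c : ℤ → ℂ := fun n => C * (I / 2 * ((Real.sign ((n : ℝ) + 1 / 2 + (x - y)) * (√π)⁻¹ : ℝ) *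
    ((-1 : ℂ) ^ n * cexp (-(2 * π * I * ((n : ℂ) + 1 / 2) * (s - t))) *
      cexp (-(π * I * ((n : ℂ) + 1 / 2 + (x - y)) ^ 2 * σ))))) with hc
  have hKL (n : ℤ) : κ * ((n : ℝ) + 1 / 2 + (x - y)) ^ 2 / 2 * M = (K n * L : ℕ) := by
    rw [hL]
    push_cast
    rw [← hK n]
    ring
  refine ⟨M, m₀, a, fun k => ∑' n : (fun n => K n * L) ⁻¹' {k + 1}, c n, hM, hexp, fun τ => ?_⟩
  have hτ : 0 < (κ * τ + σ : ℂ).im := by simpa using mul_pos hκ τ.im_pos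
  have hs := (hasSum_Zmu_sub_ZHol hxy s t hτ).mul_left C
  have := hasSum_fiber (c := c) (K := fun n => K n * L)
    (Φ := fun k => (incGamma (1 - 1 / 2) (4 * π * k * τ.im / M) : ℂ) *
      cexp (-(2 * π * I * τ * k / M))) (fun n hn => ?_)
    (hasSum_of_eq hs (fun n => ?_) (mul_sub _ _ _).symm)
  · refine hasSum_of_eq this (fun k => ?_) rfl
    push_cast
    ring
  -- Exponent zero forces n + 1/2 + (x - y) = 0, and the coefficient then vanishes because the sign
  -- of 0 is 0.
  · have h0 := hKL n
    rw [hn, Nat.cast_zero] at h0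
    have h1 : (n : ℝ) + 1 / 2 + (x - y) = 0 := by
      by_contra h2
      have : 0 < κ * ((n : ℝ) + 1 / 2 + (x - y)) ^ 2 / 2 * M := by
        have : (0 : ℝ) < M := by exact_mod_cast hM
        have := sq_pos_of_ne_zero h2
        positivity
      linarith
    simp only [hc, h1, Real.sign_zero]
    simp
  · have hkM : ((K n * L : ℕ) : ℝ) / M = κ * ((n : ℝ) + 1 / 2 + (x - y)) ^ 2 / 2 := by
      rw [← hKL n, mul_div_cancel_right₀ _ hM']
    have hkMc : ((K n * L : ℕ) : ℂ) / M = κ * ((n : ℂ) + 1 / 2 + (x - y)) ^ 2 / 2 := by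
      have := congrArg (fun z : ℝ => (z : ℂ)) hkM
      simp only [ofReal_div, ofReal_natCast] at this
      rw [this]
      push_cast
      ring
    have e1 : 4 * π * ((K n * L : ℕ) : ℝ) * τ.im / M =
        2 * π * ((n : ℝ) + 1 / 2 + (x - y)) ^ 2 * (κ * τ + σ : ℂ).im := by
      rw [show 4 * π * ((K n * L : ℕ) : ℝ) * τ.im / M = 4 * π * τ.im * (((K n * L : ℕ) : ℝ) / M) by
        ring, hkM]
      simp
      ring
    have e2 : cexp (-(π * I * ((n : ℂ) + 1 / 2 + (x - y)) ^ 2 * (κ * τ + σ))) =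
        cexp (-(π * I * ((n : ℂ) + 1 / 2 + (x - y)) ^ 2 * σ)) *
          cexp (-(2 * π * I * τ * ((K n * L : ℕ) : ℂ) / M)) := by
      rw [← Complex.exp_add, mul_div_assoc, hkMc]
      congr 1
      ring
    rw [e1, hc, RTerm]
    push_cast at e2 ⊢
    rw [e2]
    ring

/-! ### Orders at the cusps -/

lemma exists_Zmu_fract {x s y t : ℝ} (h : OffLattice x s) (h' : OffLattice y t) :
    ∃ C : ℂ, ∀ τ : ℂ, 0 < τ.im →
      Zmu x s y t τ = C * Zmu (Int.fract x) s (Int.fract y) t τ := by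
  have hx : OffLattice (Int.fract x) s := by
    rw [← offLattice_add_int ⌊x⌋, Int.fract_add_floor]
    exact h
  have hy : OffLattice (Int.fract y) t := by
    rw [← offLattice_add_int ⌊y⌋, Int.fract_add_floor]
    exact h'
  obtain ⟨C, -, hC⟩ := exists_shift_const (F := fun x τ => Zmu x s y t τ) (fun z hz =>
    ⟨_, neg_ne_zero.mpr (Complex.exp_ne_zero _), fun τ hτ => Zmu_add_one_left hz h' hτ⟩) hx ⌊x⌋
  obtain ⟨C', -, hC'⟩ := exists_shift_const (F := fun y τ => Zmu (Int.fract x) s y t τ)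
    (fun z hz => ⟨_, neg_ne_zero.mpr (Complex.exp_ne_zero _),
      fun τ hτ => Zmu_add_one_right hx hz hτ⟩) hy ⌊y⌋
  refine ⟨C * C', fun τ hτ => ?_⟩
  have h1 := hC τ hτ
  have h2 := hC' τ hτ
  rw [Int.fract_add_floor] at h1 h2
  rw [h1, h2, mul_assoc]

lemma exists_Ztheta_fract {x s : ℝ} (h : OffLattice x s) :
    OffLattice (Int.fract x) s ∧ ∃ C : ℂ, C ≠ 0 ∧ ∀ τ : ℂ, 0 < τ.im →
      Ztheta x s τ = C * Ztheta (Int.fract x) s τ := by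
  have hx : OffLattice (Int.fract x) s := by
    rw [← offLattice_add_int ⌊x⌋, Int.fract_add_floor]
    exact h
  obtain ⟨C, hC, h1⟩ := exists_shift_const (F := fun x τ => Ztheta x s τ) (fun z _ =>
    ⟨_, neg_ne_zero.mpr (Complex.exp_ne_zero _), fun τ _ => Ztheta_add_one z s τ⟩) hx ⌊x⌋
  refine ⟨hx, C, hC, fun τ hτ => ?_⟩
  have := h1 τ hτ
  rwa [Int.fract_add_floor] at this

lemma exists_holomorphicPart_N {a c : ℤ} {ρ : ℝ} (hρc : (ρ : ℂ) = 2 * a / c) (hρr : IsRat ρ)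
    (hρ : ∀ n : ℤ, ρ ≠ n) {A B : SL(2, ℤ)} (hA : 0 ≤ A 1 0) {κ σ : ℝ} (hκ : 0 < κ)
    (hκ' : IsRat κ) {l : ℂ} (hl : l ≠ 0)
    (hJ : ∀ τ, autFactor B (affineMap κ σ hκ τ) = l * autFactor A τ)
    (hAB : ∀ τ, ((B • affineMap κ σ hκ τ : ℍ) : ℂ) = 2 * (A • τ : ℍ))
    {x y : ℝ} (hx : Int.fract ((B 1 0 : ℤ) * ρ) = x) (hy : Int.fract ((B 0 0 : ℤ) / 2 : ℝ) = y)
    (hy' : y = 0 ∨ y = 1 / 2) :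
    ∃ g : ℍ → ℂ, IsHolomorphicPart (1 / 2) (weightAct (1 / 2) (N a c) A) g ∧
      InvariantOrderAtLeast g (κ * (kFun x y - (x - y) ^ 2 / 2)) := by
  obtain ⟨C, -, h⟩ := exists_weightAct_N hρc hρ hA hκ hl hJ hAB
  have o1 := offLattice_of_real hρ B
  have o2 := offLattice_half B
  obtain ⟨C', h'⟩ := exists_Zmu_fract o1 o2
  have e : weightAct (1 / 2) (N a c) A = fun τ : ℍ => C * C' *
      Zmu x ((B 1 1 : ℤ) * ρ) y ((B 0 1 : ℤ) / 2) (κ * τ + σ) := by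
    funext τ
    rw [h τ, h' _ (by simpa using mul_pos hκ τ.im_pos), mul_assoc, hx, hy]
  rw [e]
  have o1' := (exists_Ztheta_fract o1).1
  have o2' := (exists_Ztheta_fract o2).1
  rw [hx] at o1'
  rw [hy] at o2'
  refine exists_holomorphicPart_Zmu (hx ▸ ((isRat_int _).mul hρr).fract) (hx ▸ Int.fract_nonneg _)
    (hx ▸ Int.fract_lt_one _) hy' o1' o2' hκ hκ' _

lemma hasInvariantOrder_P {a c : ℤ} {ρ : ℝ} (hρc : (ρ : ℂ) = 2 * a / c) (hρr : IsRat ρ)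
    (hρ : ∀ n : ℤ, ρ ≠ n) {A B : SL(2, ℤ)} (hA : 0 ≤ A 1 0) {κ σ : ℝ} (hκ : 0 < κ)
    (hκ' : IsRat κ) {l : ℂ} (hl : l ≠ 0)
    (hJ : ∀ τ, autFactor B (affineMap κ σ hκ τ) = l * autFactor A τ)
    (hAB : ∀ τ, ((B • affineMap κ σ hκ τ : ℍ) : ℂ) = 2 * (A • τ : ℍ))
    {x y : ℝ} (hx : Int.fract ((B 1 0 : ℤ) * ρ) = x) (hy : Int.fract ((B 0 0 : ℤ) / 2 : ℝ) = y) :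
    HasInvariantOrder (weightAct (1 / 2) (P a c) A)
      (κ * (x / 2 - x ^ 2 / 2 + y / 2 - y ^ 2 / 2 - 1 / 8)) := by
  obtain ⟨C, hC, h⟩ := exists_weightAct_P hρc hA hκ hl hJ hAB
  obtain ⟨o1, C₁, hC₁, h₁⟩ := exists_Ztheta_fract (offLattice_of_real hρ B)
  obtain ⟨o2, C₂, hC₂, h₂⟩ := exists_Ztheta_fract (offLattice_half B)
  have e : weightAct (1 / 2) (P a c) A = fun τ : ℍ => C * (C₁ * C₂)⁻¹ *
      (ModularForm.eta (κ * τ + σ) ^ 3 / (Ztheta x ((B 1 1 : ℤ) * ρ) (κ * τ + σ) *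
        Ztheta y ((B 0 1 : ℤ) / 2) (κ * τ + σ))) := by
    funext τ
    have hτ : 0 < (κ * τ + σ : ℂ).im := by simpa using mul_pos hκ τ.im_pos
    rw [h τ, h₁ _ hτ, h₂ _ hτ, hx, hy]
    simp only [div_eq_mul_inv, mul_inv]
    ring
  rw [e]
  rw [hx] at o1
  rw [hy] at o2
  exact hasInvariantOrder_theta_quot (hx ▸ ((isRat_int _).mul hρr).fract)
    (hy ▸ ((isRat_int _).div (isRat_ofNat 2)).fract) (hx ▸ Int.fract_nonneg _)
    (hx ▸ Int.fract_lt_one _) (hy ▸ Int.fract_nonneg _) (hy ▸ Int.fract_lt_one _) o1 o2 hκ hκ'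
    (mul_ne_zero hC (inv_ne_zero (mul_ne_zero hC₁ hC₂)))

/-- For even lower left entry, `2Aτ = B(2τ)`. -/
lemma exists_conjugate_even {A : SL(2, ℤ)} (hA : Even (A 1 0)) :
    ∃ B : SL(2, ℤ), B 0 0 = A 0 0 ∧ 2 * B 1 0 = A 1 0 ∧
      (∀ τ, autFactor B (affineMap 2 0 two_pos τ) = 1 * autFactor A τ) ∧
      ∀ τ, ((B • affineMap 2 0 two_pos τ : ℍ) : ℂ) = 2 * (A • τ : ℍ) := by
  obtain ⟨g, hg⟩ := hA
  have hd := det_eq_one A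
  -- B is the conjugate of A by diag(2, 1), integral because γ = 2g.
  let B : SL(2, ℤ) := ⟨!![A 0 0, 2 * A 0 1; g, A 1 1], by
    rw [Matrix.det_fin_two_of]; rw [hg] at hd; linarith⟩
  have hgc : ((A 1 0 : ℤ) : ℂ) = g + g := by exact_mod_cast hg
  have b00 : B 0 0 = A 0 0 := rfl
  have b01 : B 0 1 = 2 * A 0 1 := rfl
  have b10 : B 1 0 = g := rfl
  have b11 : B 1 1 = A 1 1 := rfl
  have hJ (τ : ℍ) : autFactor B (affineMap 2 0 two_pos τ) = 1 * autFactor A τ := by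
    rw [autFactor, autFactor, b10, b11, hgc, coe_affineMap]
    push_cast
    ring
  refine ⟨B, b00, by rw [b10, hg]; ring, hJ, fun τ => ?_⟩
  rw [coe_smul_eq, coe_smul_eq, hJ, b00, b01, coe_affineMap]
  push_cast
  ring

/-- For odd lower left entry, `2Aτ = B((τ + δ)/2)`. -/
lemma exists_conjugate_odd {A : SL(2, ℤ)} (hA : Odd (A 1 0)) :
    ∃ (B : SL(2, ℤ)) (σ : ℝ), B 0 0 = 2 * A 0 0 ∧ B 1 0 = A 1 0 ∧
      (∀ τ, autFactor B (affineMap (1 / 2) σ one_half_pos τ) = (1 / 2) * autFactor A τ) ∧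
      ∀ τ, ((B • affineMap (1 / 2) σ one_half_pos τ : ℍ) : ℂ) = 2 * (A • τ : ℍ) := by
  obtain ⟨g, hg⟩ := hA
  have hd := det_eq_one A
  -- B solves diag(2, 1)·A = B·(1, δ; 0, 2); the lower right entry δ(1 - γ)/2 = -gδ is integral
  -- because γ = 2g + 1.
  let B : SL(2, ℤ) := ⟨!![2 * A 0 0, A 0 1 - A 0 0 * A 1 1; A 1 0, -(g * A 1 1)], by
    rw [Matrix.det_fin_two_of]; rw [hg] at hd ⊢; linarith⟩
  have hgc : ((A 1 0 : ℤ) : ℂ) = 2 * g + 1 := by exact_mod_cast hg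
  have b00 : B 0 0 = 2 * A 0 0 := rfl
  have b01 : B 0 1 = A 0 1 - A 0 0 * A 1 1 := rfl
  have b10 : B 1 0 = A 1 0 := rfl
  have b11 : B 1 1 = -(g * A 1 1) := rfl
  have hJ (τ : ℍ) : autFactor B (affineMap (1 / 2) ((A 1 1 : ℤ) / 2) one_half_pos τ) =
      (1 / 2) * autFactor A τ := by
    rw [autFactor, autFactor, b10, b11, hgc, coe_affineMap]
    push_cast
    ring
  refine ⟨B, (A 1 1 : ℤ) / 2, b00, b10, hJ, fun τ => ?_⟩
  have hJ0 := autFactor_ne_zero A τ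
  rw [coe_smul_eq, coe_smul_eq, hJ, b00, b01, coe_affineMap]
  push_cast
  field_simp
  ring

/-! ### Matching the exponents with the stated orders. -/

lemma kFun_fract (u w : ℝ) : kFun (Int.fract u) (Int.fract w) = kFun u w := by
  simp only [kFun, Int.fract_fract]

lemma fract_int_div_two_of_odd {n : ℤ} (hn : Odd n) : Int.fract ((n : ℝ) / 2) = 1 / 2 := by
  obtain ⟨k, rfl⟩ := hn
  rw [Int.fract_eq_iff]
  exact ⟨by norm_num, by norm_num, k, by push_cast; ring⟩

lemma two_mul_div_ne_int {a c : ℤ} (hc : 0 < c) (hac : ¬ c ∣ 2 * a) (n : ℤ) :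
    (2 * a / c : ℝ) ≠ n := by
  intro h
  have hc' : (c : ℝ) ≠ 0 := by exact_mod_cast hc.ne'
  rw [div_eq_iff hc'] at h
  exact hac ⟨n, by rw [mul_comm c]; exact_mod_cast h⟩

lemma isRat_two_mul_div (a c : ℤ) : IsRat (2 * a / c : ℝ) :=
  ((isRat_ofNat 2).mul (isRat_int a)).div (isRat_int c)

/-- By uniqueness of holomorphic parts, bounding one bounds all. -/
lemma holomorphicPartOrderAtCuspAtLeast_of_exists {f : ℍ → ℂ} {α γ : ℕ} {r : ℝ}
    (h : ∀ A : SL(2, ℤ), A 0 0 = (α : ℤ) → A 1 0 = (γ : ℤ) →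
      ∃ g, IsHolomorphicPart (1 / 2) (weightAct (1 / 2) f A) g ∧ InvariantOrderAtLeast g r) :
    HolomorphicPartOrderAtCuspAtLeast (1 / 2) f α γ r := by
  intro A h0 h1
  obtain ⟨g, hg, hr⟩ := h A h0 h1
  exact ⟨⟨g, hg⟩, fun g' hg' => hg'.unique hg ▸ hr⟩

lemma odd_of_gcd_eq_one {α γ : ℕ} (h : Nat.gcd α γ = 1) (hγ : Even γ) : Odd (α : ℤ) := by
  rw [Int.odd_coe_nat, ← Nat.not_even_iff_odd]
  intro hα
  have := Nat.dvd_gcd hα.two_dvd hγ.two_dvd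
  omega

/-- Here κ = 2 and y = 1/2, since α is odd. With aγ/c = m + x the integer part m cancels, and the
stated bound is 2k - (x - 1/2)². -/
theorem order_N_even {a c : ℤ} (hc : 0 < c) (hac : ¬ c ∣ 2 * a) {α γ : ℕ}
    (hαγ : Nat.gcd α γ = 1) (hγ : Even γ) :
    HolomorphicPartOrderAtCuspAtLeast (1 / 2) (N a c) α γ
      (-((a : ℝ) ^ 2 * (γ : ℝ) ^ 2 / (c : ℝ) ^ 2) + (a : ℝ) * γ / c - 1 / 4
        + 2 * nuTilde ((a : ℝ) * γ / c) (1 / 2)) := by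
  refine holomorphicPartOrderAtCuspAtLeast_of_exists fun A h0 h1 => ?_
  obtain ⟨B, b0, b1, hJ, hAB⟩ := exists_conjugate_even (A := A) (by rw [h1]; exact_mod_cast hγ)
  rw [h0] at b0
  rw [h1] at b1
  have hb1 : ((B 1 0 : ℤ) : ℝ) * (2 * a / c) = a * γ / c := by
    have : (2 * (B 1 0 : ℤ) : ℝ) = γ := by exact_mod_cast b1
    rw [← this]; ring
  obtain ⟨g, hg, hr⟩ := exists_holomorphicPart_N (ρ := 2 * a / c) (by push_cast; rfl)
    (isRat_two_mul_div a c) (two_mul_div_ne_int hc hac) (by rw [h1]; positivity) two_pos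
    (isRat_ofNat 2) one_ne_zero hJ hAB (by rw [hb1])
    (by rw [b0, fract_int_div_two_of_odd (odd_of_gcd_eq_one hαγ hγ)]) (Or.inr rfl)
  refine ⟨g, hg, ?_⟩
  have hf : Int.fract (1 / 2 : ℝ) = 1 / 2 := Int.fract_eq_self.mpr ⟨by norm_num, by norm_num⟩
  have hfl : ⌊(1 / 2 : ℝ)⌋ = 0 := by rw [Int.floor_eq_zero_iff]; constructor <;> norm_num
  have hk : kFun (Int.fract ((a : ℝ) * γ / c)) (1 / 2) = kFun ((a : ℝ) * γ / c) (1 / 2) := by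
    rw [← kFun_fract _ (1 / 2), ← kFun_fract _ (1 / 2), Int.fract_fract]
  rw [hk] at hr
  have e : (a : ℝ) ^ 2 * (γ : ℝ) ^ 2 / (c : ℝ) ^ 2 = ((a : ℝ) * γ / c) ^ 2 := by ring
  rw [e, nuTilde, hf, hfl]
  have hx := Int.floor_add_fract ((a : ℝ) * γ / c)
  generalize kFun ((a : ℝ) * γ / c) (1 / 2) = k at *
  generalize Int.fract ((a : ℝ) * γ / c) = x at *
  generalize (⌊(a : ℝ) * γ / c⌋ : ℝ) = m at *
  rw [← hx]
  convert hr using 1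
  push_cast
  ring

/-- Here κ = 1/2 and y = 0, since B₀₀/2 = α is an integer. With 2aγ/c = m + x the difference m - α
cancels, and the stated bound is k/2 - x²/4. -/
theorem order_N_odd {a c : ℤ} (hc : 0 < c) (hac : ¬ c ∣ 2 * a) {α γ : ℕ} (hγ : Odd γ) :
    HolomorphicPartOrderAtCuspAtLeast (1 / 2) (N a c) α γ
      (-((a : ℝ) ^ 2 * (γ : ℝ) ^ 2 / (c : ℝ) ^ 2) + (a : ℝ) * α * γ / c - (α : ℝ) ^ 2 / 4
        + 1 / 2 * nuTilde (2 * (a : ℝ) * γ / c) (α : ℝ)) := by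
  refine holomorphicPartOrderAtCuspAtLeast_of_exists fun A h0 h1 => ?_
  obtain ⟨B, σ, b0, b1, hJ, hAB⟩ := exists_conjugate_odd (A := A)
    (by rw [h1]; exact_mod_cast hγ)
  rw [h0] at b0
  rw [h1] at b1
  have hb1 : ((B 1 0 : ℤ) : ℝ) * (2 * a / c) = 2 * a * γ / c := by
    rw [b1]; push_cast; ring
  have hb0 : Int.fract (((B 0 0 : ℤ) : ℝ) / 2) = 0 := by
    rw [b0, Int.fract_eq_iff]
    exact ⟨le_rfl, one_pos, α, by push_cast; ring⟩
  obtain ⟨g, hg, hr⟩ := exists_holomorphicPart_N (ρ := 2 * a / c) (by push_cast; rfl)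
    (isRat_two_mul_div a c) (two_mul_div_ne_int hc hac) (by rw [h1]; positivity) one_half_pos
    (isRat_one.div (isRat_ofNat 2)) (by norm_num) hJ hAB (by rw [hb1]) hb0 (Or.inl rfl)
  refine ⟨g, hg, ?_⟩
  have hk : kFun (Int.fract (2 * (a : ℝ) * γ / c)) 0 = kFun (2 * (a : ℝ) * γ / c) (α : ℝ) := by
    rw [← kFun_fract _ (α : ℝ), Int.fract_natCast]
  rw [hk] at hr
  have e : (a : ℝ) ^ 2 * (γ : ℝ) ^ 2 / (c : ℝ) ^ 2 = (2 * (a : ℝ) * γ / c) ^ 2 / 4 := by ring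
  have e' : (a : ℝ) * α * γ / c = (2 * (a : ℝ) * γ / c) * α / 2 := by ring
  rw [e, e', nuTilde, Int.fract_natCast, Int.floor_natCast]
  have hx := Int.floor_add_fract (2 * (a : ℝ) * γ / c)
  generalize kFun (2 * (a : ℝ) * γ / c) (α : ℝ) = k at *
  generalize Int.fract (2 * (a : ℝ) * γ / c) = x at *
  generalize (⌊2 * (a : ℝ) * γ / c⌋ : ℝ) = m at *
  rw [← hx]
  convert hr using 1
  push_cast
  ring

/-- At y = 1/2 the contribution y/2 - y²/2 - 1/8 is zero; at y = 0, the odd case, it is -1/8, which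
κ = 1/2 turns into -1/16. -/
theorem order_P_even {a c : ℤ} (hc : 0 < c) (hac : ¬ c ∣ 2 * a) {α γ : ℕ}
    (hαγ : Nat.gcd α γ = 1) (hγ : Even γ) :
    HasInvariantOrderAtCusp (1 / 2) (P a c) α γ
      (Int.fract ((a : ℝ) * γ / c) - Int.fract ((a : ℝ) * γ / c) ^ 2) := by
  intro A h0 h1
  obtain ⟨B, b0, b1, hJ, hAB⟩ := exists_conjugate_even (A := A) (by rw [h1]; exact_mod_cast hγ)
  rw [h0] at b0
  rw [h1] at b1
  have hb1 : ((B 1 0 : ℤ) : ℝ) * (2 * a / c) = a * γ / c := by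
    have : (2 * (B 1 0 : ℤ) : ℝ) = γ := by exact_mod_cast b1
    rw [← this]; ring
  have hr := hasInvariantOrder_P (ρ := 2 * a / c) (by push_cast; rfl)
    (isRat_two_mul_div a c) (two_mul_div_ne_int hc hac) (by rw [h1]; positivity) two_pos
    (isRat_ofNat 2) one_ne_zero hJ hAB (by rw [hb1])
    (by rw [b0, fract_int_div_two_of_odd (odd_of_gcd_eq_one hαγ hγ)])
  convert hr using 1
  ring

theorem order_P_odd {a c : ℤ} (hc : 0 < c) (hac : ¬ c ∣ 2 * a) {α γ : ℕ} (hγ : Odd γ) :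
    HasInvariantOrderAtCusp (1 / 2) (P a c) α γ
      (1 / 4 * Int.fract (2 * (a : ℝ) * γ / c)
        - 1 / 4 * Int.fract (2 * (a : ℝ) * γ / c) ^ 2 - 1 / 16) := by
  intro A h0 h1
  obtain ⟨B, σ, b0, b1, hJ, hAB⟩ := exists_conjugate_odd (A := A)
    (by rw [h1]; exact_mod_cast hγ)
  rw [h0] at b0
  rw [h1] at b1
  have hb1 : ((B 1 0 : ℤ) : ℝ) * (2 * a / c) = 2 * a * γ / c := by
    rw [b1]; push_cast; ring
  have hb0 : Int.fract (((B 0 0 : ℤ) : ℝ) / 2) = 0 := by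
    rw [b0, Int.fract_eq_iff]
    exact ⟨le_rfl, one_pos, α, by push_cast; ring⟩
  have hr := hasInvariantOrder_P (ρ := 2 * a / c) (by push_cast; rfl)
    (isRat_two_mul_div a c) (two_mul_div_ne_int hc hac) (by rw [h1]; positivity) one_half_pos
    (isRat_one.div (isRat_ofNat 2)) (by norm_num) hJ hAB (by rw [hb1]) hb0
  convert hr using 1
  ring

end OverpartitionRank

end

theorem mainTheorem6 (a c : ℤ) (hc : 0 < c) (hac : ¬ c ∣ 2 * a)
    (α γ : ℕ) (hαγ : Nat.gcd α γ = 1) :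
    (Even γ →
      OverpartitionRank.HolomorphicPartOrderAtCuspAtLeast (1 / 2) (OverpartitionRank.N a c) α γ
        (-((a : ℝ) ^ 2 * (γ : ℝ) ^ 2 / (c : ℝ) ^ 2) + (a : ℝ) * γ / c - 1 / 4
          + 2 * OverpartitionRank.nuTilde ((a : ℝ) * γ / c) (1 / 2))) ∧
    (Odd γ →
      OverpartitionRank.HolomorphicPartOrderAtCuspAtLeast (1 / 2) (OverpartitionRank.N a c) α γ
        (-((a : ℝ) ^ 2 * (γ : ℝ) ^ 2 / (c : ℝ) ^ 2) + (a : ℝ) * α * γ / c - (α : ℝ) ^ 2 / 4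
          + 1 / 2 * OverpartitionRank.nuTilde (2 * (a : ℝ) * γ / c) (α : ℝ))) ∧
    (Even γ →
      OverpartitionRank.HasInvariantOrderAtCusp (1 / 2) (OverpartitionRank.P a c) α γ
        (Int.fract ((a : ℝ) * γ / c) - Int.fract ((a : ℝ) * γ / c) ^ 2)) ∧
    (Odd γ →
      OverpartitionRank.HasInvariantOrderAtCusp (1 / 2) (OverpartitionRank.P a c) α γ
        (1 / 4 * Int.fract (2 * (a : ℝ) * γ / c)
          - 1 / 4 * Int.fract (2 * (a : ℝ) * γ / c) ^ 2 - 1 / 16)) :=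
  ⟨OverpartitionRank.order_N_even hc hac hαγ, OverpartitionRank.order_N_odd hc hac,
    OverpartitionRank.order_P_even hc hac hαγ, OverpartitionRank.order_P_odd hc hac⟩
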